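/- Let $\mathsf C$ be a compact connected oriented 1-manifold (diffeomorphic to the oriented circle $\mathbb R/\mathbb Z$), presented as $\mathsf C=\widetilde{\mathsf C}/\mathbb Z$ with universal cover $\widetilde{\mathsf C}$, and let $\kappa$ be the diffeomorphism of $\widetilde{\mathsf C}$ given by the generator of the $\mathbb Z$-action (a translation in the positive direction). A developing map is an orientation preserving local diffeomorphism $\gamma\colon\widetilde{\mathsf C}\to\mathbb{RP}(1)$ such that $\gamma(\kappa x)=h\cdot\gamma(x)$ for some $h\in \mathrm{PSL}(2,\mathbb R)$; here $\mathbb{RP}(1)=\mathbb R/\pi\mathbb Z$ via $\phi\mapsto(\sin\phi:\cos\phi)$. Let $\mathcal D(\mathsf C)\subset C^\infty(\widetilde{\mathsf C},\mathbb{RP}(1))$ be the space of developing maps. The group $\mathrm{PSL}(2,\mathbb R)$ acts on it by $(g\cdot\gamma)(x)=g\cdot\gamma(x)$, and the group $\mathrm{Diff}_{\mathbb Z}(\widetilde{\mathsf C})$ of $\mathbb Z$-equivariant diffeomorphisms of $\widetilde{\mathsf C}$ acts by $\mathsf F\cdot\gamma=\gamma\circ\mathsf F^{-1}$. For $X\in\mathfrak{sl}(2,\mathbb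 R)$ let $X_{\mathcal D}|_\gamma=\frac{d}{dt}|_{t=0}\exp(-tX)\cdot\gamma$, and for a vector field $v$ on $\mathsf C$ with flow $\exp(tv)$, lifted to $\widetilde{\mathsf C}$, let $v_{\mathcal D}|_\gamma=\frac{d}{dt}|_{t=0}\,\gamma\circ\exp(-tv)$. Let $q\colon\mathcal D(\mathsf C)\to\widetilde{\mathrm{SL}}(2,\mathbb R)$ take $\gamma=(\sin\phi:\cos\phi)$ to its lifted monodromy, i.e. the element $\widetilde h$ of the universal cover of $\mathrm{SL}(2,\mathbb R)$ with $\phi(\kappa x)=\widetilde h\cdot\phi(x)$ for the lifted action on $\mathbb R$. Let $p$ take $\gamma$ to the Hill operator $L$ on $\mathsf C$ with fundamental system of solutions $u_1=(\phi')^{-1/2}\sin\phi$, $u_2=(\phi')^{-1/2}\cos\phi$; in a parametrization $\mathsf C\cong\mathbb R/\mathbb Z$ it is $L=\frac{d^2}{dx^2}+\mathcal T$ with $\mathcal T=(\phi')^2+\frac12\big(\frac{\phi'''}{\phi'}-\frac32(\frac{\phi''}{\phi'})^2\big)$, and $dL$ is the 1-form $d\mathcal T$ on the affine space of Hill operators with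 values in quadratic differentials on $\mathsf C$. Let $\theta^L,\theta^R$ be the left- and right-invariant Maurer-Cartan forms on $\widetilde{\mathrm{SL}}(2,\mathbb R)$ and $\eta=\frac16\operatorname{tr}(\theta^L\wedge[\theta^L,\theta^L])$ the Cartan 3-form. Then for every such $\mathsf C$ there is a 2-form $\varpi_{\mathcal D}\in\Omega^2(\mathcal D(\mathsf C))$, where differential forms on $\mathcal D(\mathsf C)$ are taken in the diffeological sense (given by their pullbacks to all smooth finite-dimensional families of developing maps), which is natural (for every $\mathbb Z$-equivariant diffeomorphism $\widetilde{\mathsf C}_1\to\widetilde{\mathsf C}_2$, the induced map $\mathcal D(\mathsf C_2)\to\mathcal D(\mathsf C_1)$ pulls the form on $\mathcal D(\mathsf C_1)$ back to the form on $\mathcal D(\mathsf C_2)$) and has the following properties. (a) $d\varpi_{\mathcal D}=q^*\eta$. (b) $\varpi_{\mathcal D}$ is $\mathrm{PSL}(2,\mathbb R)$-invariant, and $\iota(X_{\mathcal D})\varpi_{\mathcal D}=\operatorname{tr}\big(X\,q^*(\theta^L+\theta^R)\big)$ for all $X\in\mathfrak{sl}(2,\mathbb R)$. (c) $\varpi_{\mathcal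 D}$ is $\mathrm{Diff}_{\mathbb Z}(\widetilde{\mathsf C})$-invariant, and $\iota(v_{\mathcal D})\varpi_{\mathcal D}=-2\,p^*\int_{\mathsf C}(dL)\,v$ for all vector fields $v$ on $\mathsf C$. -/

import Mathlib

open scoped Manifold ContDiff LinearAlgebra.Projectivization Matrix MatrixGroups Topology

noncomputable section

namespace Virasoro

/-! ### Differential forms on diffeological spaces -/

/-- A differential `k`-form on a diffeological space `M`: a smooth `k`-form `pull p` on `ℝⁿ` for
every plot `p : ℝⁿ → M` (the pullback of the form along `p`), compatible with smooth
reparametrizations of the plots.  (The values of `pull` on maps that are not plots are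
irrelevant.) -/
structure DForm (M : Type*) [DiffeologicalSpace M] (k : ℕ) where
  pull : ∀ {n : ℕ}, (EuclideanSpace ℝ (Fin n) → M) →
    EuclideanSpace ℝ (Fin n) → EuclideanSpace ℝ (Fin n) [⋀^Fin k]→L[ℝ] ℝ
  smooth : ∀ {n : ℕ} (p : EuclideanSpace ℝ (Fin n) → M), Diffeology.IsPlot p →
    ContDiff ℝ ∞ (pull p)
  reparam : ∀ {m n : ℕ} (p : EuclideanSpace ℝ (Fin n) → M)
    (g : EuclideanSpace ℝ (Fin m) → EuclideanSpace ℝ (Fin n)),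
    Diffeology.IsPlot p → ContDiff ℝ ∞ g →
    ∀ s, pull (p ∘ g) s = (pull p (g s)).compContinuousLinearMap (fderiv ℝ g s)

/-- For a 2-form `α` on `M`, a smooth family of maps `ρ t : M → M` with `ρ 0 = id` and generating
vector field `Y = d/dt|₀ ρ t`, this is the pullback along the plot `p` of the 1-form `ι(Y)α`,
evaluated at the point `s` on the vector `w`: on the plot `(t, s) ↦ ρ t (p s)` one evaluates `α`
at `(0, s)` on the pair `∂/∂t, w`. -/
def DForm.contract {M : Type*} [DiffeologicalSpace M] (α : DForm M 2) (ρ : ℝ → M → M) {n : ℕ}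
    (p : EuclideanSpace ℝ (Fin n) → M) (s w : EuclideanSpace ℝ (Fin n)) : ℝ :=
  α.pull (n := n + 1) (fun z => ρ (z 0) (p (WithLp.toLp 2 fun i : Fin n => z i.succ)))
    (WithLp.toLp 2 (Fin.cons 0 fun i : Fin n => s i))
    ![EuclideanSpace.single 0 1, WithLp.toLp 2 (Fin.cons 0 fun i : Fin n => w i)]

/-! ### The circle `C`, its universal cover and `ℤ`-equivariant diffeomorphisms -/

/-- A compact connected oriented 1-manifold `C` (that is, a manifold diffeomorphic to the oriented
circle `ℝ/ℤ`), presented as `C = X/ℤ`: here `X` is the universal cover and `κ` is the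
diffeomorphism of `X` given by the generator of the `ℤ`-action.  The orientation is the one for
which `κ` is a translation in the positive direction. -/
structure CircleCover where
  X : Type*
  [top : TopologicalSpace X]
  [charted : ChartedSpace ℝ X]
  [mfd : IsManifold 𝓘(ℝ, ℝ) ∞ X]
  κ : X ≃ₘ⟮𝓘(ℝ, ℝ), 𝓘(ℝ, ℝ)⟯ X
  exists_param : ∃ c : ℝ ≃ₘ⟮𝓘(ℝ, ℝ), 𝓘(ℝ, ℝ)⟯ X, ∀ x, c (x + 1) = κ (c x)

attribute [instance] CircleCover.top CircleCover.charted CircleCover.mfd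

/-- A `ℤ`-equivariant diffeomorphism between the universal covers.  In particular,
`Iso C C` is the group `Diff_ℤ` of `ℤ`-equivariant diffeomorphisms of the universal cover. -/
structure Iso (C₁ C₂ : CircleCover) where
  toDiffeo : C₁.X ≃ₘ⟮𝓘(ℝ, ℝ), 𝓘(ℝ, ℝ)⟯ C₂.X
  map_κ : ∀ x, toDiffeo (C₁.κ x) = C₂.κ (toDiffeo x)

/-- The inverse of an equivariant diffeomorphism. -/
def Iso.symm {C₁ C₂ : CircleCover} (Φ : Iso C₁ C₂) : Iso C₂ C₁ where
  toDiffeo := Φ.toDiffeo.symm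
  map_κ x := by
    have h := Φ.map_κ (Φ.toDiffeo.symm x)
    rw [Diffeomorph.apply_symm_apply] at h
    rw [← h, Diffeomorph.symm_apply_apply]

/-- Composition of equivariant diffeomorphisms. -/
def Iso.trans {C₁ C₂ C₃ : CircleCover} (Φ : Iso C₁ C₂) (Ψ : Iso C₂ C₃) : Iso C₁ C₃ where
  toDiffeo := Φ.toDiffeo.trans Ψ.toDiffeo
  map_κ x := by simp [Φ.map_κ, Ψ.map_κ]

/-- The translation `x ↦ x + 1` of `ℝ`. -/
def translation : ℝ ≃ₘ⟮𝓘(ℝ, ℝ), 𝓘(ℝ, ℝ)⟯ ℝ where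
  toEquiv := Equiv.addRight 1
  contMDiff_toFun := (contDiff_id.add contDiff_const).contMDiff
  contMDiff_invFun := by
    have h : ContDiff ℝ ∞ fun x : ℝ => x + -1 := contDiff_id.add contDiff_const
    exact h.contMDiff

/-- The standard circle `ℝ/ℤ`, with universal cover `ℝ`. -/
def stdCircle : CircleCover where
  X := ℝ
  κ := translation
  exists_param := ⟨Diffeomorph.refl _ _ _, fun _ => rfl⟩

/-- A parametrization of `C` by the oriented circle `ℝ/ℤ`, lifted to the universal covers. -/
abbrev CircleCover.Param (C : CircleCover) := Iso stdCircle C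

/-- The underlying map `ℝ → X` of a parametrization. -/
def CircleCover.Param.map {C : CircleCover} (c : C.Param) : ℝ → C.X := c.toDiffeo

/-- The inverse `X → ℝ` of a parametrization. -/
def CircleCover.Param.inv {C : CircleCover} (c : C.Param) : C.X → ℝ := c.toDiffeo.symm

/-- Smooth vector fields on `C`: `ℤ`-invariant smooth vector fields on the universal cover. -/
structure Vect (C : CircleCover) where
  toFun : ∀ x : C.X, TangentSpace 𝓘(ℝ, ℝ) x
  smooth : ContMDiff 𝓘(ℝ, ℝ) 𝓘(ℝ, ℝ).tangent ∞
    fun x => (⟨x, toFun x⟩ : TangentBundle 𝓘(ℝ, ℝ) C.X)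
  invariant : ∀ x, mfderiv 𝓘(ℝ, ℝ) 𝓘(ℝ, ℝ) C.κ x (toFun x) = toFun (C.κ x)

/-- The coefficient function `f` of the vector field `v = f ∂/∂x` in a parametrization. -/
def Vect.coeff {C : CircleCover} (v : Vect C) (c : C.Param) (x : ℝ) : ℝ :=
  mfderiv 𝓘(ℝ, ℝ) 𝓘(ℝ, ℝ) c.inv (c.map x) (v.toFun (c.map x))

/-- `F t = exp(tv)` is the flow of the vector field `v`, acting on the universal cover. -/
structure IsFlow {C : CircleCover} (v : Vect C) (F : ℝ → Iso C C) : Prop where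
  add : ∀ s t x, (F (s + t)).toDiffeo x = (F s).toDiffeo ((F t).toDiffeo x)
  smooth : ContMDiff (𝓘(ℝ, ℝ).prod 𝓘(ℝ, ℝ)) 𝓘(ℝ, ℝ) ∞
    fun z : ℝ × C.X => (F z.1).toDiffeo z.2
  integral : ∀ x, IsMIntegralCurve (I := 𝓘(ℝ, ℝ)) (fun t => (F t).toDiffeo x) v.toFun

/-! ### The projective line -/

/-- The real projective line. -/
abbrev RP1 := ℙ ℝ (Fin 2 → ℝ)

/-- The group `PSL(2,ℝ)`. -/
abbrev PSL2R := Matrix.ProjectiveSpecialLinearGroup (Fin 2) ℝ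

theorem sin_cos_ne_zero (φ : ℝ) : ![Real.sin φ, Real.cos φ] ≠ 0 := by
  intro h
  have h0 := congrFun h 0
  have h1 := congrFun h 1
  have h2 := Real.sin_sq_add_cos_sq φ
  simp at h0 h1
  rw [h0, h1] at h2
  norm_num at h2

/-- The universal covering `ℝ → ℝP(1)`, `φ ↦ (sin φ : cos φ)`; it identifies `ℝP(1)` with
`ℝ/πℤ` and defines its smooth structure and orientation. -/
def rp (φ : ℝ) : RP1 := Projectivization.mk ℝ ![Real.sin φ, Real.cos φ] (sin_cos_ne_zero φ)

/-- The action of `SL(2,ℝ)` on `ℝP(1)` is by orientation preserving local diffeomorphisms. -/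
theorem exists_smul_lift (A : SL(2, ℝ)) (φ₀ : ℝ) : ∃ m : ℝ → ℝ, ContDiffAt ℝ ∞ m φ₀ ∧
    0 < deriv m φ₀ ∧ ∀ᶠ φ in 𝓝 φ₀, A • rp φ = rp (m φ) := by
  have hdet : A 0 0 * A 1 1 - A 0 1 * A 1 0 = 1 := by
    have h := A.det_coe
    rwa [Matrix.det_fin_two] at h
  set a : ℝ → ℝ := fun φ => A 0 0 * Real.sin φ + A 0 1 * Real.cos φ with ha
  set b : ℝ → ℝ := fun φ => A 1 0 * Real.sin φ + A 1 1 * Real.cos φ with hb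
  obtain ⟨r, ψ, hr, h1, h2⟩ : ∃ r ψ : ℝ, 0 < r ∧ a φ₀ = r * Real.sin ψ ∧
      b φ₀ = r * Real.cos ψ := by
    refine ⟨‖(⟨b φ₀, a φ₀⟩ : ℂ)‖, Complex.arg ⟨b φ₀, a φ₀⟩, ?_, ?_, ?_⟩
    · rw [norm_pos_iff]
      intro h
      have hb0 : b φ₀ = 0 := congrArg Complex.re h
      have ha0 : a φ₀ = 0 := congrArg Complex.im h
      have hs : Real.sin φ₀ = A 1 1 * a φ₀ - A 0 1 * b φ₀ := by
        simp only [ha, hb]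
        linear_combination (-Real.sin φ₀) * hdet
      have hc : Real.cos φ₀ = A 0 0 * b φ₀ - A 1 0 * a φ₀ := by
        simp only [ha, hb]
        linear_combination (-Real.cos φ₀) * hdet
      have h2 := Real.sin_sq_add_cos_sq φ₀
      rw [hs, hc, ha0, hb0] at h2
      norm_num at h2
    · exact (Complex.norm_mul_sin_arg (⟨b φ₀, a φ₀⟩ : ℂ)).symm
    · exact (Complex.norm_mul_cos_arg (⟨b φ₀, a φ₀⟩ : ℂ)).symm
  have had : ∀ φ, HasDerivAt a (A 0 0 * Real.cos φ - A 0 1 * Real.sin φ) φ := fun φ => by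
    have h := ((Real.hasDerivAt_sin φ).const_mul (A 0 0)).add
      ((Real.hasDerivAt_cos φ).const_mul (A 0 1))
    convert! h using 1
    ring
  have hbd : ∀ φ, HasDerivAt b (A 1 0 * Real.cos φ - A 1 1 * Real.sin φ) φ := fun φ => by
    have h := ((Real.hasDerivAt_sin φ).const_mul (A 1 0)).add
      ((Real.hasDerivAt_cos φ).const_mul (A 1 1))
    convert! h using 1
    ring
  have hac : ContDiff ℝ ∞ a :=
    (contDiff_const.mul Real.contDiff_sin).add (contDiff_const.mul Real.contDiff_cos)
  have hbc : ContDiff ℝ ∞ b :=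
    (contDiff_const.mul Real.contDiff_sin).add (contDiff_const.mul Real.contDiff_cos)
  set P : ℝ → ℝ := fun φ => a φ * Real.sin ψ + b φ * Real.cos ψ with hP
  set Q : ℝ → ℝ := fun φ => a φ * Real.cos ψ - b φ * Real.sin ψ with hQ
  have hPc : ContDiff ℝ ∞ P := (hac.mul contDiff_const).add (hbc.mul contDiff_const)
  have hQc : ContDiff ℝ ∞ Q := (hac.mul contDiff_const).sub (hbc.mul contDiff_const)
  have hsc := Real.sin_sq_add_cos_sq ψ
  have hP0 : P φ₀ = r := by
    simp only [hP, h1, h2]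
    linear_combination r * hsc
  have hQ0 : Q φ₀ = 0 := by
    simp only [hQ, h1, h2]
    ring
  have hPpos : ∀ᶠ φ in 𝓝 φ₀, 0 < P φ :=
    hPc.continuous.continuousAt.eventually (lt_mem_nhds (by rw [hP0]; exact hr))
  have hP0' : P φ₀ ≠ 0 := by rw [hP0]; exact hr.ne'
  refine ⟨fun φ => ψ + Real.arctan (Q φ / P φ), ?_, ?_, ?_⟩
  · exact contDiffAt_const.add
      (Real.contDiff_arctan.contDiffAt.comp φ₀ (hQc.contDiffAt.div hPc.contDiffAt hP0'))
  · have hQd := ((had φ₀).mul_const (Real.cos ψ)).sub ((hbd φ₀).mul_const (Real.sin ψ))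
    have hPd := ((had φ₀).mul_const (Real.sin ψ)).add ((hbd φ₀).mul_const (Real.cos ψ))
    have hm := ((hQd.div hPd hP0').arctan).const_add ψ
    have hm' : HasDerivAt (fun φ => ψ + Real.arctan (Q φ / P φ)) _ φ₀ := hm
    rw [hm'.deriv]
    change 0 < 1 / (1 + (Q φ₀ / P φ₀) ^ 2) * ((_ * P φ₀ - Q φ₀ * _) / P φ₀ ^ 2)
    rw [hQ0, hP0]
    have hkey : ((A 0 0 * Real.cos φ₀ - A 0 1 * Real.sin φ₀) * Real.cos ψ -
        (A 1 0 * Real.cos φ₀ - A 1 1 * Real.sin φ₀) * Real.sin ψ) * r = 1 := by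
      have e1 : A 0 0 * Real.sin φ₀ + A 0 1 * Real.cos φ₀ = r * Real.sin ψ := h1
      have e2 : A 1 0 * Real.sin φ₀ + A 1 1 * Real.cos φ₀ = r * Real.cos ψ := h2
      have e3 := Real.sin_sq_add_cos_sq φ₀
      linear_combination (-(A 0 0 * Real.cos φ₀ - A 0 1 * Real.sin φ₀)) * e2 +
        (A 1 0 * Real.cos φ₀ - A 1 1 * Real.sin φ₀) * e1 + (Real.sin φ₀ ^ 2 + Real.cos φ₀ ^ 2) * hdet
        + e3
    rw [hkey]
    simp
    positivity
  · filter_upwards [hPpos] with φ hφ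
    set t := Real.arctan (Q φ / P φ) with ht
    have hct : 0 < Real.cos t := Real.cos_arctan_pos _
    have hst : Real.sin t * P φ = Real.cos t * Q φ := by
      have h := Real.tan_arctan (Q φ / P φ)
      rw [← ht, Real.tan_eq_sin_div_cos, div_eq_div_iff hct.ne' hφ.ne'] at h
      linarith
    have hrp : A • rp φ = Projectivization.mk ℝ (A • ![Real.sin φ, Real.cos φ])
      ((smul_ne_zero_iff_ne A).mpr (sin_cos_ne_zero φ)) := rfl
    rw [hrp, rp, Projectivization.mk_eq_mk_iff']
    refine ⟨P φ / Real.cos t, ?_⟩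
    have hsm : A • ![Real.sin φ, Real.cos φ] = ![a φ, b φ] := by
      change (A : Matrix (Fin 2) (Fin 2) ℝ) *ᵥ ![Real.sin φ, Real.cos φ] = _
      ext i
      fin_cases i <;> simp [Matrix.mulVec, dotProduct, Fin.sum_univ_two, ha, hb]
    rw [hsm]
    have hPe : P φ = a φ * Real.sin ψ + b φ * Real.cos ψ := rfl
    have hQe : Q φ = a φ * Real.cos ψ - b φ * Real.sin ψ := rfl
    ext i
    fin_cases i
    · simp only [Fin.zero_eta, Pi.smul_apply, Matrix.cons_val_zero, smul_eq_mul]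
      rw [Real.sin_add, div_mul_eq_mul_div, div_eq_iff hct.ne']
      linear_combination Real.cos ψ * hst + Real.cos t * Real.sin ψ * hPe +
        Real.cos t * Real.cos ψ * hQe + a φ * Real.cos t * hsc
    · simp only [Fin.mk_one, Pi.smul_apply, Matrix.cons_val_one, Matrix.cons_val_fin_one,
        smul_eq_mul]
      rw [Real.cos_add, div_mul_eq_mul_div, div_eq_iff hct.ne']
      linear_combination (-Real.sin ψ) * hst + Real.cos t * Real.cos ψ * hPe -
        Real.cos t * Real.sin ψ * hQe + b φ * Real.cos t * hsc

/-! ### Developing maps -/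

/-- A developing map: an orientation preserving local diffeomorphism `γ : X → ℝP(1)` which is
quasi-periodic, `γ(κ x) = h · γ(x)` for some `h ∈ PSL(2,ℝ)`.  That `γ` is an orientation preserving
local diffeomorphism means that locally `γ = (sin φ : cos φ)` with `φ` smooth and `φ' > 0`. -/
structure DevMap (C : CircleCover) where
  toFun : C.X → RP1
  localDiffeo : ∀ x : C.X, ∃ φ : C.X → ℝ, ContMDiffAt 𝓘(ℝ, ℝ) 𝓘(ℝ, ℝ) ∞ φ x ∧
    (∀ᶠ y in 𝓝 x, toFun y = rp (φ y)) ∧ ∀ c : C.Param, 0 < deriv (φ ∘ c.map) (c.inv x)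
  quasiPeriodic : ∃ h : PSL2R, ∀ x, toFun (C.κ x) = h • toFun x

/-- The family `p` of developing maps is smooth on `U`: the map `(s, x) ↦ p(s)(x) ∈ ℝP(1)` is
smooth, i.e. locally of the form `(sin φ : cos φ)` with a smooth function `φ` of `(s, x)`. -/
def IsSmoothFamilyOn {C : CircleCover} {n : ℕ} (p : EuclideanSpace ℝ (Fin n) → DevMap C)
    (U : Set (EuclideanSpace ℝ (Fin n))) : Prop :=
  ∀ s ∈ U, ∀ x : C.X, ∃ φ : EuclideanSpace ℝ (Fin n) × C.X → ℝ,
    ContMDiffAt (𝓘(ℝ, EuclideanSpace ℝ (Fin n)).prod 𝓘(ℝ, ℝ)) 𝓘(ℝ, ℝ) ∞ φ (s, x) ∧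
    ∀ᶠ z in 𝓝 (s, x), (p z.1).toFun z.2 = rp (φ z)

/-- The space `𝒟(C)` of developing maps, as a subspace of `C^∞(X, ℝP(1))`: the smooth maps
`ℝⁿ → 𝒟(C)` are the smooth families of developing maps. -/
instance (C : CircleCover) : DiffeologicalSpace (DevMap C) := .ofCorePlotsOn {
  isPlotOn := fun {_ U} _ p => IsSmoothFamilyOn p U
  isPlotOn_congr := by
    have key : ∀ {n : ℕ} {U : Set (EuclideanSpace ℝ (Fin n))} (_ : IsOpen U)
        {p q : EuclideanSpace ℝ (Fin n) → DevMap C}, Set.EqOn p q U → IsSmoothFamilyOn p U →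
        IsSmoothFamilyOn q U := by
      intro n U hU p q h hp s hs x
      obtain ⟨φ, h1, h2⟩ := hp s hs x
      refine ⟨φ, h1, ?_⟩
      have hU' : ∀ᶠ z : EuclideanSpace ℝ (Fin n) × C.X in 𝓝 (s, x), z.1 ∈ U :=
        continuousAt_fst.eventually (hU.mem_nhds hs)
      filter_upwards [h2, hU'] with z hz hzU
      rw [← h hzU]
      exact hz
    intro n U hU p q h
    exact ⟨key hU h, key hU h.symm⟩
  isPlot_const := by
    intro n γ s _ x
    obtain ⟨φ, h1, h2, -⟩ := γ.localDiffeo x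
    refine ⟨fun z => φ z.2, ?_, (continuousAt_snd (p := (s, x))).eventually h2⟩
    exact ContMDiffAt.comp (s, x) (g := φ) h1 contMDiffAt_snd
  isPlotOn_reparam := by
    intro n m U V hU hV p f hf hp hfs s hs x
    obtain ⟨φ, h1, h2⟩ := hp (f s) (hf hs) x
    have hfs' : ContDiffAt ℝ ∞ f s := hfs.contDiffAt (hV.mem_nhds hs)
    have hg : ContMDiffAt (𝓘(ℝ, EuclideanSpace ℝ (Fin m)).prod 𝓘(ℝ, ℝ))
        (𝓘(ℝ, EuclideanSpace ℝ (Fin n)).prod 𝓘(ℝ, ℝ)) ∞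
        (fun z : EuclideanSpace ℝ (Fin m) × C.X => (f z.1, z.2)) (s, x) :=
      (ContMDiffAt.comp (s, x) (g := f) hfs'.contMDiffAt contMDiffAt_fst).prodMk contMDiffAt_snd
    exact ⟨fun z => φ (f z.1, z.2), ContMDiffAt.comp (s, x) (g := φ) h1 hg,
      hg.continuousAt.eventually h2⟩
  locality := by
    intro n U hU p hp s hs x
    obtain ⟨V, hV, hsV, h⟩ := hp s hs
    exact h s hsV x }

/-- The action of `PSL(2,ℝ)` on developing maps, `(g · γ)(x) = g · γ(x)`. -/
instance (C : CircleCover) : SMul PSL2R (DevMap C) where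
  smul g γ :=
    { toFun := fun x => g • γ.toFun x
      localDiffeo := by
        intro x
        induction g using QuotientGroup.induction_on with | _ A => ?_
        obtain ⟨φ, h1, h2, h3⟩ := γ.localDiffeo x
        obtain ⟨m, m1, m2, m3⟩ := exists_smul_lift A (φ x)
        refine ⟨m ∘ φ, ContMDiffAt.comp x m1.contMDiffAt h1, ?_, ?_⟩
        · filter_upwards [h2, h1.continuousAt.eventually m3] with y hy hy'
          rw [hy]
          exact hy'
        · intro c
          have hx : c.map (c.inv x) = x := c.toDiffeo.apply_symm_apply x
          have hd : DifferentiableAt ℝ (φ ∘ c.map) (c.inv x) :=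
            differentiableAt_of_deriv_ne_zero (h3 c).ne'
          have hm : DifferentiableAt ℝ m ((φ ∘ c.map) (c.inv x)) := by
            rw [Function.comp_apply, hx]
            exact m1.differentiableAt (by simp)
          rw [Function.comp_assoc, deriv_comp _ hm hd, Function.comp_apply, hx]
          exact mul_pos m2 (h3 c)
      quasiPeriodic := by
        obtain ⟨h, hh⟩ := γ.quasiPeriodic
        exact ⟨g * h * g⁻¹, fun x => by simp [mul_smul, hh]⟩ }

/-- The pullback `γ ∘ Φ` of a developing map under an equivariant diffeomorphism. -/
def DevMap.pullback {C₁ C₂ : CircleCover} (Φ : Iso C₁ C₂) (γ : DevMap C₂) : DevMap C₁ where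
  toFun x := γ.toFun (Φ.toDiffeo x)
  localDiffeo := by
    intro x
    obtain ⟨φ, h1, h2, h3⟩ := γ.localDiffeo (Φ.toDiffeo x)
    refine ⟨φ ∘ Φ.toDiffeo, ContMDiffAt.comp x h1 Φ.toDiffeo.contMDiff.contMDiffAt,
      Φ.toDiffeo.continuous.continuousAt.eventually h2, ?_⟩
    intro c
    have h := h3 (c.trans Φ)
    have e : CircleCover.Param.inv (c.trans Φ) (Φ.toDiffeo x) = c.inv x :=
      congrArg c.toDiffeo.symm (Φ.toDiffeo.symm_apply_apply x)
    rw [e] at h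
    exact h
  quasiPeriodic := by
    obtain ⟨h, hh⟩ := γ.quasiPeriodic
    exact ⟨h, fun x => by rw [Φ.map_κ, hh]⟩

/-- The action of `Diff_ℤ` on developing maps, `F · γ = γ ∘ F⁻¹`. -/
def diffAct {C : CircleCover} (F : Iso C C) (γ : DevMap C) : DevMap C := γ.pullback F.symm

/-! ### The map `p` to Hill operators -/

/-- A local lift of `γ` near `x`: `γ = (sin φ : cos φ)` near `x`, with `φ` smooth.  It is unique,
near `x`, up to adding a multiple of `π`. -/
def DevMap.localLift {C : CircleCover} (γ : DevMap C) (x : C.X) : C.X → ℝ :=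
  (γ.localDiffeo x).choose

/-- The normalized lift `u = (φ')^{-1/2} (sin φ, cos φ)` of `γ` in the parametrization `c`, near
the point with parameter `x`; the `-1/2`-densities `u₁, u₂` are identified with functions of the
parameter.  They have Wronskian `u₁ u₂' - u₂ u₁' = -1`, and `γ = (u₁ : u₂)`. -/
def DevMap.normalizedLift {C : CircleCover} (γ : DevMap C) (c : C.Param) (x : ℝ) :
    Fin 2 → ℝ → ℝ :=
  let φ : ℝ → ℝ := γ.localLift (c.map x) ∘ c.map
  ![fun y => deriv φ y ^ (-(1 / 2) : ℝ) * Real.sin (φ y),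
    fun y => deriv φ y ^ (-(1 / 2) : ℝ) * Real.cos (φ y)]

/-- The Hill operator `L = p(γ)` in the parametrization `c`: the second order operator with
principal symbol `1` whose kernel is spanned by the normalized lift `u₁, u₂` of `γ`,
`L u = -det (∂*∂u, ∂*∂u₁, ∂*∂u₂; ∂u, ∂u₁, ∂u₂; u, u₁, u₂)` where `∂*∂u = -u''`. -/
def DevMap.hill {C : CircleCover} (γ : DevMap C) (c : C.Param) (u : ℝ → ℝ) (x : ℝ) : ℝ :=
  let u₁ := γ.normalizedLift c x 0
  let u₂ := γ.normalizedLift c x 1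
  (-Matrix.det !![-deriv (deriv u) x, -deriv (deriv u₁) x, -deriv (deriv u₂) x;
                  deriv u x, deriv u₁ x, deriv u₂ x;
                  u x, u₁ x, u₂ x])

/-- The Hill potential `𝒯` of `L = p(γ)` in the parametrization `c`: `L u = u'' + 𝒯 u`, so that
`𝒯 = L 1`. -/
def DevMap.hillPotential {C : CircleCover} (γ : DevMap C) (c : C.Param) (x : ℝ) : ℝ :=
  γ.hill c (fun _ => 1) x

/-- The 1-form `p^* ∫_C (dL) v` on `𝒟(C)`, pulled back along the plot `p` and evaluated at `s` on
`w`, computed in the parametrization `c`: `dL` is multiplication by the quadratic differential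
`d𝒯`, which is paired with the vector field `v`. -/
def hillPairing {C : CircleCover} (c : C.Param) (v : Vect C) {n : ℕ}
    (p : EuclideanSpace ℝ (Fin n) → DevMap C) (s w : EuclideanSpace ℝ (Fin n)) : ℝ :=
  ∫ x in (0 : ℝ)..1, fderiv ℝ (fun s' => (p s').hillPotential c x) s w * v.coeff c x

/-! ### The map `q` to the universal cover of `SL(2,ℝ)` -/

/-- The universal cover of `SL(2,ℝ)`: its elements are the pairs of a matrix `A ∈ SL(2,ℝ)` and a
continuous lift to `ℝ`, under `φ ↦ (sin φ, cos φ)`, of the action of `A` on the circle of rays in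
`ℝ²`. -/
structure SLTilde where
  mat : SL(2, ℝ)
  lift : C(ℝ, ℝ)
  lifts : ∀ φ, ∃ r : ℝ, 0 < r ∧
    mat.1 *ᵥ ![Real.sin φ, Real.cos φ] = r • ![Real.sin (lift φ), Real.cos (lift φ)]

instance : Inhabited SLTilde :=
  ⟨⟨1, ContinuousMap.id ℝ, fun _ => ⟨1, one_pos, by simp⟩⟩⟩

/-- `h` is the lifted monodromy of `γ`: for a global lift `φ`, so that `γ = (sin φ : cos φ)`,
`φ(κ x) = h · φ(x)`. -/
def DevMap.IsLiftedMonodromy {C : CircleCover} (γ : DevMap C) (h : SLTilde) : Prop :=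
  ∃ φ : C.X → ℝ, Continuous φ ∧ (∀ x, γ.toFun x = rp (φ x)) ∧ ∀ x, φ (C.κ x) = h.lift (φ x)

/-- The map `q` taking a developing map to its (unique) lifted monodromy. -/
def DevMap.q {C : CircleCover} (γ : DevMap C) : SLTilde :=
  Classical.epsilon γ.IsLiftedMonodromy

section MaurerCartan

variable {n : ℕ} (h : EuclideanSpace ℝ (Fin n) → SLTilde) (s : EuclideanSpace ℝ (Fin n))

/-- The derivative at `s` of the matrix-valued function underlying `h`, in the direction `w`. -/
def dMat (w : EuclideanSpace ℝ (Fin n)) : Matrix (Fin 2) (Fin 2) ℝ :=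
  Matrix.of fun i j => fderiv ℝ (fun s' => (h s').mat i j) s w

/-- The pullback `h^*θ^L` of the left-invariant Maurer-Cartan form. -/
def thetaL (w : EuclideanSpace ℝ (Fin n)) : Matrix (Fin 2) (Fin 2) ℝ :=
  ((h s).mat⁻¹).1 * dMat h s w

/-- The pullback `h^*θ^R` of the right-invariant Maurer-Cartan form. -/
def thetaR (w : EuclideanSpace ℝ (Fin n)) : Matrix (Fin 2) (Fin 2) ℝ :=
  dMat h s w * ((h s).mat⁻¹).1

/-- The 2-form `[h^*θ^L, h^*θ^L]`, whose value on `(w, w')` is `2[θ^L(w), θ^L(w')]`. -/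
def thetaBracket (w w' : EuclideanSpace ℝ (Fin n)) : Matrix (Fin 2) (Fin 2) ℝ :=
  2 • ⁅thetaL h s w, thetaL h s w'⁆

/-- The pullback `h^*η` of the Cartan 3-form `η = (1/6) tr(θ^L ∧ [θ^L, θ^L])`. -/
def cartanForm (w : Fin 3 → EuclideanSpace ℝ (Fin n)) : ℝ :=
  (1 / 6) * ((thetaL h s (w 0) * thetaBracket h s (w 1) (w 2)).trace
    - (thetaL h s (w 1) * thetaBracket h s (w 0) (w 2)).trace
    + (thetaL h s (w 2) * thetaBracket h s (w 0) (w 1)).trace)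

end MaurerCartan

/-! ### One-parameter subgroups of `PSL(2,ℝ)` -/

/-- The Lie algebra `𝔰𝔩(2,ℝ)`. -/
abbrev sl2R := LieAlgebra.SpecialLinear.sl (Fin 2) ℝ

theorem det_exp_sl2 (X : sl2R) : (NormedSpace.exp X.1).det = 1 := by
  have htr : X.1.trace = 0 := LinearMap.mem_ker.1 X.2
  rw [Matrix.trace_fin_two] at htr
  let J : Matrix (Fin 2) (Fin 2) ℝ := !![0, 1; -1, 0]
  have hJ : J * (-J) = 1 := by
    ext i j
    fin_cases i <;> fin_cases j <;> simp [J, Matrix.mul_apply, Fin.sum_univ_two]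
  have hJi : J⁻¹ = -J := Matrix.inv_eq_right_inv hJ
  have hJu : IsUnit J := (Matrix.isUnit_iff_isUnit_det J).2 (by simp [J, Matrix.det_fin_two])
  have hadj : ∀ M : Matrix (Fin 2) (Fin 2) ℝ, M.adjugate = J * Mᵀ * J⁻¹ := by
    intro M
    rw [hJi, Matrix.adjugate_fin_two, Matrix.mul_assoc]
    ext i j
    fin_cases i <;> fin_cases j <;> simp [J, Matrix.mul_apply, Fin.sum_univ_two]
  have hX : J * (X.1)ᵀ * J⁻¹ = -X.1 := by
    rw [← hadj, Matrix.adjugate_fin_two]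
    ext i j
    fin_cases i <;> fin_cases j <;> simp <;> linarith
  have h1 : (NormedSpace.exp X.1).adjugate = NormedSpace.exp (-X.1) := by
    rw [hadj, ← hX, Matrix.exp_conj _ _ hJu, Matrix.exp_transpose]
  have h2 := Matrix.mul_adjugate (NormedSpace.exp X.1)
  have h3 := congrFun (congrFun h2 0) 0
  rw [h1, Matrix.exp_neg, Matrix.mul_nonsing_inv _
    ((Matrix.isUnit_iff_isUnit_det _).1 (Matrix.isUnit_exp X.1))] at h3
  simpa using h3.symm

/-- The exponential map `𝔰𝔩(2,ℝ) → PSL(2,ℝ)`. -/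
def expPSL (X : sl2R) : PSL2R := QuotientGroup.mk (⟨NormedSpace.exp X.1, det_exp_sl2 X⟩ : SL(2, ℝ))

end Virasoro

end

open Virasoro

universe u

/-! A family of developing maps over `ℝⁿ` has, in a parametrization of the circle, a normalized
lift: smooth functions `a`, `b` of `(s, x)` with γ = (a : b) and a'b − ab' = 1. Let T be its Hill
potential, Ψ the fundamental matrix with rows (a', a), (b', b), and ε_w = b δ_w a − a δ_w b the
vector field on the cover that generates the variation in the direction w. With κ^* the shift x ↦ x
+ 1, the 2-form is ϖ(v, w) = ∫₀¹ (ε_v δ_w T − ε_w δ_v T) dx + ½ (B(κ^*ε_v, ε_w) − B(κ^*ε_w,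
ε_v))(0). Here B is `pairing`, and ½ B(ε_v, ε_w) = tr(Ψ⁻¹δ_vΨ · Ψ⁻¹δ_wΨ) by `connMat_eps` and
`trace_connMat_mul`.

Three identities for commuting derivations carry the proof: the variation 2δT = ε''' + 4Tε' + 2T'ε
(`variation_pot`), the flatness δ₁ε₂ − δ₂ε₁ = ε₁ε₂' − ε₁'ε₂ (`curvature_gen`), and B(e, f)' = −(e ·
2δ_f T + 2δ_e T · f) (`d_pairing` with `variation_pot`).

Exterior derivative: the differential of the integrand is half the x-derivative of the Wronskian of
ε₁, ε₂, ε₃ (`cyclic_integrand`). The boundary term turns the difference of the end values into half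
the Wronskian of the fields κ^*ε − ε (`cyclic_boundary`). Their matrices are conjugate to M⁻¹δM for
the monodromy matrix M, and the Wronskian becomes the Cartan form.

Contractions: along exp(−tX) the potential does not move, so the integrand is a derivative and only
boundary values remain (`twoForm_of_linear`). Along a flow ε_t is periodic, and the boundary term
doubles half of the integrand and cancels the rest (`twoForm_of_periodic`).

The form does not depend on the lift, since lifts differ by a sign and all terms are quadratic, nor
on the parametrization, since a reparametrization only moves the base point 0 (`twoForm_substitute`,
`baseChange`). Naturality and invariance under diffeomorphisms are then immediate: pulling back by a
diffeomorphism keeps the pair `a`, `b` and changes the parametrization. -/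

noncomputable section

namespace Virasoro

/-! ### Parametric integrals of smooth functions -/

section ParametricIntegral

variable {E F : Type*} [NormedAddCommGroup E] [NormedSpace ℝ E] [NormedAddCommGroup F]
  [NormedSpace ℝ F]

theorem hasFDerivAt_integral_of_contDiff {f : E × ℝ → F} (hf : ContDiff ℝ 1 f) (s : E) :
    HasFDerivAt (fun s => ∫ x in (0 : ℝ)..1, f (s, x))
      (∫ x in (0 : ℝ)..1, (fderiv ℝ f (s, x)).comp (ContinuousLinearMap.inl ℝ E ℝ)) s := by
  have hc : Continuous fun z : E × ℝ =>
      (fderiv ℝ f z).comp (ContinuousLinearMap.inl ℝ E ℝ) :=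
    (hf.continuous_fderiv one_ne_zero).clm_comp continuous_const
  have hcx : ∀ s : E, Continuous fun x : ℝ => (s, x) := fun s => by fun_prop
  obtain ⟨M, hM⟩ : ∃ M, ∀ x ∈ Set.Icc (0 : ℝ) 1,
      ‖(fderiv ℝ f (s, x)).comp (ContinuousLinearMap.inl ℝ E ℝ)‖ < M := by
    obtain ⟨M, hM⟩ := isCompact_Icc.exists_bound_of_continuousOn
      ((hc.comp (hcx s)).continuousOn (s := Set.Icc (0 : ℝ) 1))
    exact ⟨M + 1, fun x hx => (hM x hx).trans_lt (lt_add_one M)⟩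
  -- Compactness of the interval makes the strict bound on the slice over `s` persist over a
  -- neighbourhood of `s`, which gives the dominating constant.
  have hnhds : {s' : E | ∀ x ∈ Set.Icc (0 : ℝ) 1,
      ‖(fderiv ℝ f (s', x)).comp (ContinuousLinearMap.inl ℝ E ℝ)‖ < M} ∈ 𝓝 s := by
    have h : ∀ᶠ s' in 𝓝 s, ∀ x ∈ Set.Icc (0 : ℝ) 1,
        ‖(fderiv ℝ f (s', x)).comp (ContinuousLinearMap.inl ℝ E ℝ)‖ < M := by
      refine isCompact_Icc.eventually_forall_of_forall_eventually fun x hx => ?_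
      exact (hc.norm.continuousAt (x := (s, x))).eventually (gt_mem_nhds (hM x hx))
    exact h
  refine intervalIntegral.hasFDerivAt_integral_of_dominated_of_fderiv_le
    (F := fun s x => f (s, x)) (bound := fun _ => M)
    (F' := fun s x => (fderiv ℝ f (s, x)).comp (ContinuousLinearMap.inl ℝ E ℝ)) hnhds ?_ ?_ ?_ ?_
    intervalIntegrable_const ?_
  · exact .of_forall fun s' => (hf.continuous.comp (hcx s')).aestronglyMeasurable
  · exact (hf.continuous.comp (hcx s)).intervalIntegrable _ _
  · exact (hc.comp (hcx s)).aestronglyMeasurable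
  · refine .of_forall fun x hx s' hs' => (hs' x ?_).le
    rw [Set.uIoc_of_le zero_le_one] at hx
    exact ⟨hx.1.le, hx.2⟩
  · refine .of_forall fun x _ s' _ => ?_
    exact ((hf.differentiable one_ne_zero).differentiableAt.hasFDerivAt).comp s'
      (hasFDerivAt_prodMk_left s' x)

end ParametricIntegral

universe v

/-- The induction replaces `F` by `E →L[ℝ] F`, which is why `F` is quantified inside and shares its
universe with `E`. -/
theorem contDiff_nat_integral {E : Type v} [NormedAddCommGroup E] [NormedSpace ℝ E] (n : ℕ) :
    ∀ {F : Type v} [NormedAddCommGroup F] [NormedSpace ℝ F] {f : E × ℝ → F}, ContDiff ℝ ∞ f →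
      ContDiff ℝ n (fun s => ∫ x in (0 : ℝ)..1, f (s, x)) := by
  induction n with
  | zero =>
    intro F _ _ f hf
    refine contDiff_zero.2 ?_
    exact intervalIntegral.continuous_parametric_intervalIntegral_of_continuous'
      (f := fun s x => f (s, x)) hf.continuous 0 1
  | succ n ih =>
    intro F _ _ f hf
    rw [Nat.cast_succ]
    refine contDiff_succ_iff_hasFDerivAt.2 ⟨_, ?_,
      hasFDerivAt_integral_of_contDiff (hf.of_le (by simp))⟩
    exact ih ((hf.fderiv_right (m := ∞) (by simp)).clm_comp contDiff_const)

theorem contDiff_integral {E F : Type v} [NormedAddCommGroup E] [NormedSpace ℝ E]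
    [NormedAddCommGroup F] [NormedSpace ℝ F] {f : E × ℝ → F} (hf : ContDiff ℝ ∞ f) :
    ContDiff ℝ ∞ (fun s => ∫ x in (0 : ℝ)..1, f (s, x)) :=
  contDiff_infty.2 fun n => contDiff_nat_integral n hf

/-! ### The algebra of smooth functions -/

section SmoothFn

variable (V : Type*) [NormedAddCommGroup V] [NormedSpace ℝ V]

/-- The smooth functions on a normed space, as a subalgebra of all functions. -/
def smoothSubalgebra : Subalgebra ℝ (V → ℝ) where
  carrier := {f | ContDiff ℝ ∞ f}
  mul_mem' {f g} hf hg := show ContDiff ℝ ∞ (f * g) from ContDiff.mul hf hg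
  add_mem' {f g} hf hg := show ContDiff ℝ ∞ (f + g) from ContDiff.add hf hg
  algebraMap_mem' r := show ContDiff ℝ ∞ fun _ : V => r from contDiff_const

/-- The algebra of smooth functions on a normed space. -/
def SmoothFn : Type _ := smoothSubalgebra V

instance : CommRing (SmoothFn V) := inferInstanceAs (CommRing (smoothSubalgebra V))

instance : Algebra ℝ (SmoothFn V) := inferInstanceAs (Algebra ℝ (smoothSubalgebra V))

variable {V} {V' : Type*} [NormedAddCommGroup V'] [NormedSpace ℝ V']

namespace SmoothFn

theorem contDiff (f : SmoothFn V) : ContDiff ℝ ∞ f.1 := f.2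

theorem differentiableAt (f : SmoothFn V) (z : V) : DifferentiableAt ℝ f.1 z :=
  (f.contDiff.differentiable (by simp)).differentiableAt

@[simp] theorem add_val (f g : SmoothFn V) (z : V) : (f + g).1 z = f.1 z + g.1 z := rfl
@[simp] theorem sub_val (f g : SmoothFn V) (z : V) : (f - g).1 z = f.1 z - g.1 z := rfl
@[simp] theorem neg_val (f : SmoothFn V) (z : V) : (-f).1 z = -f.1 z := rfl
@[simp] theorem mul_val (f g : SmoothFn V) (z : V) : (f * g).1 z = f.1 z * g.1 z := rfl
@[simp] theorem smul_val (r : ℝ) (f : SmoothFn V) (z : V) : (r • f).1 z = r * f.1 z := rfl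
@[simp] theorem one_val (z : V) : (1 : SmoothFn V).1 z = 1 := rfl
@[simp] theorem zero_val (z : V) : (0 : SmoothFn V).1 z = 0 := rfl

theorem ext_val {f g : SmoothFn V} (h : ∀ z, f.1 z = g.1 z) : f = g := Subtype.ext (funext h)

/-- The directional derivative. -/
def dir (v : V) : Derivation ℝ (SmoothFn V) (SmoothFn V) :=
  Derivation.mk'
    { toFun := fun f => ⟨fun z => fderiv ℝ f.1 z v,
        (f.contDiff.fderiv_right (m := ∞) (by simp)).clm_apply contDiff_const⟩
      map_add' := fun f g => ext_val fun z => by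
        change fderiv ℝ (f.1 + g.1) z v = _
        rw [fderiv_add (f.differentiableAt z) (g.differentiableAt z)]
        rfl
      map_smul' := fun r f => ext_val fun z => by
        change fderiv ℝ (r • f.1) z v = _
        rw [fderiv_const_smul (f.differentiableAt z)]
        rfl }
    fun f g => ext_val fun z => by
      change fderiv ℝ (f.1 * g.1) z v = _
      rw [fderiv_mul (f.differentiableAt z) (g.differentiableAt z)]
      rfl

theorem dir_val (v : V) (f : SmoothFn V) (z : V) : (dir v f).1 z = fderiv ℝ f.1 z v := rfl

theorem dir_mul (v : V) (f g : SmoothFn V) : dir v (f * g) = dir v f * g + f * dir v g := by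
  rw [Derivation.leibniz, smul_eq_mul, smul_eq_mul]
  ring

theorem dir_add_left (v w : V) (f : SmoothFn V) : dir (v + w) f = dir v f + dir w f :=
  ext_val fun z => map_add (fderiv ℝ f.1 z) v w

theorem dir_smul_left (r : ℝ) (v : V) (f : SmoothFn V) : dir (r • v) f = r • dir v f :=
  ext_val fun z => map_smul (fderiv ℝ f.1 z) r v

theorem dir_comm (v w : V) (f : SmoothFn V) : dir v (dir w f) = dir w (dir v f) := by
  refine ext_val fun z => ?_
  have hd : DifferentiableAt ℝ (fderiv ℝ f.1) z :=
    ((f.contDiff.fderiv_right (m := ∞) (by simp)).differentiable (by simp)).differentiableAt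
  have key : ∀ v w, (dir v (dir w f)).1 z = fderiv ℝ (fderiv ℝ f.1) z v w := fun v w => by
    change fderiv ℝ (fun z => fderiv ℝ f.1 z w) z v = _
    rw [fderiv_clm_apply hd (differentiableAt_const w)]
    simp
  rw [key, key]
  exact ((contDiff_infty.1 f.contDiff 2).contDiffAt.isSymmSndFDerivAt (by simp)).eq v w

/-- Pullback of smooth functions along a smooth map. -/
def comp (G : V' → V) (hG : ContDiff ℝ ∞ G) : SmoothFn V →ₐ[ℝ] SmoothFn V' where
  toFun f := ⟨fun z => f.1 (G z), f.contDiff.comp hG⟩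
  map_one' := rfl
  map_mul' _ _ := rfl
  map_zero' := rfl
  map_add' _ _ := rfl
  commutes' _ := rfl

theorem dir_comp_val (G : V' → V) (hG : ContDiff ℝ ∞ G) (f : SmoothFn V) (v z : V') :
    (dir v (comp G hG f)).1 z = (dir (fderiv ℝ G z v) f).1 (G z) := by
  change fderiv ℝ (f.1 ∘ G) z v = _
  rw [fderiv_comp _ (f.differentiableAt _) (hG.differentiable (by simp)).differentiableAt]
  rfl

end SmoothFn

end SmoothFn

/-! ### Smooth functions of a parameter and of the circle variable -/

section Family

open SmoothFn

variable {E : Type*} [NormedAddCommGroup E] [NormedSpace ℝ E]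

/-- The derivative in the circle direction. -/
abbrev dx : Derivation ℝ (SmoothFn (E × ℝ)) (SmoothFn (E × ℝ)) := dir (0, 1)

/-- The derivative in a parameter direction. -/
abbrev ds (w : E) : Derivation ℝ (SmoothFn (E × ℝ)) (SmoothFn (E × ℝ)) := dir (w, 0)

theorem ds_add (v w : E) (f : SmoothFn (E × ℝ)) : ds (v + w) f = ds v f + ds w f := by
  rw [← dir_add_left, Prod.mk_add_mk, add_zero]

theorem ds_smul (r : ℝ) (w : E) (f : SmoothFn (E × ℝ)) : ds (r • w) f = r • ds w f := by
  rw [← dir_smul_left, Prod.smul_mk, smul_zero]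

/-- The deck transformation `f(s, x) ↦ f(s, x + 1)`. -/
def shift : SmoothFn (E × ℝ) →ₐ[ℝ] SmoothFn (E × ℝ) :=
  comp (fun z => (z.1, z.2 + 1)) (by fun_prop)

@[simp] theorem shift_val (f : SmoothFn (E × ℝ)) (s : E) (x : ℝ) :
    (shift f).1 (s, x) = f.1 (s, x + 1) := rfl

theorem dir_shift (v : E × ℝ) (f : SmoothFn (E × ℝ)) : dir v (shift f) = shift (dir v f) := by
  refine ext_val fun z => ?_
  have h : HasFDerivAt (fun z : E × ℝ => (z.1, z.2 + 1)) (ContinuousLinearMap.id ℝ (E × ℝ)) z := by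
    have := (hasFDerivAt_fst (𝕜 := ℝ) (p := z)).prodMk
      ((hasFDerivAt_snd (𝕜 := ℝ) (p := z)).add_const (1 : ℝ))
    exact this
  rw [shift, dir_comp_val, h.fderiv]
  rfl

theorem hasDerivAt_snd (f : SmoothFn (E × ℝ)) (s : E) (x : ℝ) :
    HasDerivAt (fun x => f.1 (s, x)) ((dx f).1 (s, x)) x := by
  have h := (f.differentiableAt (s, x)).hasFDerivAt.comp x (hasFDerivAt_prodMk_right s x)
  have h' := h.hasDerivAt
  exact h'

theorem hasFDerivAt_fst' (f : SmoothFn (E × ℝ)) (s : E) (x : ℝ) :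
    HasFDerivAt (fun s => f.1 (s, x))
      ((fderiv ℝ f.1 (s, x)).comp (ContinuousLinearMap.inl ℝ E ℝ)) s :=
  (f.differentiableAt (s, x)).hasFDerivAt.comp s (hasFDerivAt_prodMk_left s x)

theorem fderiv_fst (f : SmoothFn (E × ℝ)) (s w : E) (x : ℝ) :
    fderiv ℝ (fun s => f.1 (s, x)) s w = (ds w f).1 (s, x) := by
  rw [(hasFDerivAt_fst' f s x).fderiv]
  rfl

theorem continuous_snd (f : SmoothFn (E × ℝ)) (s : E) : Continuous fun x => f.1 (s, x) :=
  f.contDiff.continuous.comp (by fun_prop)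

theorem integral_dx (f : SmoothFn (E × ℝ)) (s : E) (x y : ℝ) :
    ∫ t in x..y, (dx f).1 (s, t) = f.1 (s, y) - f.1 (s, x) :=
  intervalIntegral.integral_eq_sub_of_hasDerivAt (fun t _ => hasDerivAt_snd f s t)
    ((continuous_snd (dx f) s).intervalIntegrable _ _)

theorem fderiv_integral (f : SmoothFn (E × ℝ)) (s w : E) :
    fderiv ℝ (fun s => ∫ x in (0 : ℝ)..1, f.1 (s, x)) s w =
      ∫ x in (0 : ℝ)..1, (ds w f).1 (s, x) := by
  have hc : Continuous fun x : ℝ =>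
      (fderiv ℝ f.1 (s, x)).comp (ContinuousLinearMap.inl ℝ E ℝ) :=
    ((f.contDiff.continuous_fderiv (by simp)).comp (by fun_prop)).clm_comp continuous_const
  rw [(hasFDerivAt_integral_of_contDiff (f.contDiff.of_le (by simp)) s).fderiv,
    ContinuousLinearMap.intervalIntegral_apply (hc.intervalIntegrable _ _)]
  rfl

end Family

/-! ### Alternating forms with smooth coefficients -/

section AltForm

variable {E V : Type} [NormedAddCommGroup E] [NormedSpace ℝ E] [FiniteDimensional ℝ E]
  [NormedAddCommGroup V] [NormedSpace ℝ V]

/-- Evaluation of a bilinear form with smooth coefficients at a point. -/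
def bilinAt (B : E →ₗ[ℝ] E →ₗ[ℝ] SmoothFn V) (z : V) : E →L[ℝ] E →L[ℝ] ℝ :=
  LinearMap.toContinuousLinearMap
    { toFun := fun w => LinearMap.toContinuousLinearMap
        { toFun := fun w' => (B w w').1 z
          map_add' := fun _ _ => by simp
          map_smul' := fun _ _ => by simp }
      map_add' := fun _ _ => by ext; simp
      map_smul' := fun _ _ => by ext; simp }

theorem bilinAt_apply (B : E →ₗ[ℝ] E →ₗ[ℝ] SmoothFn V) (z : V) (w w' : E) :
    bilinAt B z w w' = (B w w').1 z := rfl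

/-- The alternation `B(w, w') - B(w', w)` of a bilinear form with smooth coefficients. -/
def altForm (B : E →ₗ[ℝ] E →ₗ[ℝ] SmoothFn V) (z : V) : E [⋀^Fin 2]→L[ℝ] ℝ :=
  ContinuousAlternatingMap.alternatizeUncurryFinCLM ℝ E ℝ
    ((ContinuousAlternatingMap.ofSubsingletonLIE (𝕜 := ℝ) (E := E) (F := ℝ) (0 : Fin 1)
      ).toContinuousLinearEquiv.toContinuousLinearMap.comp (bilinAt B z))

theorem altForm_apply (B : E →ₗ[ℝ] E →ₗ[ℝ] SmoothFn V) (z : V) (w : Fin 2 → E) :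
    altForm B z w = (B (w 0) (w 1)).1 z - (B (w 1) (w 0)).1 z := by
  change ContinuousAlternatingMap.alternatizeUncurryFin _ w = _
  rw [ContinuousAlternatingMap.alternatizeUncurryFin_apply, Fin.sum_univ_two]
  simp [Fin.removeNth, ContinuousAlternatingMap.ofSubsingletonLIE, bilinAt_apply, sub_eq_add_neg]
  rfl

theorem contDiff_altForm (B : E →ₗ[ℝ] E →ₗ[ℝ] SmoothFn V) : ContDiff ℝ ∞ (altForm B) := by
  refine (ContinuousLinearMap.contDiff _).comp (contDiff_const.clm_comp ?_)
  refine contDiff_clm_apply_iff.2 fun w => contDiff_clm_apply_iff.2 fun w' => ?_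
  exact (B w w').contDiff

end AltForm

/-! ### Algebraic identities for normalized lifts

In a commutative ring with a derivation `d`, a pair `a, b` with `(d a) b - a (d b) = 1` is a
fundamental system of solutions of `d² u + T u = 0`. -/

section Algebra

variable {R : Type*} [CommRing R] [Algebra ℝ R]

/-- The potential of the Hill operator with solutions `a`, `b`. -/
def pot (d : Derivation ℝ R R) (a b : R) : R := d (d a) * d b - d (d b) * d a

/-- The vector field that generates the variation `δ` of the pair `a`, `b`. -/
def gen (δ : Derivation ℝ R R) (a b : R) : R := b * δ a - a * δ b

/-- Twice the trace of the product of the matrices associated with the vector fields `e`, `f`. -/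
def pairing (d : Derivation ℝ R R) (T e f : R) : R :=
  d e * d f - e * d (d f) - d (d e) * f - 4 * (T * e * f)

/-- The Wronskian of three elements. -/
def wr3 (d : Derivation ℝ R R) (e f g : R) : R :=
  e * (d f * d (d g) - d g * d (d f)) - f * (d e * d (d g) - d g * d (d e)) +
    g * (d e * d (d f) - d f * d (d e))

theorem derivation_mul (d : Derivation ℝ R R) (x y : R) : d (x * y) = d x * y + x * d y := by
  rw [Derivation.leibniz, smul_eq_mul, smul_eq_mul]
  ring

theorem pairing_comm (d : Derivation ℝ R R) (T e f : R) : pairing d T e f = pairing d T f e := by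
  unfold pairing
  ring

variable {d δ δ₁ δ₂ δ₃ : Derivation ℝ R R} {a b : R}

/-- Differentiating the Wronskian condition gives a''b = ab'', so that a'' and b'' have the same
ratio to a and b. -/
theorem dd_eq_left (h : d a * b - a * d b = 1) : d (d a) = -(pot d a b * a) := by
  have h1 := congrArg d h
  simp only [map_sub, derivation_mul, Derivation.map_one_eq_zero] at h1
  unfold pot
  linear_combination (-d (d a)) * h + d a * h1

theorem dd_eq_right (h : d a * b - a * d b = 1) : d (d b) = -(pot d a b * b) := by
  have h1 := congrArg d h
  simp only [map_sub, derivation_mul, Derivation.map_one_eq_zero] at h1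
  unfold pot
  linear_combination (-d (d b)) * h + d b * h1

theorem d_gen (h : d a * b - a * d b = 1) (hc : ∀ x, d (δ x) = δ (d x)) :
    d (gen δ a b) = 2 * (d b * δ a - d a * δ b) := by
  have h1 := congrArg δ h
  simp only [map_sub, derivation_mul, Derivation.map_one_eq_zero] at h1
  simp only [gen, map_sub, derivation_mul, hc]
  linear_combination h1

/-- The two formulas for the derivative of `gen` agree because the variation of the Wronskian
vanishes. They match the two diagonal entries in `connMat_eps`. -/
theorem d_gen' (h : d a * b - a * d b = 1) (hc : ∀ x, d (δ x) = δ (d x)) :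
    d (gen δ a b) = 2 * (b * δ (d a) - a * δ (d b)) := by
  have h1 := congrArg δ h
  simp only [map_sub, derivation_mul, Derivation.map_one_eq_zero] at h1
  simp only [gen, map_sub, derivation_mul, hc]
  linear_combination -h1

theorem dd_gen (h : d a * b - a * d b = 1) (hc : ∀ x, d (δ x) = δ (d x)) :
    d (d (gen δ a b)) =
      2 * (d b * δ (d a) - d a * δ (d b)) - 2 * (pot d a b * gen δ a b) := by
  have ha := dd_eq_left h
  have hb := dd_eq_right h
  rw [d_gen h hc]
  have h2 : d (2 : R) = 0 := by
    have := d.map_natCast 2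
    simpa using this
  simp only [map_sub, derivation_mul, hc, h2]
  unfold gen
  linear_combination 2 * δ a * hb - 2 * δ b * ha

/-- This is the infinitesimal action of a vector field on Hill potentials. It comes from
differentiating `dd_gen` and eliminating second derivatives by Hill's equation. -/
theorem variation_pot (h : d a * b - a * d b = 1) (hc : ∀ x, d (δ x) = δ (d x)) :
    2 * δ (pot d a b) = d (d (d (gen δ a b))) + 4 * (pot d a b * d (gen δ a b)) +
      2 * (d (pot d a b) * gen δ a b) := by
  have ha := dd_eq_left h
  have hb := dd_eq_right h
  have ha' := congrArg δ ha
  have hb' := congrArg δ hb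
  have e1 := d_gen h hc
  have e2 := d_gen' h hc
  have h2 : d (2 : R) = 0 := by
    have := d.map_natCast 2
    simpa using this
  rw [dd_gen h hc]
  simp only [map_sub, map_neg, derivation_mul, hc, h2] at ha' hb' ⊢
  rw [ha', hb', ha, hb]
  linear_combination (-pot d a b) * e1 - pot d a b * e2 - 2 * δ (pot d a b) * h

/-- One entry of the Maurer-Cartan equation for Ψ⁻¹δΨ: the matrix commutator corresponds to the Lie
bracket of vector fields. -/
theorem curvature_gen (h : d a * b - a * d b = 1) (hc₁ : ∀ x, d (δ₁ x) = δ₁ (d x))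
    (hc₂ : ∀ x, d (δ₂ x) = δ₂ (d x)) (hc : ∀ x, δ₁ (δ₂ x) = δ₂ (δ₁ x)) :
    δ₁ (gen δ₂ a b) - δ₂ (gen δ₁ a b) =
      gen δ₁ a b * d (gen δ₂ a b) - d (gen δ₁ a b) * gen δ₂ a b := by
  rw [d_gen h hc₁, d_gen h hc₂]
  simp only [gen, map_sub, derivation_mul, hc]
  linear_combination (2 * (δ₁ a * δ₂ b - δ₁ b * δ₂ a)) * h

/-- The variation of twice the potential `T` under the vector field `e`. -/
def potVar (d : Derivation ℝ R R) (T e : R) : R := d (d (d e)) + 4 * (T * d e) + 2 * (d T * e)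

/-- The operator `potVar` is skew-adjoint, so the symmetrized product is a total derivative, and
`pairing` is minus its primitive. -/
theorem d_pairing (d : Derivation ℝ R R) (T e f : R) :
    d (pairing d T e f) = -(e * potVar d T f + potVar d T e * f) := by
  have h4 : d (4 : R) = 0 := by
    have := d.map_natCast 4
    simpa using this
  simp only [pairing, potVar, map_sub, derivation_mul, h4]
  ring

/-- The second variations of `T` cancel and flatness leaves the sum of (e₁e₂' − e₁'e₂) · 2δ₃T over
the cyclic permutations. Expanding 2δT, the terms with `T` and `d T` form determinants with a
repeated row; the third derivatives form the derivative of the Wronskian. -/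
theorem cyclic_integrand {T e₁ e₂ e₃ : R} (hc₁₂ : ∀ x, δ₁ (δ₂ x) = δ₂ (δ₁ x))
    (hc₁₃ : ∀ x, δ₁ (δ₃ x) = δ₃ (δ₁ x)) (hc₂₃ : ∀ x, δ₂ (δ₃ x) = δ₃ (δ₂ x))
    (h₁₂ : δ₁ e₂ - δ₂ e₁ = e₁ * d e₂ - d e₁ * e₂) (h₁₃ : δ₁ e₃ - δ₃ e₁ = e₁ * d e₃ - d e₁ * e₃)
    (h₂₃ : δ₂ e₃ - δ₃ e₂ = e₂ * d e₃ - d e₂ * e₃) (hT₁ : 2 * δ₁ T = potVar d T e₁)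
    (hT₂ : 2 * δ₂ T = potVar d T e₂) (hT₃ : 2 * δ₃ T = potVar d T e₃) :
    2 * (δ₁ (e₂ * δ₃ T - e₃ * δ₂ T) - δ₂ (e₁ * δ₃ T - e₃ * δ₁ T) +
      δ₃ (e₁ * δ₂ T - e₂ * δ₁ T)) = d (wr3 d e₁ e₂ e₃) := by
  simp only [map_sub, derivation_mul, hc₁₂, hc₁₃, hc₂₃, wr3, map_add, potVar] at *
  linear_combination (2 * δ₃ T) * h₁₂ - (2 * δ₂ T) * h₁₃ + (2 * δ₁ T) * h₂₃ +
    (e₁ * d e₂ - d e₁ * e₂) * hT₃ - (e₁ * d e₃ - d e₁ * e₃) * hT₂ + (e₂ * d e₃ - d e₂ * e₃) * hT₁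

/-- The Polyakov-Wiegmann identity in terms of vector fields: the Cartan form pulled back along
Ψ(1)Ψ(0)⁻¹ is the difference of the pullbacks along the two factors, up to the differential of the
mixed trace. The fields `e` and `f` stand for the variations at the two ends, and both generate the
same variation of `T`. -/
theorem cyclic_boundary {T e₁ e₂ e₃ f₁ f₂ f₃ : R} (hc₁ : ∀ x, d (δ₁ x) = δ₁ (d x))
    (hc₂ : ∀ x, d (δ₂ x) = δ₂ (d x)) (hc₃ : ∀ x, d (δ₃ x) = δ₃ (d x))
    (h₁₂ : δ₁ e₂ - δ₂ e₁ = e₁ * d e₂ - d e₁ * e₂) (h₁₃ : δ₁ e₃ - δ₃ e₁ = e₁ * d e₃ - d e₁ * e₃)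
    (h₂₃ : δ₂ e₃ - δ₃ e₂ = e₂ * d e₃ - d e₂ * e₃) (hT₁ : 2 * δ₁ T = potVar d T e₁)
    (hT₂ : 2 * δ₂ T = potVar d T e₂) (hT₃ : 2 * δ₃ T = potVar d T e₃)
    (k₁₂ : δ₁ f₂ - δ₂ f₁ = f₁ * d f₂ - d f₁ * f₂) (k₁₃ : δ₁ f₃ - δ₃ f₁ = f₁ * d f₃ - d f₁ * f₃)
    (k₂₃ : δ₂ f₃ - δ₃ f₂ = f₂ * d f₃ - d f₂ * f₃) (kT₁ : 2 * δ₁ T = potVar d T f₁)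
    (kT₂ : 2 * δ₂ T = potVar d T f₂) (kT₃ : 2 * δ₃ T = potVar d T f₃) :
    wr3 d f₁ f₂ f₃ - wr3 d e₁ e₂ e₃ +
      (δ₁ (pairing d T f₂ e₃ - pairing d T f₃ e₂) - δ₂ (pairing d T f₁ e₃ - pairing d T f₃ e₁) +
        δ₃ (pairing d T f₁ e₂ - pairing d T f₂ e₁)) =
      wr3 d (f₁ - e₁) (f₂ - e₂) (f₃ - e₃) := by
  have h4 : ∀ δ : Derivation ℝ R R, δ (4 : R) = 0 := fun δ => by
    have := δ.map_natCast 4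
    simpa using this
  have h₁₂' := congrArg d h₁₂
  have h₁₃' := congrArg d h₁₃
  have h₂₃' := congrArg d h₂₃
  have k₁₂' := congrArg d k₁₂
  have k₁₃' := congrArg d k₁₃
  have k₂₃' := congrArg d k₂₃
  have h₁₂'' := congrArg d h₁₂'
  have h₁₃'' := congrArg d h₁₃'
  have h₂₃'' := congrArg d h₂₃'
  have k₁₂'' := congrArg d k₁₂'
  have k₁₃'' := congrArg d k₁₃'
  have k₂₃'' := congrArg d k₂₃'
  simp only [map_sub, map_add, derivation_mul, hc₁, hc₂, hc₃, wr3, potVar, pairing, h4] at *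
  linear_combination (d e₃ * k₁₂' - d (d e₃) * k₁₂ - e₃ * k₁₂'' - 4 * T * e₃ * k₁₂) -
    (d e₂ * k₁₃' - d (d e₂) * k₁₃ - e₂ * k₁₃'' - 4 * T * e₂ * k₁₃) +
    (d e₁ * k₂₃' - d (d e₁) * k₂₃ - e₁ * k₂₃'' - 4 * T * e₁ * k₂₃) -
    (d f₃ * h₁₂' - d (d f₃) * h₁₂ - f₃ * h₁₂'' - 4 * T * f₃ * h₁₂) +
    (d f₂ * h₁₃' - d (d f₂) * h₁₃ - f₂ * h₁₃'' - 4 * T * f₂ * h₁₃) -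
    (d f₁ * h₂₃' - d (d f₁) * h₂₃ - f₁ * h₂₃'' - 4 * T * f₁ * h₂₃) -
    (f₂ * e₃ - f₃ * e₂) * (hT₁ + kT₁) + (f₁ * e₃ - f₃ * e₁) * (hT₂ + kT₂) -
    (f₁ * e₂ - f₂ * e₁) * (hT₃ + kT₃)

end Algebra

/-! ### The 2-form of a normalized lift and its independence of the base point -/

section TwoForm

open SmoothFn

variable {E : Type} [NormedAddCommGroup E] [NormedSpace ℝ E]

/-- The vector fields on the cover that generate the parameter variations of the lift. -/
def eps (a b : SmoothFn (E × ℝ)) (w : E) : SmoothFn (E × ℝ) := gen (ds w) a b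

theorem eps_add (a b : SmoothFn (E × ℝ)) (v w : E) : eps a b (v + w) = eps a b v + eps a b w := by
  simp only [eps, gen, ds_add]
  ring

theorem eps_smul (a b : SmoothFn (E × ℝ)) (r : ℝ) (w : E) :
    eps a b (r • w) = r • eps a b w := by
  simp only [eps, gen, ds_smul, mul_smul_comm, smul_sub]

theorem pairing_add_left (d : Derivation ℝ (SmoothFn (E × ℝ)) (SmoothFn (E × ℝ)))
    (T e e' f : SmoothFn (E × ℝ)) :
    pairing d T (e + e') f = pairing d T e f + pairing d T e' f := by
  simp only [pairing, map_add]
  ring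

theorem pairing_smul_left (d : Derivation ℝ (SmoothFn (E × ℝ)) (SmoothFn (E × ℝ)))
    (T : SmoothFn (E × ℝ)) (r : ℝ) (e f : SmoothFn (E × ℝ)) :
    pairing d T (r • e) f = r • pairing d T e f := by
  simp only [pairing, Derivation.map_smul, smul_mul_assoc, mul_smul_comm, smul_sub]

/-- The integrand of the 2-form. -/
def density (a b : SmoothFn (E × ℝ)) : E →ₗ[ℝ] E →ₗ[ℝ] SmoothFn (E × ℝ) :=
  LinearMap.mk₂ ℝ (fun w w' => eps a b w * ds w' (pot dx a b))
    (fun _ _ _ => by rw [eps_add, add_mul]) (fun _ _ _ => by rw [eps_smul, smul_mul_assoc])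
    (fun _ _ _ => by rw [ds_add, mul_add]) (fun _ _ _ => by rw [ds_smul, mul_smul_comm])

/-- The boundary term of the 2-form. -/
def boundary (a b : SmoothFn (E × ℝ)) : E →ₗ[ℝ] E →ₗ[ℝ] SmoothFn (E × ℝ) :=
  LinearMap.mk₂ ℝ
    (fun w w' => (1 / 2 : ℝ) • pairing dx (pot dx a b) (shift (eps a b w)) (eps a b w'))
    (fun _ _ _ => by rw [eps_add, map_add, pairing_add_left, smul_add])
    (fun _ _ _ => by rw [eps_smul, map_smul, pairing_smul_left, smul_comm])
    (fun _ _ _ => by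
      rw [eps_add, pairing_comm, pairing_add_left, smul_add, pairing_comm _ _ (eps _ _ _),
        pairing_comm _ _ (eps _ _ _) (shift _)])
    (fun _ _ _ => by
      rw [eps_smul, pairing_comm, pairing_smul_left, smul_comm, pairing_comm])

/-- The antisymmetrized integrand. -/
def densityAlt (a b : SmoothFn (E × ℝ)) (v w : E) : SmoothFn (E × ℝ) :=
  eps a b v * ds w (pot dx a b) - eps a b w * ds v (pot dx a b)

/-- Twice the antisymmetrized boundary term. -/
def boundaryAlt (a b : SmoothFn (E × ℝ)) (v w : E) : SmoothFn (E × ℝ) :=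
  pairing dx (pot dx a b) (shift (eps a b v)) (eps a b w) -
    pairing dx (pot dx a b) (shift (eps a b w)) (eps a b v)

section Def

variable [FiniteDimensional ℝ E]

/-- The 2-form on the parameter space defined by a normalized lift `a`, `b`. -/
def twoForm (a b : SmoothFn (E × ℝ)) (s : E) : E [⋀^Fin 2]→L[ℝ] ℝ :=
  (∫ x in (0 : ℝ)..1, altForm (density a b) (s, x)) + altForm (boundary a b) (s, 0)

theorem contDiff_twoForm (a b : SmoothFn (E × ℝ)) : ContDiff ℝ ∞ (twoForm a b) :=
  (contDiff_integral (contDiff_altForm _)).add ((contDiff_altForm _).comp (by fun_prop))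

theorem twoForm_apply (a b : SmoothFn (E × ℝ)) (s : E) (w : Fin 2 → E) :
    twoForm a b s w = (∫ x in (0 : ℝ)..1, (densityAlt a b (w 0) (w 1)).1 (s, x)) +
      (1 / 2) * (boundaryAlt a b (w 0) (w 1)).1 (s, 0) := by
  have hc : Continuous fun x : ℝ => altForm (density a b) (s, x) :=
    (contDiff_altForm _).continuous.comp (by fun_prop)
  have h1 := (ContinuousAlternatingMap.apply ℝ E ℝ w).intervalIntegral_comp_comm
    (hc.intervalIntegrable 0 1) (μ := MeasureTheory.volume)
  rw [twoForm, ContinuousAlternatingMap.add_apply]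
  have h0 : (∫ x in (0 : ℝ)..1, altForm (density a b) (s, x)) w =
      ContinuousAlternatingMap.apply ℝ E ℝ w (∫ x in (0 : ℝ)..1, altForm (density a b) (s, x)) :=
    rfl
  rw [h0, ← h1]
  congr 1
  · refine intervalIntegral.integral_congr fun x _ => ?_
    exact altForm_apply _ _ _
  · rw [altForm_apply]
    simp only [boundary, boundaryAlt, LinearMap.mk₂_apply, smul_val, sub_val]
    ring

end Def

variable {a b : SmoothFn (E × ℝ)}

theorem ds_pot (h : dx a * b - a * dx b = 1) (w : E) :
    2 * ds w (pot dx a b) = potVar dx (pot dx a b) (eps a b w) :=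
  variation_pot h fun x => dir_comm _ _ x

theorem curvature_eps (h : dx a * b - a * dx b = 1) (v w : E) :
    ds v (eps a b w) - ds w (eps a b v) =
      eps a b v * dx (eps a b w) - dx (eps a b v) * eps a b w :=
  curvature_gen h (fun x => dir_comm _ _ x) (fun x => dir_comm _ _ x) fun x => dir_comm _ _ x

theorem shift_potVar (T e : SmoothFn (E × ℝ)) :
    shift (potVar dx T e) = potVar dx (shift T) (shift e) := by
  simp only [potVar, map_add, map_mul, dir_shift, map_ofNat]

/-- Since the potential is periodic, the shifted field generates the same variation of it;
`cyclic_boundary` requires this of its second triple of fields. -/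
theorem ds_pot_shift (h : dx a * b - a * dx b = 1) (hT : shift (pot dx a b) = pot dx a b) (w : E) :
    2 * ds w (pot dx a b) = potVar dx (pot dx a b) (shift (eps a b w)) := by
  have h1 := congrArg shift (ds_pot h w)
  rwa [shift_potVar, hT, map_mul, ← dir_shift, hT, map_ofNat] at h1

theorem dx_boundaryAlt (h : dx a * b - a * dx b = 1) (hT : shift (pot dx a b) = pot dx a b)
    (v w : E) : dx (boundaryAlt a b v w) = 2 * (densityAlt a b v w - shift (densityAlt a b v w)) := by
  have hs : ∀ u : E, shift (ds u (pot dx a b)) = ds u (pot dx a b) := fun u => by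
    rw [← dir_shift, hT]
  simp only [boundaryAlt, densityAlt, map_sub, map_mul, hs, d_pairing, ← ds_pot h,
    ← ds_pot_shift h hT]
  ring

/-- By `dx_boundaryAlt`, moving the base point changes the boundary term by the opposite of what it
adds to the integral. This is needed because a reparametrization of the circle need not fix 0. -/
theorem baseChange (h : dx a * b - a * dx b = 1) (hT : shift (pot dx a b) = pot dx a b)
    (v w s : E) (y : ℝ) :
    (∫ x in y..(y + 1), (densityAlt a b v w).1 (s, x)) + (1 / 2) * (boundaryAlt a b v w).1 (s, y) =
      (∫ x in (0 : ℝ)..1, (densityAlt a b v w).1 (s, x)) +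
        (1 / 2) * (boundaryAlt a b v w).1 (s, 0) := by
  have h1 := integral_dx (boundaryAlt a b v w) s 0 y
  have hc := continuous_snd (densityAlt a b v w) s
  have hi : ∀ p q, IntervalIntegrable (fun x => (densityAlt a b v w).1 (s, x))
    MeasureTheory.volume p q := fun p q => hc.intervalIntegrable p q
  have hc' := continuous_snd (shift (densityAlt a b v w)) s
  have e : ∀ x, (dx (boundaryAlt a b v w)).1 (s, x) =
      2 * ((densityAlt a b v w).1 (s, x) - (shift (densityAlt a b v w)).1 (s, x)) := fun x => by
    rw [dx_boundaryAlt h hT, two_mul, two_mul]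
    rfl
  have h2 : ∫ x in (0 : ℝ)..y, (shift (densityAlt a b v w)).1 (s, x) =
      ∫ x in (1 : ℝ)..(y + 1), (densityAlt a b v w).1 (s, x) := by
    have := intervalIntegral.integral_comp_add_right (a := 0) (b := y)
      (fun x => (densityAlt a b v w).1 (s, x)) 1
    rw [zero_add] at this
    exact this
  simp only [e] at h1
  rw [intervalIntegral.integral_const_mul, intervalIntegral.integral_sub (hi _ _)
    (hc'.intervalIntegrable _ _), h2] at h1
  have h3 := intervalIntegral.integral_add_adjacent_intervals (hi 0 1) (hi 1 (y + 1))
  have h4 := intervalIntegral.integral_add_adjacent_intervals (hi 0 y) (hi y (y + 1))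
  linarith

/-! #### The exterior derivative -/

theorem extDeriv_twoForm [FiniteDimensional ℝ E] (h : dx a * b - a * dx b = 1)
    (hT : shift (pot dx a b) = pot dx a b) (s : E) (w : Fin 3 → E) :
    extDeriv (twoForm a b) s w = (1 / 2) *
      (wr3 dx (shift (eps a b (w 0)) - eps a b (w 0)) (shift (eps a b (w 1)) - eps a b (w 1))
        (shift (eps a b (w 2)) - eps a b (w 2))).1 (s, 0) := by
  have hd : DifferentiableAt ℝ (twoForm a b) s :=
    ((contDiff_twoForm a b).differentiable (by simp)).differentiableAt
  have key : ∀ (u : E) (v : Fin 2 → E), fderiv ℝ (twoForm a b) s u v =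
      (∫ x in (0 : ℝ)..1, (ds u (densityAlt a b (v 0) (v 1))).1 (s, x)) +
      (1 / 2) * (ds u (boundaryAlt a b (v 0) (v 1))).1 (s, 0) := by
    intro u v
    have h1 : HasFDerivAt (fun s' => twoForm a b s' v)
        ((ContinuousAlternatingMap.apply ℝ E ℝ v).comp (fderiv ℝ (twoForm a b) s)) s :=
      (ContinuousAlternatingMap.apply ℝ E ℝ v).hasFDerivAt.comp s hd.hasFDerivAt
    have h2 : fderiv ℝ (fun s' => twoForm a b s' v) s u = fderiv ℝ (twoForm a b) s u v := by
      rw [h1.fderiv]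
      rfl
    rw [← h2]
    simp only [twoForm_apply]
    have hI := (hasFDerivAt_integral_of_contDiff
      ((densityAlt a b (v 0) (v 1)).contDiff.of_le (by simp)) s)
    have hB := (hasFDerivAt_fst' (boundaryAlt a b (v 0) (v 1)) s 0).const_mul (1 / 2)
    rw [fderiv_fun_add hI.differentiableAt hB.differentiableAt, add_apply,
      fderiv_integral, hB.fderiv]
    rfl
  rw [extDeriv, ContinuousAlternatingMap.alternatizeUncurryFin_apply, Fin.sum_univ_three]
  simp only [key]
  have r0 : Fin.removeNth 0 w = ![w 1, w 2] := by
    ext i; fin_cases i <;> rfl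
  have r1 : Fin.removeNth 1 w = ![w 0, w 2] := by
    ext i; fin_cases i <;> rfl
  have r2 : Fin.removeNth 2 w = ![w 0, w 1] := by
    ext i; fin_cases i <;> rfl
  -- The integrand contributes the Wronskian at the two ends of the period; the value at 1 is then
  -- written as that of the shifted fields at 0.
  have hJ := cyclic_integrand (fun x => dir_comm _ _ x) (fun x => dir_comm _ _ x)
    (fun x => dir_comm _ _ x) (curvature_eps h (w 0) (w 1)) (curvature_eps h (w 0) (w 2))
    (curvature_eps h (w 1) (w 2)) (ds_pot h (w 0)) (ds_pot h (w 1)) (ds_pot h (w 2))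
  have hcs : ∀ v v' : E, ds v (shift (eps a b v')) - ds v' (shift (eps a b v)) =
      shift (eps a b v) * dx (shift (eps a b v')) - dx (shift (eps a b v)) * shift (eps a b v') :=
    fun v v' => by
      have := congrArg shift (curvature_eps h v v')
      simpa only [map_sub, map_mul, ← dir_shift] using this
  -- The boundary term contributes the mixed terms that complete the difference of Wronskians to the
  -- Wronskian of the differences.
  have hK := cyclic_boundary (fun x => dir_comm _ _ x) (fun x => dir_comm _ _ x)
    (fun x => dir_comm _ _ x) (curvature_eps h (w 0) (w 1)) (curvature_eps h (w 0) (w 2))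
    (curvature_eps h (w 1) (w 2)) (ds_pot h (w 0)) (ds_pot h (w 1)) (ds_pot h (w 2))
    (hcs (w 0) (w 1)) (hcs (w 0) (w 2)) (hcs (w 1) (w 2)) (ds_pot_shift h hT (w 0))
    (ds_pot_shift h hT (w 1)) (ds_pot_shift h hT (w 2))
  have hN : shift (wr3 dx (eps a b (w 0)) (eps a b (w 1)) (eps a b (w 2))) =
      wr3 dx (shift (eps a b (w 0))) (shift (eps a b (w 1))) (shift (eps a b (w 2))) := by
    simp only [wr3, map_sub, map_add, map_mul, dir_shift]
  have hI := integral_dx (wr3 dx (eps a b (w 0)) (eps a b (w 1)) (eps a b (w 2))) s 0 1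
  rw [← hJ] at hI
  have hv : (wr3 dx (eps a b (w 0)) (eps a b (w 1)) (eps a b (w 2))).1 (s, 1) =
      (wr3 dx (shift (eps a b (w 0))) (shift (eps a b (w 1))) (shift (eps a b (w 2)))).1 (s, 0) := by
    rw [← hN, shift_val, zero_add]
  rw [hv] at hI
  have hi : ∀ f : SmoothFn (E × ℝ), IntervalIntegrable (fun x => f.1 (s, x))
    MeasureTheory.volume 0 1 := fun f => (continuous_snd f s).intervalIntegrable 0 1
  have e : ∀ x, (2 * (ds (w 0) (densityAlt a b (w 1) (w 2)) - ds (w 1) (densityAlt a b (w 0) (w 2)) +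
      ds (w 2) (densityAlt a b (w 0) (w 1)))).1 (s, x) =
      2 * ((ds (w 0) (densityAlt a b (w 1) (w 2))).1 (s, x) -
        (ds (w 1) (densityAlt a b (w 0) (w 2))).1 (s, x) +
        (ds (w 2) (densityAlt a b (w 0) (w 1))).1 (s, x)) := fun x => by
    rw [two_mul, two_mul]
    rfl
  have hI' : (∫ x in (0 : ℝ)..1, 2 * ((ds (w 0) (densityAlt a b (w 1) (w 2))).1 (s, x) -
        (ds (w 1) (densityAlt a b (w 0) (w 2))).1 (s, x) +
        (ds (w 2) (densityAlt a b (w 0) (w 1))).1 (s, x))) = _ :=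
    (intervalIntegral.integral_congr fun x _ => (e x).symm).trans hI
  rw [intervalIntegral.integral_const_mul, intervalIntegral.integral_add ((hi _).sub (hi _)) (hi _),
    intervalIntegral.integral_sub (hi _) (hi _)] at hI'
  have hK' := congrArg (fun f : SmoothFn (E × ℝ) => f.1 (s, 0)) hK
  simp only [add_val, sub_val] at hK'
  rw [r0, r1, r2]
  simp only [Matrix.cons_val_zero, Matrix.cons_val_one, Fin.val_zero, Fin.val_one, Fin.val_two,
    pow_zero, pow_one, one_smul, neg_smul, even_two, Even.neg_pow, one_pow,
    Matrix.cons_val_fin_one]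
  simp only [boundaryAlt, map_sub, sub_val] at hK' ⊢
  linarith

end TwoForm

/-! #### Comparison of 2-forms -/

section TwoFormProperties

open SmoothFn

variable {E E' : Type} [NormedAddCommGroup E] [NormedSpace ℝ E] [NormedAddCommGroup E']
  [NormedSpace ℝ E']

theorem dx_congr_slice {f : SmoothFn (E × ℝ)} {f' : SmoothFn (E' × ℝ)} {s : E} {s' : E'}
    (h : ∀ x, f.1 (s, x) = f'.1 (s', x)) (x : ℝ) : (dx f).1 (s, x) = (dx f').1 (s', x) := by
  have h1 := hasDerivAt_snd f s x
  rw [show (fun x => f.1 (s, x)) = fun x => f'.1 (s', x) from funext h] at h1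
  exact h1.unique (hasDerivAt_snd f' s' x)

theorem pairing_congr_slice {T e f : SmoothFn (E × ℝ)} {T' e' f' : SmoothFn (E' × ℝ)} {s : E}
    {s' : E'} (hT : ∀ x, T.1 (s, x) = T'.1 (s', x)) (he : ∀ x, e.1 (s, x) = e'.1 (s', x))
    (hf : ∀ x, f.1 (s, x) = f'.1 (s', x)) (x : ℝ) :
    (pairing dx T e f).1 (s, x) = (pairing dx T' e' f').1 (s', x) := by
  have h1 := dx_congr_slice he
  have h2 := dx_congr_slice hf
  have h3 := dx_congr_slice h1
  have h4 := dx_congr_slice h2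
  change _ - _ - _ - (4 : ℝ) * _ = _ - _ - _ - (4 : ℝ) * _
  simp only [mul_val, hT, he, hf, h1, h2, h3, h4]

/-- Derivatives in the circle direction are determined on a slice, so the form at a point depends
only on the values listed here. The two parameter spaces may differ, with `L` relating the
directions. -/
theorem twoForm_congr [FiniteDimensional ℝ E] [FiniteDimensional ℝ E'] {a b : SmoothFn (E × ℝ)}
    {a' b' : SmoothFn (E' × ℝ)} {s : E} {s' : E'} (L : E → E')
    (he : ∀ w x, (eps a b w).1 (s, x) = (eps a' b' (L w)).1 (s', x))
    (hT : ∀ x, (pot dx a b).1 (s, x) = (pot dx a' b').1 (s', x))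
    (hdT : ∀ w x, (ds w (pot dx a b)).1 (s, x) = (ds (L w) (pot dx a' b')).1 (s', x))
    (w : Fin 2 → E) : twoForm a b s w = twoForm a' b' s' fun i => L (w i) := by
  rw [twoForm_apply, twoForm_apply]
  have hs : ∀ w x, (shift (eps a b w)).1 (s, x) = (shift (eps a' b' (L w))).1 (s', x) :=
    fun w x => he w (x + 1)
  congr 1
  · refine intervalIntegral.integral_congr fun x _ => ?_
    simp only [densityAlt, sub_val, mul_val, he, hdT]
  · simp only [boundaryAlt, sub_val]
    rw [pairing_congr_slice hT (hs _) (he _), pairing_congr_slice hT (hs _) (he _)]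

/-- Pullback along a smooth map of parameter spaces. -/
def reparam (g : E' → E) (hg : ContDiff ℝ ∞ g) : SmoothFn (E × ℝ) →ₐ[ℝ] SmoothFn (E' × ℝ) :=
  comp (fun z => (g z.1, z.2)) ((hg.comp contDiff_fst).prodMk contDiff_snd)

theorem dir_reparam (g : E' → E) (hg : ContDiff ℝ ∞ g) (f : SmoothFn (E × ℝ)) (w : E') (r : ℝ)
    (s : E') (x : ℝ) :
    (dir (w, r) (reparam g hg f)).1 (s, x) = (dir (fderiv ℝ g s w, r) f).1 (g s, x) := by
  have h : HasFDerivAt (fun z : E' × ℝ => (g z.1, z.2))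
      (((fderiv ℝ g s).comp (ContinuousLinearMap.fst ℝ E' ℝ)).prod
        (ContinuousLinearMap.snd ℝ E' ℝ)) (s, x) :=
    (((hg.differentiable (by simp)).differentiableAt.hasFDerivAt).comp (s, x)
      hasFDerivAt_fst).prodMk hasFDerivAt_snd
  rw [reparam, dir_comp_val, h.fderiv]
  rfl

theorem dx_reparam (g : E' → E) (hg : ContDiff ℝ ∞ g) (f : SmoothFn (E × ℝ)) :
    dx (reparam g hg f) = reparam g hg (dx f) := by
  refine ext_val fun z => ?_
  rw [dir_reparam, map_zero]
  rfl

theorem pot_reparam (g : E' → E) (hg : ContDiff ℝ ∞ g) (a b : SmoothFn (E × ℝ)) :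
    pot dx (reparam g hg a) (reparam g hg b) = reparam g hg (pot dx a b) := by
  simp only [pot, dx_reparam, map_sub, map_mul]

theorem twoForm_reparam [FiniteDimensional ℝ E] [FiniteDimensional ℝ E'] (g : E' → E)
    (hg : ContDiff ℝ ∞ g) (a b : SmoothFn (E × ℝ)) (s : E') (w : Fin 2 → E') :
    twoForm (reparam g hg a) (reparam g hg b) s w =
      twoForm a b (g s) fun i => fderiv ℝ g s (w i) := by
  refine twoForm_congr (fderiv ℝ g s) (fun w x => ?_) (fun x => ?_) (fun w x => ?_) w
  · simp only [eps, gen, sub_val, mul_val, dir_reparam]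
    rfl
  · rw [pot_reparam]
    rfl
  · rw [pot_reparam, dir_reparam]

/-! #### Invariance under reparametrization of the circle -/

/-- The hypotheses say that `G` is the pullback along a diffeomorphism with derivative `ρ`. -/
theorem pot_substitute {R : Type*} [CommRing R] [Algebra ℝ R] {d : Derivation ℝ R R} (G : R →+* R)
    {a b m ρ : R} (hG : ∀ f, d (G f) = ρ * G (d f)) (hm : m * m * ρ = 1)
    (h : d a * b - a * d b = 1) :
    d (m * G a) * (m * G b) - (m * G a) * d (m * G b) = 1 ∧
    m * pot d (m * G a) (m * G b) = m * ρ * ρ * G (pot d a b) - d (d m) := by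
  have hW : G (d a) * G b - G a * G (d b) = 1 := by
    rw [← map_mul, ← map_mul, ← map_sub, h, map_one]
  have hW' : d (m * G a) * (m * G b) - (m * G a) * d (m * G b) = 1 := by
    simp only [derivation_mul, hG]
    linear_combination (m * m * ρ) * hW + hm
  refine ⟨hW', ?_⟩
  have hm' : 2 * (d m * ρ) + m * d ρ = 0 := by
    have := congrArg d hm
    simp only [derivation_mul, Derivation.map_one_eq_zero] at this
    linear_combination (m * ρ) * this - (2 * (d m * ρ) + m * d ρ) * hm
  have ha := congrArg G (dd_eq_left h)
  have hb := congrArg G (dd_eq_right h)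
  rw [map_neg, map_mul] at ha hb
  have ea : d (d (m * G a)) = (d (d m) - m * ρ * ρ * G (pot d a b)) * G a := by
    simp only [derivation_mul, hG, map_add]
    linear_combination G (d a) * hm' + m * ρ * ρ * ha
  have eb : d (d (m * G b)) = (d (d m) - m * ρ * ρ * G (pot d a b)) * G b := by
    simp only [derivation_mul, hG, map_add]
    linear_combination G (d b) * hm' + m * ρ * ρ * hb
  have key : m * pot d (m * G a) (m * G b) = m * (d (d (m * G a)) * d (m * G b) -
    d (d (m * G b)) * d (m * G a)) := rfl
  rw [key, ea, eb]
  linear_combination (-(d (d m) - m * ρ * ρ * G (pot d a b))) * hW'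

/-- The vector fields are rescaled by `m * m`, the inverse of the derivative `ρ`. The second
derivatives of this factor are compensated by the Schwarzian term `d (d m)` of the new potential. -/
theorem pairing_substitute {R : Type*} [CommRing R] [Algebra ℝ R] {d : Derivation ℝ R R}
    (G : R →+* R) {m ρ T T' : R} (e f : R) (hG : ∀ f, d (G f) = ρ * G (d f)) (hm : m * m * ρ = 1)
    (hT : m * T' = m * ρ * ρ * G T - d (d m)) :
    pairing d T' (m * m * G e) (m * m * G f) = G (pairing d T e f) := by
  have hd : ∀ f, d (m * m * G f) = 2 * (m * d m) * G f + G (d f) := fun f => by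
    simp only [derivation_mul, hG]
    linear_combination G (d f) * hm
  have h2 : d (2 : R) = 0 := by
    have := d.map_natCast 2
    simpa using this
  have hdd : ∀ f, d (d (m * m * G f)) = 2 * (d m * d m + m * d (d m)) * G f +
      2 * (m * d m * ρ) * G (d f) + ρ * G (d (d f)) := fun f => by
    rw [hd, map_add, derivation_mul, derivation_mul, derivation_mul, hG, hG, h2]
    ring
  unfold pairing
  rw [hdd e, hdd f, hd e, hd f]
  simp only [map_sub, map_mul, map_ofNat]
  linear_combination (-(2 * m * d m * (G e * G (d f) + G (d e) * G f)) - G e * G (d (d f)) -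
    G (d (d e)) * G f - 4 * G T * G e * G f * (m * m * ρ + 1)) * hm -
    4 * m * m * m * G e * G f * hT

/-- Substitution of a function of the circle variable. -/
def substitute (f : ℝ → ℝ) (hf : ContDiff ℝ ∞ f) : SmoothFn (E × ℝ) →ₐ[ℝ] SmoothFn (E × ℝ) :=
  comp (fun z => (z.1, f z.2)) (contDiff_fst.prodMk (hf.comp contDiff_snd))

/-- A function of the circle variable, as a function with parameters. -/
def ofCircle (f : ℝ → ℝ) (hf : ContDiff ℝ ∞ f) : SmoothFn (E × ℝ) :=
  ⟨fun z => f z.2, hf.comp contDiff_snd⟩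

theorem ds_ofCircle (f : ℝ → ℝ) (hf : ContDiff ℝ ∞ f) (w : E) : ds w (ofCircle f hf) = 0 := by
  refine ext_val fun z => ?_
  have h : HasFDerivAt (fun z : E × ℝ => f z.2)
      ((fderiv ℝ f z.2).comp (ContinuousLinearMap.snd ℝ E ℝ)) z :=
    ((hf.differentiable (by simp)).differentiableAt.hasFDerivAt).comp z hasFDerivAt_snd
  change fderiv ℝ (fun z : E × ℝ => f z.2) z (w, 0) = 0
  rw [h.fderiv]
  simp

theorem dir_substitute (f : ℝ → ℝ) (hf : ContDiff ℝ ∞ f) (F : SmoothFn (E × ℝ)) (w : E) (r : ℝ)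
    (z : E × ℝ) : (dir (w, r) (substitute f hf F)).1 z = (dir (w, deriv f z.2 * r) F).1 (z.1, f z.2) := by
  have h : HasFDerivAt (fun z : E × ℝ => (z.1, f z.2)) ((ContinuousLinearMap.fst ℝ E ℝ).prod
      ((fderiv ℝ f z.2).comp (ContinuousLinearMap.snd ℝ E ℝ))) z :=
    hasFDerivAt_fst.prodMk
      (((hf.differentiable (by simp)).differentiableAt.hasFDerivAt).comp z hasFDerivAt_snd)
  rw [substitute, dir_comp_val, h.fderiv]
  have e : fderiv ℝ f z.2 r = deriv f z.2 * r := by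
    rw [← fderiv_apply_one_eq_deriv, mul_comm, ← smul_eq_mul, ← map_smul, smul_eq_mul, mul_one]
  simp [e]

theorem ds_substitute (f : ℝ → ℝ) (hf : ContDiff ℝ ∞ f) (F : SmoothFn (E × ℝ)) (w : E) :
    ds w (substitute f hf F) = substitute f hf (ds w F) := by
  refine ext_val fun z => ?_
  rw [dir_substitute, mul_zero]
  rfl

theorem contDiff_deriv {f : ℝ → ℝ} (hf : ContDiff ℝ ∞ f) : ContDiff ℝ ∞ (deriv f) :=
  (contDiff_infty_iff_deriv.1 hf).2

theorem dx_substitute (f : ℝ → ℝ) (hf : ContDiff ℝ ∞ f) (F : SmoothFn (E × ℝ)) :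
    dx (substitute f hf F) = ofCircle (deriv f) (contDiff_deriv hf) * substitute f hf (dx F) := by
  refine ext_val fun z => ?_
  have e : ((0 : E), deriv f z.2 * 1) = deriv f z.2 • ((0 : E), (1 : ℝ)) := by simp
  rw [dir_substitute, e, dir_smul_left]
  rfl

/-- The lifts transform as densities of weight −1/2. The integrand becomes a density of weight 1 and
the boundary term a function, so all that changes is the base point, from 0 to `f 0`. -/
theorem twoForm_substitute [FiniteDimensional ℝ E] {f : ℝ → ℝ} (hf : ContDiff ℝ ∞ f) {m : ℝ → ℝ}
    (hm : ContDiff ℝ ∞ m) (hmf : ∀ x, m x * m x * deriv f x = 1) (hf1 : ∀ x, f (x + 1) = f x + 1)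
    (hm1 : ∀ x, m (x + 1) = m x)
    {a b a' b' : SmoothFn (E × ℝ)} (h : dx a * b - a * dx b = 1)
    (hT : shift (pot dx a b) = pot dx a b)
    (ha : a' = ofCircle m hm * substitute f hf a) (hb : b' = ofCircle m hm * substitute f hf b) :
    twoForm a' b' = twoForm a b := by
  set M : SmoothFn (E × ℝ) := ofCircle m hm with hM
  set ρ : SmoothFn (E × ℝ) := ofCircle (deriv f) (contDiff_deriv hf) with hρ
  set G : SmoothFn (E × ℝ) →+* SmoothFn (E × ℝ) := (substitute f hf).toRingHom with hG
  have hMρ : M * M * ρ = 1 := ext_val fun z => hmf z.2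
  have hdG : ∀ F, dx (G F) = ρ * G (dx F) := dx_substitute f hf
  have hsG : ∀ w F, ds w (G F) = G (ds w F) := fun w F => ds_substitute f hf F w
  have hsM : ∀ w, ds w M = 0 := ds_ofCircle m hm
  have hsρ : ∀ w, ds w ρ = 0 := ds_ofCircle _ _
  have ha' : a' = M * G a := ha
  have hb' : b' = M * G b := hb
  have hGs : ∀ F, shift (G F) = G (shift F) := fun F => ext_val fun z => by
    change F.1 (z.1, f (z.2 + 1)) = F.1 (z.1, f z.2 + 1)
    rw [hf1]
  have hMs : shift M = M := ext_val fun z => hm1 z.2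
  obtain ⟨hW', hpot⟩ := pot_substitute G hdG hMρ h
  rw [← ha', ← hb'] at hW' hpot
  have heps : ∀ w, eps a' b' w = M * M * G (eps a b w) := fun w => by
    simp only [eps, gen, ha', hb', dir_mul, hsM, hsG, map_sub, map_mul]
    ring
  have hdT : ∀ w, ds w (pot dx a' b') = ρ * ρ * G (ds w (pot dx a b)) := fun w => by
    have h1 := congrArg (ds w) hpot
    -- The Schwarzian term of the new potential does not depend on the parameters, so its variation
    -- vanishes.
    rw [map_sub, dir_comm (w, 0) (0, 1) (dx M), dir_comm (w, 0) (0, 1) M, hsM, map_zero, map_zero] at h1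
    simp only [dir_mul, hsM, hsρ, hsG] at h1
    linear_combination (M * ρ) * h1 - (ds w (pot dx a' b') - ρ * ρ * G (ds w (pot dx a b))) * hMρ
  have hdens : ∀ v w, densityAlt a' b' v w = ρ * G (densityAlt a b v w) := fun v w => by
    simp only [densityAlt, heps, hdT, map_sub, map_mul]
    linear_combination (ρ * (G (eps a b v) * G (ds w (pot dx a b)) -
      G (eps a b w) * G (ds v (pot dx a b)))) * hMρ
  have hbd : ∀ v w, boundaryAlt a' b' v w = G (boundaryAlt a b v w) := fun v w => by
    simp only [boundaryAlt, heps, map_mul, hMs, hGs]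
    rw [pairing_substitute G _ _ hdG hMρ hpot, pairing_substitute G _ _ hdG hMρ hpot, map_sub]
  ext s w
  -- The base point `f 0` is the right one because `f` takes 0 and 1 to `f 0` and `f 0 + 1`.
  rw [twoForm_apply, twoForm_apply, hdens, hbd, ← baseChange h hT _ _ s (f 0)]
  congr 1
  have hsub := intervalIntegral.integral_comp_mul_deriv (a := 0) (b := 1) (f := f)
    (f' := deriv f) (g := fun x => (densityAlt a b (w 0) (w 1)).1 (s, x))
    (fun x _ => (hf.differentiable (by simp)).differentiableAt.hasDerivAt)
    (contDiff_deriv hf).continuous.continuousOn (continuous_snd _ s)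
  rw [← zero_add (1 : ℝ), hf1 0, zero_add] at hsub
  rw [← hsub]
  refine intervalIntegral.integral_congr fun x _ => ?_
  exact mul_comm _ _

end TwoFormProperties

section Contractions

open SmoothFn

variable {E : Type} [NormedAddCommGroup E] [NormedSpace ℝ E] {a b : SmoothFn (E × ℝ)}

/-! #### Contraction with a periodic vector field -/

/-- For periodic ε_t the boundary term is ½ (P(0) − P(1)) with P = B(ε_t, ε_w), and it turns −ε_w
δ_t T under the integral into a second copy of ε_t δ_w T. -/
theorem twoForm_of_periodic [FiniteDimensional ℝ E] (h : dx a * b - a * dx b = 1)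
    (hT : shift (pot dx a b) = pot dx a b) {t : E} (ht : shift (eps a b t) = eps a b t)
    (s w : E) : twoForm a b s ![t, w] =
      2 * ∫ x in (0 : ℝ)..1, (eps a b t).1 (s, x) * (ds w (pot dx a b)).1 (s, x) := by
  set P := pairing dx (pot dx a b) (eps a b t) (eps a b w) with hP
  have hPs : shift P = pairing dx (pot dx a b) (shift (eps a b w)) (eps a b t) := by
    rw [hP, pairing_comm]
    simp only [pairing, map_sub, map_mul, map_ofNat, hT, ← dir_shift, ht]
  have hdP : dx P = 2 * (densityAlt a b t w - 2 * (eps a b t * ds w (pot dx a b))) := by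
    rw [hP, d_pairing, ← ds_pot h, ← ds_pot h, densityAlt]
    ring
  have hI := integral_dx P s 0 1
  have e : ∀ x, (dx P).1 (s, x) = 2 * ((densityAlt a b t w).1 (s, x) -
      2 * ((eps a b t).1 (s, x) * (ds w (pot dx a b)).1 (s, x))) := fun x => by
    rw [hdP, two_mul, two_mul, two_mul, two_mul]
    rfl
  simp only [e] at hI
  have hi : IntervalIntegrable (fun x => 2 * ((eps a b t).1 (s, x) * (ds w (pot dx a b)).1 (s, x)))
      MeasureTheory.volume 0 1 :=
    (continuous_const.mul ((continuous_snd (eps a b t) s).mul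
      (continuous_snd (ds w (pot dx a b)) s))).intervalIntegrable _ _
  rw [intervalIntegral.integral_const_mul, intervalIntegral.integral_sub
    ((continuous_snd _ s).intervalIntegrable _ _) hi, intervalIntegral.integral_const_mul] at hI
  have h1 : P.1 (s, 1) = (shift P).1 (s, 0) := by rw [shift_val, zero_add]
  rw [twoForm_apply]
  simp only [Matrix.cons_val_zero, Matrix.cons_val_one, Matrix.cons_val_fin_one]
  have h2 : boundaryAlt a b t w = P - shift P := by rw [boundaryAlt, ht, hPs]
  rw [h2, sub_val, ← h1]
  linarith

/-! #### The monodromy -/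

/-- The fundamental matrix of the lift. -/
def fundMat (a b : SmoothFn (E × ℝ)) (z : E × ℝ) : Matrix (Fin 2) (Fin 2) ℝ :=
  !![(dx a).1 z, a.1 z; (dx b).1 z, b.1 z]

/-- The derivative of the fundamental matrix in a parameter direction. -/
def dFundMat (a b : SmoothFn (E × ℝ)) (w : E) (z : E × ℝ) : Matrix (Fin 2) (Fin 2) ℝ :=
  !![(ds w (dx a)).1 z, (ds w a).1 z; (ds w (dx b)).1 z, (ds w b).1 z]

/-- The inverse of the fundamental matrix of a normalized lift. -/
def fundMatInv (a b : SmoothFn (E × ℝ)) (z : E × ℝ) : Matrix (Fin 2) (Fin 2) ℝ :=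
  !![b.1 z, -a.1 z; -(dx b).1 z, (dx a).1 z]

/-- The matrix in `𝔰𝔩(2)` associated with a vector field. -/
def connMat (T e : SmoothFn (E × ℝ)) (z : E × ℝ) : Matrix (Fin 2) (Fin 2) ℝ :=
  !![(dx e).1 z / 2, e.1 z; -(T.1 z * e.1 z + (dx (dx e)).1 z / 2), -(dx e).1 z / 2]

theorem connMat_add (T e f : SmoothFn (E × ℝ)) (z : E × ℝ) :
    connMat T (e + f) z = connMat T e z + connMat T f z := by
  ext i j
  fin_cases i <;> fin_cases j <;> simp [connMat] <;> ring

theorem connMat_sub (T e f : SmoothFn (E × ℝ)) (z : E × ℝ) :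
    connMat T (e - f) z = connMat T e z - connMat T f z := by
  ext i j
  fin_cases i <;> fin_cases j <;> simp [connMat] <;> ring

theorem trace_connMat_mul (T e f : SmoothFn (E × ℝ)) (z : E × ℝ) :
    (connMat T e z * connMat T f z).trace = (1 / 2) * (pairing dx T e f).1 z := by
  have : (pairing dx T e f).1 z = (dx e).1 z * (dx f).1 z - e.1 z * (dx (dx f)).1 z -
    (dx (dx e)).1 z * f.1 z - 4 * (T.1 z * e.1 z * f.1 z) := rfl
  rw [this]
  simp only [connMat, Matrix.trace_fin_two, Matrix.mul_apply, Fin.sum_univ_two, Matrix.of_apply,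
    Matrix.cons_val', Matrix.cons_val_zero, Matrix.cons_val_one, Matrix.cons_val_fin_one]
  ring

/-- It identifies the Wronskian in `extDeriv_twoForm` with the invariant cubic form defining the
Cartan 3-form; the potential drops out. -/
theorem trace_connMat_bracket (T e f g : SmoothFn (E × ℝ)) (z : E × ℝ) :
    (connMat T e z * ⁅connMat T f z, connMat T g z⁆).trace = (1 / 2) * (wr3 dx e f g).1 z := by
  simp only [wr3, add_val, sub_val, mul_val]
  simp only [connMat, Ring.lie_def, Matrix.trace_fin_two, Matrix.mul_apply, Matrix.sub_apply,
    Fin.sum_univ_two, Matrix.of_apply, Matrix.cons_val', Matrix.cons_val_zero, Matrix.cons_val_one,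
    Matrix.cons_val_fin_one]
  ring

theorem wronskian_val (h : dx a * b - a * dx b = 1) (z : E × ℝ) :
    (dx a).1 z * b.1 z - a.1 z * (dx b).1 z = 1 :=
  congrArg (fun f : SmoothFn (E × ℝ) => f.1 z) h

theorem fundMat_mul_inv (h : dx a * b - a * dx b = 1) (z : E × ℝ) :
    fundMat a b z * fundMatInv a b z = 1 := by
  have := wronskian_val h z
  ext i j
  fin_cases i <;> fin_cases j <;>
    simp [fundMat, fundMatInv, Matrix.mul_apply, Fin.sum_univ_two] <;> linarith

theorem inv_mul_fundMat (h : dx a * b - a * dx b = 1) (z : E × ℝ) :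
    fundMatInv a b z * fundMat a b z = 1 :=
  mul_eq_one_comm.1 (fundMat_mul_inv h z)

/-- This explains the shape of `connMat`: for ε = `eps a b w` it is the logarithmic derivative
Ψ⁻¹δΨ. The entries are `gen`, its first derivative by `d_gen` and `d_gen'`, and its second by
`dd_gen`. -/
theorem connMat_eps (h : dx a * b - a * dx b = 1) (w : E) (z : E × ℝ) :
    connMat (pot dx a b) (eps a b w) z = fundMatInv a b z * dFundMat a b w z := by
  have hc : ∀ x, dx (ds w x) = ds w (dx x) := fun x => dir_comm _ _ x
  have h1 := congrArg (fun f : SmoothFn (E × ℝ) => f.1 z) (d_gen h hc)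
  have h2 := congrArg (fun f : SmoothFn (E × ℝ) => f.1 z) (d_gen' h hc)
  have h3 := congrArg (fun f : SmoothFn (E × ℝ) => f.1 z) (dd_gen h hc)
  simp only [two_mul, add_val, sub_val, mul_val] at h1 h2 h3
  ext i j
  fin_cases i <;> fin_cases j <;>
    simp [connMat, fundMatInv, dFundMat, Matrix.mul_apply, Fin.sum_univ_two, eps]
  · linarith
  · simp only [gen, sub_val, mul_val]
    ring
  · linarith
  · linarith

/-- The lift `a`, `b` has monodromy matrices `M s`. -/
def HasMonodromy (a b : SmoothFn (E × ℝ)) (M : E → SL(2, ℝ)) : Prop :=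
  ∀ s x, a.1 (s, x + 1) = M s 0 0 * a.1 (s, x) + M s 0 1 * b.1 (s, x) ∧
    b.1 (s, x + 1) = M s 1 0 * a.1 (s, x) + M s 1 1 * b.1 (s, x)

variable {M : E → SL(2, ℝ)}

theorem HasMonodromy.dx (hM : HasMonodromy a b M) : HasMonodromy (dx a) (dx b) M := by
  have key : ∀ (f f₁ f₂ : SmoothFn (E × ℝ)) (r₁ r₂ : ℝ) (s : E),
      (∀ x, f.1 (s, x + 1) = r₁ * f₁.1 (s, x) + r₂ * f₂.1 (s, x)) → ∀ x,
      (Virasoro.dx f).1 (s, x + 1) =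
        r₁ * (Virasoro.dx f₁).1 (s, x) + r₂ * (Virasoro.dx f₂).1 (s, x) := by
    intro f f₁ f₂ r₁ r₂ s hf x
    have h1 := dx_congr_slice (f := shift f) (f' := r₁ • f₁ + r₂ • f₂) (s := s) (s' := s)
      (fun x => hf x) x
    rw [dir_shift, map_add, Derivation.map_smul, Derivation.map_smul] at h1
    exact h1
  exact fun s x => ⟨key a a b _ _ s (fun x => (hM s x).1) x, key b a b _ _ s (fun x => (hM s x).2) x⟩

theorem HasMonodromy.fundMat (hM : HasMonodromy a b M) (s : E) (x : ℝ) :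
    fundMat a b (s, x + 1) = (M s).1 * fundMat a b (s, x) := by
  have h1 := hM s x
  have h2 := hM.dx s x
  ext i j
  fin_cases i <;> fin_cases j <;>
    simp [Virasoro.fundMat, Matrix.mul_apply, Fin.sum_univ_two, h1, h2]

theorem det_SL2 (A : SL(2, ℝ)) : A 0 0 * A 1 1 - A 0 1 * A 1 0 = 1 := by
  have h := A.det_coe
  rwa [Matrix.det_fin_two] at h

theorem HasMonodromy.shift_pot (hM : HasMonodromy a b M) :
    shift (pot Virasoro.dx a b) = pot Virasoro.dx a b := by
  refine ext_val fun ⟨s, x⟩ => ?_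
  have h2 := hM.dx s x
  have h3 := hM.dx.dx s x
  have hd := det_SL2 (M s)
  simp only [pot, shift_val, sub_val, mul_val, h2, h3]
  linear_combination ((Virasoro.dx (Virasoro.dx a)).1 (s, x) * (Virasoro.dx b).1 (s, x) -
    (Virasoro.dx (Virasoro.dx b)).1 (s, x) * (Virasoro.dx a).1 (s, x)) * hd

/-- The monodromy matrix of a normalized lift, expressed by the lift. -/
def monMat (a b : SmoothFn (E × ℝ)) : Matrix (Fin 2) (Fin 2) (SmoothFn (E × ℝ)) :=
  !![shift (dx a) * b - shift a * dx b, shift a * dx a - shift (dx a) * a;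
    shift (dx b) * b - shift b * dx b, shift b * dx a - shift (dx b) * a]

/-- Solving Ψ(x + 1) = MΨ(x) for M. As nothing is assumed about the dependence of `M` on the
parameters, this is what shows that its entries are smooth. -/
theorem HasMonodromy.monMat_val (hM : HasMonodromy a b M)
    (h : Virasoro.dx a * b - a * Virasoro.dx b = 1) (s : E) (x : ℝ) (i j : Fin 2) :
    (monMat a b i j).1 (s, x) = M s i j := by
  have h1 := hM s x
  have h2 := hM.dx s x
  have h3 := wronskian_val h (s, x)
  fin_cases i <;> fin_cases j <;> simp [monMat, h1, h2]
  · linear_combination M s 0 0 * h3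
  · linear_combination M s 0 1 * h3
  · linear_combination M s 1 0 * h3
  · linear_combination M s 1 1 * h3

/-- The derivative of the monodromy matrix. -/
def dMonMat (a b : SmoothFn (E × ℝ)) (w s : E) : Matrix (Fin 2) (Fin 2) ℝ :=
  Matrix.of fun i j => (ds w (monMat a b i j)).1 (s, 0)

theorem HasMonodromy.fderiv_eq (hM : HasMonodromy a b M)
    (h : Virasoro.dx a * b - a * Virasoro.dx b = 1) (s w : E) (i j : Fin 2) :
    fderiv ℝ (fun s' => M s' i j) s w = dMonMat a b w s i j := by
  rw [show (fun s' => M s' i j) = fun s' => (monMat a b i j).1 (s', 0) from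
    funext fun s' => (hM.monMat_val h s' 0 i j).symm, fderiv_fst]
  rfl

theorem HasMonodromy.dFundMat (hM : HasMonodromy a b M)
    (h : Virasoro.dx a * b - a * Virasoro.dx b = 1) (w s : E) :
    dFundMat a b w (s, 1) =
      dMonMat a b w s * Virasoro.fundMat a b (s, 0) + (M s).1 * Virasoro.dFundMat a b w (s, 0) := by
  have e : ∀ i j, (M s).1 i j = (monMat a b i j).1 (s, 0) := fun i j => (hM.monMat_val h s 0 i j).symm
  have key : ∀ f : SmoothFn (E × ℝ), (ds w f).1 (s, 1) = (ds w (shift f)).1 (s, 0) := fun f => by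
    rw [dir_shift, shift_val, zero_add]
  have k1 : ∀ i, shift (![a, b] i) = monMat a b i 0 * a + monMat a b i 1 * b := fun i => by
    fin_cases i <;> simp [monMat]
    · linear_combination (-shift a) * h
    · linear_combination (-shift b) * h
  have k2 : ∀ i, shift (Virasoro.dx (![a, b] i)) =
      monMat a b i 0 * Virasoro.dx a + monMat a b i 1 * Virasoro.dx b := fun i => by
    fin_cases i <;> simp [monMat]
    · linear_combination (-shift (Virasoro.dx a)) * h
    · linear_combination (-shift (Virasoro.dx b)) * h
  have k1a := k1 0
  have k1b := k1 1
  have k2a := k2 0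
  have k2b := k2 1
  simp only [Matrix.cons_val_zero, Matrix.cons_val_one, Matrix.cons_val_fin_one] at k1a k1b k2a k2b
  ext i j
  simp only [Matrix.add_apply, Matrix.mul_apply, Fin.sum_univ_two, e]
  fin_cases i <;> fin_cases j <;>
    simp [Virasoro.dFundMat, Virasoro.fundMat, dMonMat, key, k1a, k1b, k2a, k2b] <;>
    ring

theorem connMat_shift {T : SmoothFn (E × ℝ)} (hT : shift T = T) (e : SmoothFn (E × ℝ)) (s : E) :
    connMat T (shift e) (s, 0) = connMat T e (s, 1) := by
  have h1 : T.1 (s, 1) = T.1 (s, 0) := by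
    conv_rhs => rw [← hT, shift_val, zero_add]
  simp only [connMat, dir_shift, shift_val, zero_add, h1]

theorem SL_inv_mul (A : SL(2, ℝ)) : (A⁻¹).1 * A.1 = 1 :=
  congrArg Subtype.val (inv_mul_cancel A)

theorem SL_mul_inv (A : SL(2, ℝ)) : A.1 * (A⁻¹).1 = 1 :=
  congrArg Subtype.val (mul_inv_cancel A)

theorem HasMonodromy.fundMatInv (hM : HasMonodromy a b M)
    (h : Virasoro.dx a * b - a * Virasoro.dx b = 1) (s : E) :
    fundMatInv a b (s, 1) = fundMatInv a b (s, 0) * ((M s)⁻¹).1 := by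
  have h1 := hM.fundMat s 0
  rw [zero_add] at h1
  have h2 : Virasoro.fundMatInv a b (s, 0) * ((M s)⁻¹).1 * Virasoro.fundMat a b (s, 1) = 1 := by
    rw [h1, Matrix.mul_assoc, ← Matrix.mul_assoc _ (M s).1, SL_inv_mul, Matrix.one_mul,
      inv_mul_fundMat h]
  calc _ = Virasoro.fundMatInv a b (s, 0) * ((M s)⁻¹).1 * Virasoro.fundMat a b (s, 1) *
        Virasoro.fundMatInv a b (s, 1) := by rw [h2, Matrix.one_mul]
    _ = _ := by rw [Matrix.mul_assoc, fundMat_mul_inv h, Matrix.mul_one]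

/-- Varying Ψ(1) = MΨ(0) gives Ψ(1)⁻¹δΨ(1) − Ψ(0)⁻¹δΨ(0) = Ψ(0)⁻¹(M⁻¹δM)Ψ(0). -/
theorem HasMonodromy.connMat_sub (hM : HasMonodromy a b M)
    (h : Virasoro.dx a * b - a * Virasoro.dx b = 1) (w s : E) :
    connMat (pot Virasoro.dx a b) (shift (eps a b w) - eps a b w) (s, 0) =
      Virasoro.fundMatInv a b (s, 0) * (((M s)⁻¹).1 * dMonMat a b w s) *
        Virasoro.fundMat a b (s, 0) := by
  rw [Virasoro.connMat_sub, connMat_shift hM.shift_pot, connMat_eps h, connMat_eps h, hM.dFundMat h,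
    hM.fundMatInv h, Matrix.mul_add, Matrix.mul_assoc _ _ ((M s).1 * _),
    ← Matrix.mul_assoc _ (M s).1, SL_inv_mul, Matrix.one_mul, add_sub_cancel_right]
  simp only [Matrix.mul_assoc]

theorem trace_conj {P Q : Matrix (Fin 2) (Fin 2) ℝ} (h : Q * P = 1) (A : Matrix (Fin 2) (Fin 2) ℝ) :
    (P * A * Q).trace = A.trace := by
  rw [Matrix.trace_mul_comm, ← Matrix.mul_assoc, h, Matrix.one_mul]

theorem extDeriv_twoForm_monodromy [FiniteDimensional ℝ E] (hM : HasMonodromy a b M)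
    (h : Virasoro.dx a * b - a * Virasoro.dx b = 1) (s : E) (w : Fin 3 → E) :
    extDeriv (twoForm a b) s w = ((((M s)⁻¹).1 * dMonMat a b (w 0) s) *
      ⁅((M s)⁻¹).1 * dMonMat a b (w 1) s, ((M s)⁻¹).1 * dMonMat a b (w 2) s⁆).trace := by
  rw [extDeriv_twoForm h hM.shift_pot, ← trace_connMat_bracket (pot Virasoro.dx a b),
    hM.connMat_sub h, hM.connMat_sub h, hM.connMat_sub h]
  set P := Virasoro.fundMatInv a b (s, 0)
  set Q := Virasoro.fundMat a b (s, 0)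
  have hQP : Q * P = 1 := fundMat_mul_inv h _
  have key : ∀ A B : Matrix (Fin 2) (Fin 2) ℝ, P * A * Q * (P * B * Q) = P * (A * B) * Q :=
    fun A B => by
      calc _ = P * A * (Q * P) * B * Q := by simp only [Matrix.mul_assoc]
        _ = _ := by rw [hQP]; simp only [Matrix.mul_assoc, Matrix.mul_one]
  rw [Ring.lie_def, key, key, ← Matrix.sub_mul, ← Matrix.mul_sub, key, trace_conj hQP, Ring.lie_def]

/-! #### Contraction with the generators of the projective action -/

/-- The variation −X is traceless and constant in x, so δ_t T = 0 and the integrand is −½ of the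
derivative of B(ε_t, ε_w). The remaining boundary values are evaluated with Ψ⁻¹δ_tΨ = −Ψ⁻¹XΨ. -/
theorem twoForm_of_linear [FiniteDimensional ℝ E] (hM : HasMonodromy a b M)
    (h : Virasoro.dx a * b - a * Virasoro.dx b = 1) {X : Matrix (Fin 2) (Fin 2) ℝ}
    (hX : X.trace = 0) {t : E} (hta : ds t a = -(X 0 0 • a + X 0 1 • b))
    (htb : ds t b = -(X 1 0 • a + X 1 1 • b)) (s w : E) :
    twoForm a b s ![t, w] =
      (X * (((M s)⁻¹).1 * dMonMat a b w s + dMonMat a b w s * ((M s)⁻¹).1)).trace := by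
  have hT := hM.shift_pot
  set T := pot Virasoro.dx a b with hTdef
  have hta' : ds t (Virasoro.dx a) = -(X 0 0 • Virasoro.dx a + X 0 1 • Virasoro.dx b) := by
    rw [dir_comm, hta, map_neg, map_add, Derivation.map_smul, Derivation.map_smul]
  have htb' : ds t (Virasoro.dx b) = -(X 1 0 • Virasoro.dx a + X 1 1 • Virasoro.dx b) := by
    rw [dir_comm, htb, map_neg, map_add, Derivation.map_smul, Derivation.map_smul]
  have hTt : ds t T = 0 := by
    have hta'' : ds t (Virasoro.dx (Virasoro.dx a)) =
        -(X 0 0 • Virasoro.dx (Virasoro.dx a) + X 0 1 • Virasoro.dx (Virasoro.dx b)) := by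
      rw [dir_comm, hta', map_neg, map_add, Derivation.map_smul, Derivation.map_smul]
    have htb'' : ds t (Virasoro.dx (Virasoro.dx b)) =
        -(X 1 0 • Virasoro.dx (Virasoro.dx a) + X 1 1 • Virasoro.dx (Virasoro.dx b)) := by
      rw [dir_comm, htb', map_neg, map_add, Derivation.map_smul, Derivation.map_smul]
    rw [Matrix.trace_fin_two] at hX
    refine ext_val fun z => ?_
    simp only [hTdef, pot, map_sub, dir_mul, hta', htb', hta'', htb'', sub_val, add_val, mul_val,
      neg_val, smul_val, zero_val]
    linear_combination (-((Virasoro.dx (Virasoro.dx a)).1 z * (Virasoro.dx b).1 z -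
      (Virasoro.dx (Virasoro.dx b)).1 z * (Virasoro.dx a).1 z)) * hX
  have hdF : ∀ z, dFundMat a b t z = -(X * Virasoro.fundMat a b z) := fun z => by
    ext i j
    fin_cases i <;> fin_cases j <;>
      simp [Virasoro.dFundMat, Virasoro.fundMat, Matrix.mul_apply, Fin.sum_univ_two, hta, htb,
        hta', htb']
  have hdP : Virasoro.dx (pairing Virasoro.dx T (eps a b t) (eps a b w)) =
      -(2 * densityAlt a b t w) := by
    rw [d_pairing, ← ds_pot h, ← ds_pot h, densityAlt, ← hTdef, hTt]
    ring
  have hI := integral_dx (pairing Virasoro.dx T (eps a b t) (eps a b w)) s 0 1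
  have e : ∀ x, (Virasoro.dx (pairing Virasoro.dx T (eps a b t) (eps a b w))).1 (s, x) =
      (-2) * (densityAlt a b t w).1 (s, x) := fun x => by
    rw [hdP, two_mul, neg_val, add_val]
    ring
  simp only [e] at hI
  rw [intervalIntegral.integral_const_mul] at hI
  have hs : (pairing Virasoro.dx T (eps a b t) (eps a b w)).1 (s, 1) =
      (pairing Virasoro.dx T (shift (eps a b t)) (shift (eps a b w))).1 (s, 0) := by
    have : shift (pairing Virasoro.dx T (eps a b t) (eps a b w)) =
        pairing Virasoro.dx T (shift (eps a b t)) (shift (eps a b w)) := by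
      simp only [pairing, map_sub, map_mul, map_ofNat, hT, dir_shift]
    rw [← this, shift_val, zero_add]
  -- The end values and the boundary term factor as one trace: the sum of the fields for `t` at the
  -- two ends against the difference for `w`. The two summands give the right- and the
  -- left-invariant form.
  have hfin : twoForm a b s ![t, w] = -((connMat T (shift (eps a b t) + eps a b t) (s, 0) *
      connMat T (shift (eps a b w) - eps a b w) (s, 0)).trace) := by
    have hsplit : pairing Virasoro.dx T (shift (eps a b t) + eps a b t)
        (shift (eps a b w) - eps a b w) =
        pairing Virasoro.dx T (shift (eps a b t)) (shift (eps a b w)) -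
        pairing Virasoro.dx T (eps a b t) (eps a b w) - boundaryAlt a b t w := by
      simp only [boundaryAlt, pairing, map_add, map_sub]
      ring
    rw [trace_connMat_mul, hsplit, sub_val, sub_val, twoForm_apply]
    simp only [Matrix.cons_val_zero, Matrix.cons_val_one, Matrix.cons_val_fin_one]
    linarith
  rw [hfin, hM.connMat_sub h, connMat_add, connMat_shift hT, connMat_eps h, connMat_eps h, hdF, hdF]
  have h1 := hM.fundMat s 0
  rw [zero_add] at h1
  rw [hM.fundMatInv h, h1]
  set P := Virasoro.fundMatInv a b (s, 0)
  set Q := Virasoro.fundMat a b (s, 0)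
  have hQP : Q * P = 1 := fundMat_mul_inv h _
  set A := (M s).1
  set A' := ((M s)⁻¹).1
  set D := dMonMat a b w s
  have hAA : A * A' = 1 := SL_mul_inv _
  have e1 : P * A' * -(X * (A * Q)) * (P * (A' * D) * Q) = -(P * (A' * (X * D)) * Q) := by
    calc _ = -(P * A' * X * A * (Q * P) * A' * D * Q) := by
          simp only [Matrix.mul_assoc, Matrix.neg_mul, Matrix.mul_neg]
      _ = -(P * A' * X * (A * A') * D * Q) := by
          rw [hQP]; simp only [Matrix.mul_assoc, Matrix.mul_one]
      _ = _ := by rw [hAA]; simp only [Matrix.mul_assoc, Matrix.mul_one]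
  have e2 : P * -(X * Q) * (P * (A' * D) * Q) = -(P * (X * (A' * D)) * Q) := by
    calc _ = -(P * X * (Q * P) * (A' * D) * Q) := by
          simp only [Matrix.mul_assoc, Matrix.neg_mul, Matrix.mul_neg]
      _ = _ := by rw [hQP]; simp only [Matrix.mul_assoc, Matrix.mul_one]
  rw [Matrix.add_mul, e1, e2, Matrix.trace_add, Matrix.trace_neg, Matrix.trace_neg, trace_conj hQP,
    trace_conj hQP, Matrix.mul_add, Matrix.trace_add, Matrix.trace_mul_comm A', Matrix.mul_assoc X]
  ring

end Contractions

/-! ### Lifting along the covering of the projective line -/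

theorem mk_eq_rp {a b φ r : ℝ} (ha : a = r * Real.sin φ) (hb : b = r * Real.cos φ)
    (hne : ![a, b] ≠ 0) : Projectivization.mk ℝ ![a, b] hne = rp φ := by
  rw [rp, Projectivization.mk_eq_mk_iff']
  exact ⟨r, by simp [ha, hb]⟩

theorem mk_eq_mk_cross {a b a' b' : ℝ} {h : ![a, b] ≠ 0} {h' : ![a', b'] ≠ 0}
    (e : Projectivization.mk ℝ ![a, b] h = Projectivization.mk ℝ ![a', b'] h') :
    ∃ r : ℝ, r ≠ 0 ∧ a = r * a' ∧ b = r * b' := by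
  obtain ⟨r, hr⟩ := (Projectivization.mk_eq_mk_iff' ℝ _ _ h h').1 e
  have h0 := congrFun hr 0
  have h1 := congrFun hr 1
  simp only [Pi.smul_apply, Matrix.cons_val_zero, smul_eq_mul, Matrix.cons_val_one,
    Matrix.cons_val_fin_one] at h0 h1
  refine ⟨r, ?_, h0.symm, h1.symm⟩
  rintro rfl
  apply h
  rw [← h0, ← h1]
  simp

theorem rp_eq_rp_iff {φ ψ : ℝ} : rp φ = rp ψ ↔ ∃ k : ℤ, φ = ψ + k * Real.pi := by
  constructor
  · intro h
    obtain ⟨r, -, h0, h1⟩ := mk_eq_mk_cross h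
    have h2 : Real.sin (φ - ψ) = 0 := by
      rw [Real.sin_sub, h0, h1]
      ring
    obtain ⟨k, hk⟩ := Real.sin_eq_zero_iff.1 h2
    exact ⟨k, by linarith⟩
  · rintro ⟨k, rfl⟩
    refine mk_eq_rp (r := (-1) ^ k) ?_ ?_ _
    · rw [Real.sin_add_int_mul_pi]
    · rw [Real.cos_add_int_mul_pi]

/-- The double covering of a line, as a unit complex number: `rp φ ↦ exp(2 i φ)`. -/
def dbl (l : RP1) : ℂ :=
  ((l.rep 1 : ℂ) + l.rep 0 * Complex.I) ^ 2 / ((l.rep 1 : ℂ) ^ 2 + (l.rep 0 : ℂ) ^ 2)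

theorem dbl_rp (φ : ℝ) : dbl (rp φ) = Complex.exp (2 * φ * Complex.I) := by
  obtain ⟨r, hr⟩ := Projectivization.exists_smul_eq_mk_rep ℝ _ (sin_cos_ne_zero φ)
  have h0 := congrFun hr 0
  have h1 := congrFun hr 1
  simp only [Pi.smul_apply, Matrix.cons_val_zero, Units.smul_def, smul_eq_mul, Matrix.cons_val_one,
    Matrix.cons_val_fin_one] at h0 h1
  have hr0 : ((r : ℝ) : ℂ) ≠ 0 := by exact_mod_cast r.ne_zero
  have hsc : (Complex.cos φ) ^ 2 + (Complex.sin φ) ^ 2 = 1 := by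
    rw [add_comm, Complex.sin_sq_add_cos_sq]
  have e : Complex.exp (2 * φ * Complex.I) = (Complex.cos φ + Complex.sin φ * Complex.I) ^ 2 := by
    rw [← Complex.exp_mul_I, ← Complex.exp_nat_mul]
    congr 1
    push_cast
    ring
  rw [e, dbl, rp, ← h0, ← h1]
  push_cast
  rw [show ((r : ℝ) * Complex.cos φ) ^ 2 + ((r : ℝ) * Complex.sin φ) ^ 2 = ((r : ℝ) : ℂ) ^ 2 by
    linear_combination ((r : ℝ) : ℂ) ^ 2 * hsc]
  field_simp

theorem exists_log {A : Type*} [TopologicalSpace A] [SimplyConnectedSpace A]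
    [LocallyPathConnectedSpace A] {g : A → ℂ} (hg : Continuous g) (h0 : ∀ x, g x ≠ 0) :
    ∃ f : A → ℂ, Continuous f ∧ ∀ x, Complex.exp (f x) = g x := by
  obtain ⟨x₀⟩ : Nonempty A := inferInstance
  obtain ⟨f, ⟨-, hf⟩, -⟩ := Complex.isCoveringMapOn_exp.existsUnique_continuousMap_lifts
    (f := ⟨g, hg⟩) (Complex.exp_log (h0 x₀)) (fun x => h0 x)
  exact ⟨f, f.continuous, fun x => congrFun hf x⟩

/-- Composing with `dbl` turns the problem into finding a continuous logarithm, so no topology on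
`RP1` is needed. Half the imaginary part of the logarithm is the lift. -/
theorem exists_rp_lift {A : Type*} [TopologicalSpace A] [SimplyConnectedSpace A]
    [LocallyPathConnectedSpace A] {Γ : A → RP1}
    (hΓ : ∀ x, ∃ φ : A → ℝ, ContinuousAt φ x ∧ ∀ᶠ y in 𝓝 x, Γ y = rp (φ y)) :
    ∃ φ : A → ℝ, Continuous φ ∧ ∀ x, Γ x = rp (φ x) := by
  have hc : Continuous fun x => dbl (Γ x) := continuous_iff_continuousAt.2 fun x => by
    obtain ⟨φ, h1, h2⟩ := hΓ x
    have h3 : ContinuousAt (fun y => Complex.exp (2 * φ y * Complex.I)) x :=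
      Complex.continuous_exp.continuousAt.comp ((continuousAt_const.mul
        (Complex.continuous_ofReal.continuousAt.comp h1)).mul continuousAt_const)
    refine h3.congr ?_
    filter_upwards [h2] with y hy
    rw [hy, dbl_rp]
  have hex : ∀ x, ∃ φ : ℝ, Γ x = rp φ := fun x => by
    obtain ⟨φ, -, h2⟩ := hΓ x
    exact ⟨φ x, h2.self_of_nhds⟩
  obtain ⟨f, hf, hfe⟩ := exists_log hc fun x => by
    obtain ⟨φ, hφ⟩ := hex x
    rw [hφ, dbl_rp]
    exact Complex.exp_ne_zero _
  refine ⟨fun x => (f x).im / 2, (Complex.continuous_im.comp hf).div_const 2, fun x => ?_⟩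
  obtain ⟨φ, hφ⟩ := hex x
  rw [hφ]
  have h1 := hfe x
  rw [hφ, dbl_rp] at h1
  obtain ⟨k, hk⟩ := Complex.exp_eq_exp_iff_exists_int.1 h1
  have him := congrArg Complex.im hk
  simp at him
  refine rp_eq_rp_iff.2 ⟨-k, ?_⟩
  push_cast
  linarith

/-- The difference is continuous with values in πℤ, so it cannot jump by less than π. -/
theorem eventually_eq_add_of_rp_eq {A : Type*} [TopologicalSpace A] {φ ψ : A → ℝ} {x : A}
    (hφ : ContinuousAt φ x) (hψ : ContinuousAt ψ x) (h : ∀ᶠ y in 𝓝 x, rp (φ y) = rp (ψ y)) :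
    ∃ k : ℤ, ∀ᶠ y in 𝓝 x, φ y = ψ y + k * Real.pi := by
  obtain ⟨k, hk⟩ := rp_eq_rp_iff.1 h.self_of_nhds
  refine ⟨k, ?_⟩
  have hc : ContinuousAt (fun y => φ y - ψ y) x := hφ.sub hψ
  have hnear := Metric.continuousAt_iff'.1 hc Real.pi Real.pi_pos
  filter_upwards [h, hnear] with y hy hy'
  obtain ⟨l, hl⟩ := rp_eq_rp_iff.1 hy
  rw [Real.dist_eq, hk, hl] at hy'
  have e : ψ y + l * Real.pi - ψ y - (ψ x + k * Real.pi - ψ x) = ((l - k : ℤ) : ℝ) * Real.pi := by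
    push_cast
    ring
  rw [e, abs_mul, abs_of_pos Real.pi_pos] at hy'
  have h1 : |((l - k : ℤ) : ℝ)| < 1 := by
    by_contra hcon
    push Not at hcon
    nlinarith [Real.pi_pos]
  have h2 : l = k := by
    rw [← Int.cast_abs] at h1
    have : |l - k| < 1 := by exact_mod_cast h1
    rw [Int.abs_lt_one_iff] at this
    linarith
  rw [hl, h2]

theorem exists_polar_lift {f g : ℝ → ℝ} (hf : Continuous f) (hg : Continuous g)
    (h : ∀ x, f x ≠ 0 ∨ g x ≠ 0) : ∃ ψ : ℝ → ℝ, Continuous ψ ∧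
      ∀ x, ∃ r : ℝ, 0 < r ∧ f x = r * Real.sin (ψ x) ∧ g x = r * Real.cos (ψ x) := by
  -- The real part is `g`, since `rp` puts the cosine second and measures the angle from that axis.
  obtain ⟨F, hF, hFe⟩ := exists_log (g := fun x => (⟨g x, f x⟩ : ℂ))
    (by
      have : (fun x => (⟨g x, f x⟩ : ℂ)) = fun x => (g x : ℂ) + f x * Complex.I :=
        funext fun x => (Complex.mk_eq_add_mul_I _ _)
      rw [this]
      fun_prop)
    (fun x hx => by
      have h0 : g x = 0 := congrArg Complex.re hx
      have h1 : f x = 0 := congrArg Complex.im hx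
      have := h x
      simp [h0, h1] at this)
  refine ⟨fun x => (F x).im, Complex.continuous_im.comp hF, fun x =>
    ⟨Real.exp (F x).re, Real.exp_pos _, ?_, ?_⟩⟩
  · have := congrArg Complex.im (hFe x)
    rw [Complex.exp_im] at this
    exact this.symm
  · have := congrArg Complex.re (hFe x)
    rw [Complex.exp_re] at this
    exact this.symm

open SmoothFn

/-! ### Normalized lifts of families of developing maps -/

/-- The positive inverse square root of a positive smooth function. -/
def invSqrt {V : Type*} [NormedAddCommGroup V] [NormedSpace ℝ V] (ρ : SmoothFn V)
    (h : ∀ z, 0 < ρ.1 z) : SmoothFn V :=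
  ⟨fun z => ρ.1 z ^ (-(1 / 2) : ℝ), ρ.contDiff.rpow_const_of_ne fun z => (h z).ne'⟩

theorem rpow_neg_half_mul {r : ℝ} (h : 0 < r) :
    r ^ (-(1 / 2) : ℝ) * r ^ (-(1 / 2) : ℝ) * r = 1 := by
  rw [← Real.rpow_add h]
  norm_num
  rw [Real.rpow_neg_one, inv_mul_cancel₀ h.ne']

theorem invSqrt_mul {V : Type*} [NormedAddCommGroup V] [NormedSpace ℝ V] (ρ : SmoothFn V)
    (h : ∀ z, 0 < ρ.1 z) : invSqrt ρ h * invSqrt ρ h * ρ = 1 :=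
  ext_val fun z => rpow_neg_half_mul (h z)

/-- `a`, `b` is a normalized lift, in the parametrization `c`, of the family `p`. -/
structure IsNormalizedLift {C : CircleCover} (c : C.Param) {n : ℕ}
    (p : EuclideanSpace ℝ (Fin n) → DevMap C)
    (a b : SmoothFn (EuclideanSpace ℝ (Fin n) × ℝ)) : Prop where
  wronskian : dx a * b - a * dx b = 1
  proj : ∀ s x, ∃ hne, (p s).toFun (c.map x) = Projectivization.mk ℝ ![a.1 (s, x), b.1 (s, x)] hne

section Param

variable {C : CircleCover} (c : C.Param)

theorem Param.inv_map (x : ℝ) : c.inv (c.map x) = x := c.toDiffeo.symm_apply_apply x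

theorem Param.map_inv (x : C.X) : c.map (c.inv x) = x := c.toDiffeo.apply_symm_apply x

theorem Param.contMDiff_map : ContMDiff 𝓘(ℝ, ℝ) 𝓘(ℝ, ℝ) ∞ c.map := c.toDiffeo.contMDiff

theorem Param.contMDiff_inv : ContMDiff 𝓘(ℝ, ℝ) 𝓘(ℝ, ℝ) ∞ c.inv := c.toDiffeo.symm.contMDiff

theorem Param.continuous_map : Continuous c.map := (Param.contMDiff_map c).continuous

theorem Param.continuous_inv : Continuous c.inv := (Param.contMDiff_inv c).continuous

theorem Param.map_add_one (x : ℝ) : c.map (x + 1) = C.κ (c.map x) := c.map_κ x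

theorem Param.inv_κ (x : C.X) : c.inv (C.κ x) = c.inv x + 1 := by
  rw [← Param.map_inv c x, ← Param.map_add_one, Param.inv_map, Param.inv_map]

theorem nonempty_param (C : CircleCover) : Nonempty C.Param := by
  obtain ⟨c, hc⟩ := C.exists_param
  exact ⟨⟨c, hc⟩⟩

/-- Local lifts differ from a global lift by a multiple of `π`. -/
theorem DevMap.local_eq_global (γ : DevMap C) {φ : ℝ → ℝ} (hφ : Continuous φ)
    (h : ∀ y, γ.toFun (c.map y) = rp (φ y)) {ψ : C.X → ℝ} {x : ℝ}
    (hψ : ContinuousAt ψ (c.map x)) (h' : ∀ᶠ y in 𝓝 (c.map x), γ.toFun y = rp (ψ y)) :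
    ∃ k : ℤ, ∀ᶠ y in 𝓝 x, ψ (c.map y) = φ y + k * Real.pi := by
  have hc := (Param.continuous_map c).continuousAt (x := x)
  refine eventually_eq_add_of_rp_eq (ContinuousAt.comp hψ hc) hφ.continuousAt ?_
  filter_upwards [hc.eventually h'] with y hy
  rw [← h y]
  exact hy.symm

end Param

/-! ### Existence of normalized lifts -/

section Existence

variable {C : CircleCover} (c : C.Param) {n : ℕ} {p : EuclideanSpace ℝ (Fin n) → DevMap C}

/-- The domain `ℝⁿ × ℝ` is simply connected, so a continuous lift exists globally. It is smooth and
increasing because it differs locally by a multiple of π from the lifts provided by the definitions.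
-/
theorem exists_smooth_lift (hp : Diffeology.IsPlot p) :
    ∃ φ : SmoothFn (EuclideanSpace ℝ (Fin n) × ℝ), (∀ z, 0 < (dx φ).1 z) ∧
      ∀ s x, (p s).toFun (c.map x) = rp (φ.1 (s, x)) := by
  have hp' : IsSmoothFamilyOn p Set.univ := hp
  have hloc : ∀ z : EuclideanSpace ℝ (Fin n) × ℝ, ∃ φ : EuclideanSpace ℝ (Fin n) × ℝ → ℝ,
      ContDiffAt ℝ ∞ φ z ∧ ∀ᶠ y in 𝓝 z, (p y.1).toFun (c.map y.2) = rp (φ y) := by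
    rintro ⟨s, x⟩
    obtain ⟨φ, h1, h2⟩ := hp' s trivial (c.map x)
    have hg : ContMDiff (𝓘(ℝ, EuclideanSpace ℝ (Fin n)).prod 𝓘(ℝ, ℝ))
        (𝓘(ℝ, EuclideanSpace ℝ (Fin n)).prod 𝓘(ℝ, ℝ)) ∞
        (fun z : EuclideanSpace ℝ (Fin n) × ℝ => (z.1, c.map z.2)) :=
      contMDiff_fst.prodMk ((Param.contMDiff_map c).comp contMDiff_snd)
    refine ⟨fun z => φ (z.1, c.map z.2), ?_, (hg.continuous.continuousAt (x := (s, x))).eventually h2⟩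
    have h3 := ContMDiffAt.comp (s, x) (g := φ) h1 hg.contMDiffAt
    rw [← modelWithCornersSelf_prod, chartedSpaceSelf_prod] at h3
    exact h3.contDiffAt
  obtain ⟨φ, hφ, hφe⟩ := exists_rp_lift (A := EuclideanSpace ℝ (Fin n) × ℝ)
    (Γ := fun z => (p z.1).toFun (c.map z.2)) fun z => by
      obtain ⟨φ, h1, h2⟩ := hloc z
      exact ⟨φ, h1.continuousAt, h2⟩
  have hsm : ContDiff ℝ ∞ φ := contDiff_iff_contDiffAt.2 fun z => by
    obtain ⟨ψ, h1, h2⟩ := hloc z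
    obtain ⟨k, hk⟩ := eventually_eq_add_of_rp_eq hφ.continuousAt h1.continuousAt
      (by filter_upwards [h2] with y hy; rw [← hy, ← hφe y])
    exact (h1.add contDiffAt_const).congr_of_eventuallyEq hk
  refine ⟨⟨φ, hsm⟩, ?_, fun s x => hφe (s, x)⟩
  rintro ⟨s, x⟩
  obtain ⟨ψ, h1, h2, h3⟩ := (p s).localDiffeo (c.map x)
  have hderiv := h3 c
  rw [Param.inv_map] at hderiv
  obtain ⟨k, hk⟩ := (p s).local_eq_global c (φ := fun y => φ (s, y))
    (hφ.comp (by fun_prop)) (fun y => hφe (s, y)) h1.continuousAt h2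
  have hk' : (ψ ∘ c.map) =ᶠ[𝓝 x] fun y => φ (s, y) + k * Real.pi := hk
  rw [hk'.deriv_eq, deriv_add_const, (hasDerivAt_snd ⟨φ, hsm⟩ s x).deriv] at hderiv
  exact hderiv

/-- The normalized lift given by a lift to the universal cover of the projective line. -/
def liftSin (φ : SmoothFn (EuclideanSpace ℝ (Fin n) × ℝ)) (h : ∀ z, 0 < (dx φ).1 z) :
    SmoothFn (EuclideanSpace ℝ (Fin n) × ℝ) :=
  invSqrt (dx φ) h * ⟨fun z => Real.sin (φ.1 z), Real.contDiff_sin.comp φ.contDiff⟩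

/-- The second component of the normalized lift. -/
def liftCos (φ : SmoothFn (EuclideanSpace ℝ (Fin n) × ℝ)) (h : ∀ z, 0 < (dx φ).1 z) :
    SmoothFn (EuclideanSpace ℝ (Fin n) × ℝ) :=
  invSqrt (dx φ) h * ⟨fun z => Real.cos (φ.1 z), Real.contDiff_cos.comp φ.contDiff⟩

theorem wronskian_lift (φ : SmoothFn (EuclideanSpace ℝ (Fin n) × ℝ)) (h : ∀ z, 0 < (dx φ).1 z) :
    dx (liftSin φ h) * liftCos φ h - liftSin φ h * dx (liftCos φ h) = 1 := by
  set S : SmoothFn (EuclideanSpace ℝ (Fin n) × ℝ) :=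
    ⟨fun z => Real.sin (φ.1 z), Real.contDiff_sin.comp φ.contDiff⟩ with hS
  set K : SmoothFn (EuclideanSpace ℝ (Fin n) × ℝ) :=
    ⟨fun z => Real.cos (φ.1 z), Real.contDiff_cos.comp φ.contDiff⟩ with hK
  have h1 : dx S = K * dx φ := ext_val fun z => by
    have := (Real.hasDerivAt_sin (φ.1 z)).comp_hasFDerivAt z (φ.differentiableAt z).hasFDerivAt
    change fderiv ℝ (Real.sin ∘ φ.1) z _ = _
    rw [this.fderiv]
    rfl
  have h2 : dx K = -(S * dx φ) := ext_val fun z => by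
    have := (Real.hasDerivAt_cos (φ.1 z)).comp_hasFDerivAt z (φ.differentiableAt z).hasFDerivAt
    change fderiv ℝ (Real.cos ∘ φ.1) z _ = _
    rw [this.fderiv]
    exact neg_mul _ _
  have h3 : S * S + K * K = 1 := ext_val fun z => by
    have := Real.sin_sq_add_cos_sq (φ.1 z)
    rw [sq, sq] at this
    exact this
  have h4 := invSqrt_mul (dx φ) h
  have hs : liftSin φ h = invSqrt (dx φ) h * S := rfl
  have hc : liftCos φ h = invSqrt (dx φ) h * K := rfl
  rw [hs, hc, dir_mul, dir_mul, h1, h2]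
  linear_combination (S * S + K * K) * h4 + h3

theorem sin_cos_ne {r φ : ℝ} (hr : r ≠ 0) : ![r * Real.sin φ, r * Real.cos φ] ≠ 0 := by
  have : ![r * Real.sin φ, r * Real.cos φ] = r • ![Real.sin φ, Real.cos φ] := by simp
  rw [this]
  exact smul_ne_zero hr (sin_cos_ne_zero φ)

theorem isNormalizedLift_lift {φ : SmoothFn (EuclideanSpace ℝ (Fin n) × ℝ)}
    (h : ∀ z, 0 < (dx φ).1 z) (hφ : ∀ s x, (p s).toFun (c.map x) = rp (φ.1 (s, x))) :
    IsNormalizedLift c p (liftSin φ h) (liftCos φ h) where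
  wronskian := wronskian_lift φ h
  proj s x := by
    refine ⟨sin_cos_ne (Real.rpow_pos_of_pos (h (s, x)) _).ne', ?_⟩
    rw [hφ]
    exact (mk_eq_rp rfl rfl _).symm

/-- The chosen local lift differs from `φ` by kπ, which multiplies both solutions by (−1)^k; the
potential is quadratic in them. -/
theorem hillPotential_lift {φ : SmoothFn (EuclideanSpace ℝ (Fin n) × ℝ)}
    (h : ∀ z, 0 < (dx φ).1 z) (hφ : ∀ s x, (p s).toFun (c.map x) = rp (φ.1 (s, x)))
    (s : EuclideanSpace ℝ (Fin n)) (x : ℝ) :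
    (p s).hillPotential c x = (pot dx (liftSin φ h) (liftCos φ h)).1 (s, x) := by
  obtain ⟨h1, h2, -⟩ := ((p s).localDiffeo (c.map x)).choose_spec
  obtain ⟨k, hk⟩ := (p s).local_eq_global c (φ := fun y => φ.1 (s, y))
    (continuous_snd φ s) (fun y => hφ s y) h1.continuousAt h2
  set ψ : ℝ → ℝ := (p s).localLift (c.map x) ∘ c.map with hψ
  have hk' : ψ =ᶠ[𝓝 x] fun y => φ.1 (s, y) + k * Real.pi := hk
  have hd : deriv ψ =ᶠ[𝓝 x] fun y => (dx φ).1 (s, y) := by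
    filter_upwards [hk'.deriv] with y hy
    rw [hy, deriv_add_const, (hasDerivAt_snd φ s y).deriv]
  have e0 : (p s).normalizedLift c x 0 =ᶠ[𝓝 x]
      fun y => ((-1 : ℝ) ^ k • liftSin φ h).1 (s, y) := by
    filter_upwards [hk', hd] with y hy hy'
    change deriv ψ y ^ (-(1 / 2) : ℝ) * Real.sin (ψ y) = _
    rw [hy, hy', Real.sin_add_int_mul_pi]
    change _ = (-1 : ℝ) ^ k * ((dx φ).1 (s, y) ^ (-(1 / 2) : ℝ) * Real.sin (φ.1 (s, y)))
    ring
  have e1 : (p s).normalizedLift c x 1 =ᶠ[𝓝 x]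
      fun y => ((-1 : ℝ) ^ k • liftCos φ h).1 (s, y) := by
    filter_upwards [hk', hd] with y hy hy'
    change deriv ψ y ^ (-(1 / 2) : ℝ) * Real.cos (ψ y) = _
    rw [hy, hy', Real.cos_add_int_mul_pi]
    change _ = (-1 : ℝ) ^ k * ((dx φ).1 (s, y) ^ (-(1 / 2) : ℝ) * Real.cos (φ.1 (s, y)))
    ring
  have key : ∀ {u : ℝ → ℝ} {f : SmoothFn (EuclideanSpace ℝ (Fin n) × ℝ)},
      u =ᶠ[𝓝 x] (fun y => f.1 (s, y)) →
      deriv u x = (dx f).1 (s, x) ∧ deriv (deriv u) x = (dx (dx f)).1 (s, x) := by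
    intro u f hu
    have h1 : deriv u =ᶠ[𝓝 x] fun y => (dx f).1 (s, y) := by
      filter_upwards [hu.deriv] with y hy
      rw [hy, (hasDerivAt_snd f s y).deriv]
    exact ⟨h1.self_of_nhds, by rw [h1.deriv_eq, (hasDerivAt_snd (dx f) s x).deriv]⟩
  obtain ⟨d0, dd0⟩ := key e0
  obtain ⟨d1, dd1⟩ := key e1
  have hsq : ((-1 : ℝ) ^ k) * ((-1 : ℝ) ^ k) = 1 := by
    rw [← zpow_add₀ (by norm_num), ← two_mul]
    exact (even_two_mul k).neg_one_zpow
  simp only [DevMap.hillPotential, DevMap.hill, d0, dd0, d1, dd1, Matrix.det_fin_three,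
    Derivation.map_smul, smul_val, pot, sub_val, mul_val]
  simp
  linear_combination ((dx (dx (liftSin φ h))).1 (s, x) * (dx (liftCos φ h)).1 (s, x) -
    (dx (dx (liftCos φ h))).1 (s, x) * (dx (liftSin φ h)).1 (s, x)) * hsq

theorem exists_normalizedLift (hp : Diffeology.IsPlot p) : ∃ a b, IsNormalizedLift c p a b ∧
    ∀ s x, (p s).hillPotential c x = (pot dx a b).1 (s, x) := by
  obtain ⟨φ, h, hφ⟩ := exists_smooth_lift c hp
  exact ⟨_, _, isNormalizedLift_lift c h hφ, hillPotential_lift c h hφ⟩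

end Existence

/-! ### Uniqueness of normalized lifts up to sign -/

section Uniqueness

variable {C : CircleCover} {c : C.Param} {n : ℕ} {p : EuclideanSpace ℝ (Fin n) → DevMap C}
  {a b a' b' : SmoothFn (EuclideanSpace ℝ (Fin n) × ℝ)}

theorem IsNormalizedLift.twoForm_eq (h : IsNormalizedLift c p a b)
    (h' : IsNormalizedLift c p a' b') : twoForm a' b' = twoForm a b := by
  -- The proportionality factor of the two lifts is read off from the first Wronskian, which makes
  -- it smooth. The second Wronskian then gives σ² = 1, so all its derivatives vanish.
  set σ := dx a * b' - a' * dx b with hσ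
  have hr : ∀ z, ∃ r : ℝ, a'.1 z = r * a.1 z ∧ b'.1 z = r * b.1 z := by
    rintro ⟨s, x⟩
    obtain ⟨h1, e1⟩ := h.proj s x
    obtain ⟨h2, e2⟩ := h'.proj s x
    obtain ⟨r, -, h3, h4⟩ := mk_eq_mk_cross (e2.symm.trans e1)
    exact ⟨r, h3, h4⟩
  have hσr : ∀ z r, a'.1 z = r * a.1 z → b'.1 z = r * b.1 z → σ.1 z = r := fun z r h1 h2 => by
    have := wronskian_val h.wronskian z
    simp only [hσ, sub_val, mul_val, h1, h2]
    linear_combination r * this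
  have ha : a' = σ * a := ext_val fun z => by
    obtain ⟨r, h1, h2⟩ := hr z
    rw [mul_val, hσr z r h1 h2, h1]
  have hb : b' = σ * b := ext_val fun z => by
    obtain ⟨r, h1, h2⟩ := hr z
    rw [mul_val, hσr z r h1 h2, h2]
  have hσ2 : σ * σ = 1 := by
    have h1 := h'.wronskian
    rw [ha, hb, dir_mul, dir_mul] at h1
    linear_combination h1 - σ * σ * h.wronskian
  have hdσ : ∀ v, dir v σ = 0 := fun v => by
    have h1 := congrArg (dir v) hσ2
    rw [dir_mul, Derivation.map_one_eq_zero] at h1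
    refine ext_val fun z => ?_
    have h2 := congrArg (fun f : SmoothFn _ => f.1 z) h1
    have h3 := congrArg (fun f : SmoothFn _ => f.1 z) hσ2
    simp only [add_val, mul_val, zero_val, one_val] at h2 h3 ⊢
    linear_combination (σ.1 z / 2) * h2 - (dir v σ).1 z * h3
  have heps : ∀ w, eps a' b' w = eps a b w := fun w => by
    simp only [eps, gen, ha, hb, dir_mul, hdσ]
    linear_combination (b * ds w a - a * ds w b) * hσ2
  have hpot : pot dx a' b' = pot dx a b := by
    simp only [pot, ha, hb, dir_mul, hdσ, zero_mul, zero_add]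
    linear_combination (dx (dx a) * dx b - dx (dx b) * dx a) * hσ2
  ext s w
  exact twoForm_congr id (fun w x => by rw [heps]; rfl) (fun x => by rw [hpot])
    (fun w x => by rw [hpot]; rfl) w

end Uniqueness

/-! ### The lifted monodromy -/

section Monodromy

variable {C : CircleCover}

theorem mk_smul_rp (A : SL(2, ℝ)) {φ ψ r : ℝ}
    (h0 : A 0 0 * Real.sin φ + A 0 1 * Real.cos φ = r * Real.sin ψ)
    (h1 : A 1 0 * Real.sin φ + A 1 1 * Real.cos φ = r * Real.cos ψ) :
    (QuotientGroup.mk A : PSL2R) • rp φ = rp ψ := by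
  have hrp : (QuotientGroup.mk A : PSL2R) • rp φ =
    Projectivization.mk ℝ (A • ![Real.sin φ, Real.cos φ])
      ((smul_ne_zero_iff_ne A).mpr (sin_cos_ne_zero φ)) := rfl
  rw [hrp, rp, Projectivization.mk_eq_mk_iff']
  refine ⟨r, ?_⟩
  change _ = (A : Matrix (Fin 2) (Fin 2) ℝ) *ᵥ ![Real.sin φ, Real.cos φ]
  ext i
  fin_cases i
  · simpa [Matrix.mulVec, dotProduct, Fin.sum_univ_two] using h0.symm
  · simpa [Matrix.mulVec, dotProduct, Fin.sum_univ_two] using h1.symm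

theorem DevMap.exists_continuous_lift (γ : DevMap C) (c : C.Param) :
    ∃ φ : ℝ → ℝ, Continuous φ ∧ ∀ y, γ.toFun (c.map y) = rp (φ y) := by
  refine exists_rp_lift (Γ := fun y => γ.toFun (c.map y)) fun y => ?_
  obtain ⟨φ, h1, h2, -⟩ := γ.localDiffeo (c.map y)
  have hc := (Param.continuous_map c).continuousAt (x := y)
  exact ⟨fun y => φ (c.map y), ContinuousAt.comp h1.continuousAt hc, hc.eventually h2⟩

theorem DevMap.exists_isLiftedMonodromy (γ : DevMap C) : ∃ h, γ.IsLiftedMonodromy h := by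
  obtain ⟨c⟩ := nonempty_param C
  obtain ⟨φ, hφ, hφe⟩ := γ.exists_continuous_lift c
  obtain ⟨g, hg⟩ := γ.quasiPeriodic
  induction g using QuotientGroup.induction_on with | _ A => ?_
  have hdet := det_SL2 A
  obtain ⟨m, hm, hme⟩ := exists_polar_lift
    (f := fun θ => A 0 0 * Real.sin θ + A 0 1 * Real.cos θ)
    (g := fun θ => A 1 0 * Real.sin θ + A 1 1 * Real.cos θ) (by fun_prop) (by fun_prop)
    fun θ => by
      by_contra hcon
      push Not at hcon
      obtain ⟨h1, h2⟩ := hcon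
      refine sin_cos_ne_zero θ ?_
      have hs : Real.sin θ = 0 := by
        linear_combination (-Real.sin θ) * hdet + A 1 1 * h1 - A 0 1 * h2
      have hc : Real.cos θ = 0 := by
        linear_combination (-Real.cos θ) * hdet + A 0 0 * h2 - A 1 0 * h1
      simp [hs, hc]
  have hrp : ∀ y, rp (φ (y + 1)) = rp (m (φ y)) := fun y => by
    obtain ⟨r, -, h1, h2⟩ := hme (φ y)
    rw [← hφe, Param.map_add_one, hg, hφe]
    exact mk_smul_rp A h1 h2
  have hlc : IsLocallyConstant fun y => φ (y + 1) - m (φ y) := by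
    refine (IsLocallyConstant.iff_eventually_eq _).2 fun y => ?_
    obtain ⟨k, hk⟩ := eventually_eq_add_of_rp_eq (φ := fun y => φ (y + 1)) (ψ := fun y => m (φ y))
      (x := y) (hφ.comp (by fun_prop)).continuousAt (hm.comp hφ).continuousAt (.of_forall hrp)
    filter_upwards [hk] with z hz
    rw [hz, hk.self_of_nhds]
    ring
  obtain ⟨k, hk⟩ := rp_eq_rp_iff.1 (hrp 0)
  have hall : ∀ y, φ (y + 1) = m (φ y) + k * Real.pi := fun y => by
    have := hlc.apply_eq_of_preconnectedSpace y 0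
    linarith
  have hsin := fun θ => Real.sin_add_int_mul_pi (m θ) k
  have hcos := fun θ => Real.cos_add_int_mul_pi (m θ) k
  -- Adding kπ to the lift reverses the rays for odd k, so the matrix has to change sign
  -- accordingly.
  obtain ⟨B, hB⟩ : ∃ B : SL(2, ℝ), ∀ i j, B i j = (-1 : ℝ) ^ k * A i j := by
    rcases Int.even_or_odd k with hk | hk
    · exact ⟨A, fun i j => by rw [hk.neg_one_zpow, one_mul]⟩
    · exact ⟨-A, fun i j => by rw [hk.neg_one_zpow]; simp⟩
  refine ⟨⟨B, ⟨fun θ => m θ + k * Real.pi, by fun_prop⟩, fun θ => ?_⟩, φ ∘ c.inv,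
    hφ.comp (Param.continuous_inv c), fun x => ?_, fun x => ?_⟩
  · obtain ⟨r, hr, h1, h2⟩ := hme θ
    refine ⟨r, hr, ?_⟩
    have hB' : ∀ i j, B.1 i j = (-1 : ℝ) ^ k * A i j := hB
    ext i
    fin_cases i
    · simp [Matrix.mulVec, dotProduct, Fin.sum_univ_two, hB', hsin]
      linear_combination (-1 : ℝ) ^ k * h1
    · simp [Matrix.mulVec, dotProduct, Fin.sum_univ_two, hB', hcos]
      linear_combination (-1 : ℝ) ^ k * h2
  · rw [Function.comp_apply, ← hφe, Param.map_inv]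
  · rw [Function.comp_apply, Param.inv_κ, hall]
    rfl

theorem DevMap.isLiftedMonodromy_q (γ : DevMap C) : γ.IsLiftedMonodromy γ.q :=
  Classical.epsilon_spec γ.exists_isLiftedMonodromy

theorem mul_pos_of_continuous {r : ℝ → ℝ} (hr : Continuous r) (h0 : ∀ x, r x ≠ 0) (x y : ℝ) :
    0 < r x * r y := by
  by_contra hcon
  push Not at hcon
  have hmem : (0 : ℝ) ∈ Set.uIcc (r x) (r y) := by
    rw [Set.mem_uIcc]
    rcases mul_nonpos_iff.1 hcon with h | h
    · exact Or.inr ⟨h.2, h.1⟩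
    · exact Or.inl ⟨h.1, h.2⟩
  obtain ⟨z, -, hz⟩ := intermediate_value_uIcc hr.continuousOn hmem
  exact h0 z hz

variable {c : C.Param} {n : ℕ} {p : EuclideanSpace ℝ (Fin n) → DevMap C}
  {a b : SmoothFn (EuclideanSpace ℝ (Fin n) × ℝ)}

/-- The vectors A(a, b)(x) and (a, b)(x + 1) span the same line. Equality of Wronskians makes the
factor ±1, and the lift on rays makes it positive. -/
theorem IsNormalizedLift.hasMonodromy (h : IsNormalizedLift c p a b) :
    HasMonodromy a b fun s => (p s).q.mat := by
  intro s
  obtain ⟨ψ, hψ, hψe, hψκ⟩ := (p s).isLiftedMonodromy_q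
  set A := (p s).q.mat with hA
  have hdet := det_SL2 A
  have hac := continuous_snd a s
  have hbc := continuous_snd b s
  have hψc : Continuous fun y => ψ (c.map y) := hψ.comp (Param.continuous_map c)
  set r : ℝ → ℝ := fun y => a.1 (s, y) * Real.sin (ψ (c.map y)) +
    b.1 (s, y) * Real.cos (ψ (c.map y)) with hr
  have hrc : Continuous r := (hac.mul (Real.continuous_sin.comp hψc)).add
    (hbc.mul (Real.continuous_cos.comp hψc))
  have hrel : ∀ y, r y ≠ 0 ∧ a.1 (s, y) = r y * Real.sin (ψ (c.map y)) ∧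
      b.1 (s, y) = r y * Real.cos (ψ (c.map y)) := fun y => by
    obtain ⟨hne, he⟩ := h.proj s y
    rw [hψe] at he
    obtain ⟨q, hq, h1, h2⟩ := mk_eq_mk_cross he.symm
    have hrq : r y = q := by
      have := Real.sin_sq_add_cos_sq (ψ (c.map y))
      simp only [hr]
      rw [h1, h2]
      linear_combination q * this
    rw [hrq]
    exact ⟨hq, h1, h2⟩
  -- Positivity uses that the nonvanishing continuous `r` has constant sign, and that elements of
  -- `SLTilde` act on rays rather than lines.
  have hτ : ∀ y, ∃ τ : ℝ, 0 < τ ∧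
      A 0 0 * a.1 (s, y) + A 0 1 * b.1 (s, y) = τ * a.1 (s, y + 1) ∧
      A 1 0 * a.1 (s, y) + A 1 1 * b.1 (s, y) = τ * b.1 (s, y + 1) := fun y => by
    obtain ⟨ρ, hρ, hv⟩ := (p s).q.lifts (ψ (c.map y))
    obtain ⟨h0, h1, h2⟩ := hrel y
    obtain ⟨h0', h1', h2'⟩ := hrel (y + 1)
    rw [Param.map_add_one, hψκ] at h1' h2'
    have hv0 := congrFun hv 0
    have hv1 := congrFun hv 1
    simp [Matrix.mulVec, dotProduct, Fin.sum_univ_two] at hv0 hv1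
    have hpos := mul_pos_of_continuous hrc (fun y => (hrel y).1) y (y + 1)
    refine ⟨r y * ρ / r (y + 1), ?_, ?_, ?_⟩
    · rw [show r y * ρ / r (y + 1) = (r y * r (y + 1)) * ρ / (r (y + 1)) ^ 2 by field_simp]
      positivity
    · rw [h1, h2, h1']
      field_simp
      linear_combination hv0
    · rw [h1, h2, h2']
      field_simp
      linear_combination hv1
  have hW := wronskian_val h.wronskian
  intro x
  obtain ⟨τ, hτ0, e1, e2⟩ := hτ x
  -- Proportionality in the form of a vanishing cross product can be differentiated without knowing
  -- that τ is differentiable.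
  have hcross : ∀ y, (A 0 0 • a + A 0 1 • b).1 (s, y) * (shift b).1 (s, y) =
      (A 1 0 • a + A 1 1 • b).1 (s, y) * (shift a).1 (s, y) := fun y => by
    obtain ⟨τ, -, e1, e2⟩ := hτ y
    simp only [add_val, smul_val, shift_val, e1, e2]
    ring
  have hd := dx_congr_slice (f := (A 0 0 • a + A 0 1 • b) * shift b)
    (f' := (A 1 0 • a + A 1 1 • b) * shift a) (s := s) (s' := s) hcross x
  simp only [dir_mul, map_add, Derivation.map_smul, dir_shift, add_val, mul_val, smul_val,
    shift_val, e1, e2] at hd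
  have hsq : τ * τ = 1 := by
    have w0 := hW (s, x)
    have w1 := hW (s, x + 1)
    have key : ((A 0 0 * (dx a).1 (s, x) + A 0 1 * (dx b).1 (s, x)) *
        (A 1 0 * a.1 (s, x) + A 1 1 * b.1 (s, x)) -
        (A 0 0 * a.1 (s, x) + A 0 1 * b.1 (s, x)) *
        (A 1 0 * (dx a).1 (s, x) + A 1 1 * (dx b).1 (s, x))) = 1 := by
      linear_combination (A 0 0 * A 1 1 - A 0 1 * A 1 0) * w0 + hdet
    rw [e1, e2] at key
    linear_combination key - τ * hd - τ * τ * w1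
  have hτ1 : τ = 1 := by nlinarith
  rw [hτ1, one_mul] at e1 e2
  exact ⟨e1.symm, e2.symm⟩

end Monodromy

/-! ### Transformations of normalized lifts -/

section Transform

variable {C : CircleCover} {c : C.Param} {n : ℕ} {p : EuclideanSpace ℝ (Fin n) → DevMap C}
  {a b : SmoothFn (EuclideanSpace ℝ (Fin n) × ℝ)}

theorem IsNormalizedLift.smul (h : IsNormalizedLift c p a b)
    (A : EuclideanSpace ℝ (Fin n) → SL(2, ℝ))
    (α : Fin 2 → Fin 2 → SmoothFn (EuclideanSpace ℝ (Fin n) × ℝ))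
    (hα : ∀ i j s x, (α i j).1 (s, x) = A s i j) :
    IsNormalizedLift c (fun s => (QuotientGroup.mk (A s) : PSL2R) • p s)
      (α 0 0 * a + α 0 1 * b) (α 1 0 * a + α 1 1 * b) where
  wronskian := by
    have hd : ∀ i j, dx (α i j) = 0 := fun i j => ext_val fun ⟨s, x⟩ => by
      have h1 := hasDerivAt_snd (α i j) s x
      simp only [hα] at h1
      exact h1.unique (hasDerivAt_const _ _)
    have hdet : α 0 0 * α 1 1 - α 0 1 * α 1 0 = 1 := ext_val fun ⟨s, x⟩ => by
      simp only [sub_val, mul_val, hα, one_val]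
      exact det_SL2 (A s)
    simp only [map_add, dir_mul, hd]
    linear_combination (α 0 0 * α 1 1 - α 0 1 * α 1 0) * h.wronskian + hdet
  proj s x := by
    obtain ⟨hne, he⟩ := h.proj s x
    have e : (A s) • ![a.1 (s, x), b.1 (s, x)] =
        ![(α 0 0 * a + α 0 1 * b).1 (s, x), (α 1 0 * a + α 1 1 * b).1 (s, x)] := by
      change (A s : Matrix (Fin 2) (Fin 2) ℝ) *ᵥ _ = _
      ext i
      fin_cases i <;> simp [Matrix.mulVec, dotProduct, Fin.sum_univ_two, hα]
    have hne' : A s • ![a.1 (s, x), b.1 (s, x)] ≠ 0 := (smul_ne_zero_iff_ne (A s)).2 hne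
    refine ⟨e ▸ hne', ?_⟩
    change (QuotientGroup.mk (A s) : PSL2R) • (p s).toFun (c.map x) = _
    rw [he]
    change Projectivization.mk ℝ (A s • ![a.1 (s, x), b.1 (s, x)]) hne' = _
    congr 1

theorem IsNormalizedLift.reparam (h : IsNormalizedLift c p a b) {m : ℕ}
    (g : EuclideanSpace ℝ (Fin m) → EuclideanSpace ℝ (Fin n)) (hg : ContDiff ℝ ∞ g) :
    IsNormalizedLift c (fun s => p (g s)) (reparam g hg a) (reparam g hg b) where
  wronskian := by
    rw [dx_reparam, dx_reparam, ← map_mul, ← map_mul, ← map_sub, h.wronskian, map_one]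
  proj s x := h.proj (g s) x

/-! ### Reparametrizations of the circle depending on parameters -/

section Flow

variable {m : ℕ} {g : EuclideanSpace ℝ (Fin m) → EuclideanSpace ℝ (Fin n)} (hg : ContDiff ℝ ∞ g)
  (f : SmoothFn (EuclideanSpace ℝ (Fin m) × ℝ))

/-- Substitution of a family of functions of the circle variable. -/
def substFamily : SmoothFn (EuclideanSpace ℝ (Fin n) × ℝ) →ₐ[ℝ]
    SmoothFn (EuclideanSpace ℝ (Fin m) × ℝ) :=
  comp (fun z => (g z.1, f.1 z)) ((hg.comp contDiff_fst).prodMk f.contDiff)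

theorem dir_substFamily (F : SmoothFn (EuclideanSpace ℝ (Fin n) × ℝ))
    (v z : EuclideanSpace ℝ (Fin m) × ℝ) (hv : fderiv ℝ g z.1 v.1 = 0) :
    (dir v (substFamily hg f F)).1 z = (dir v f * substFamily hg f (dx F)).1 z := by
  have h : HasFDerivAt (fun z : EuclideanSpace ℝ (Fin m) × ℝ => (g z.1, f.1 z))
      (((fderiv ℝ g z.1).comp (ContinuousLinearMap.fst ℝ _ ℝ)).prod (fderiv ℝ f.1 z)) z :=
    (((hg.differentiable (by simp)).differentiableAt.hasFDerivAt).comp z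
      hasFDerivAt_fst).prodMk (f.differentiableAt z).hasFDerivAt
  have e : fderiv ℝ (fun z : EuclideanSpace ℝ (Fin m) × ℝ => (g z.1, f.1 z)) z v =
      (dir v f).1 z • ((0 : EuclideanSpace ℝ (Fin n)), (1 : ℝ)) := by
    rw [h.fderiv]
    simp [hv, dir_val]
  rw [substFamily, dir_comp_val, e, dir_smul_left]
  rfl

theorem dx_substFamily (F : SmoothFn (EuclideanSpace ℝ (Fin n) × ℝ)) :
    dx (substFamily hg f F) = dx f * substFamily hg f (dx F) :=
  ext_val fun z => dir_substFamily hg f F _ z (map_zero _)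

theorem IsNormalizedLift.substFamily (h : IsNormalizedLift c p a b) {C' : CircleCover}
    {c' : C'.Param} {p' : EuclideanSpace ℝ (Fin m) → DevMap C'} (hf : ∀ z, 0 < (dx f).1 z)
    (hp' : ∀ s x, (p' s).toFun (c'.map x) = (p (g s)).toFun (c.map (f.1 (s, x)))) :
    IsNormalizedLift c' p' (invSqrt (dx f) hf * substFamily hg f a)
      (invSqrt (dx f) hf * substFamily hg f b) where
  wronskian := by
    have h1 := congrArg (Virasoro.substFamily hg f) h.wronskian
    rw [map_sub, map_mul, map_mul, map_one] at h1
    rw [dir_mul, dir_mul, dx_substFamily, dx_substFamily]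
    linear_combination (invSqrt (dx f) hf * invSqrt (dx f) hf * dx f) * h1 + invSqrt_mul (dx f) hf
  proj s x := by
    obtain ⟨hne, he⟩ := h.proj (g s) (f.1 (s, x))
    set r := (invSqrt (dx f) hf).1 (s, x) with hr
    have hr0 : r ≠ 0 := (Real.rpow_pos_of_pos (hf (s, x)) _).ne'
    have e : ![(invSqrt (dx f) hf * Virasoro.substFamily hg f a).1 (s, x),
        (invSqrt (dx f) hf * Virasoro.substFamily hg f b).1 (s, x)] =
        r • ![a.1 (g s, f.1 (s, x)), b.1 (g s, f.1 (s, x))] := by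
      rw [Matrix.smul_cons, Matrix.smul_cons]
      simp only [mul_val, Matrix.smul_empty]
      rfl
    have hne' : ![(invSqrt (dx f) hf * Virasoro.substFamily hg f a).1 (s, x),
        (invSqrt (dx f) hf * Virasoro.substFamily hg f b).1 (s, x)] ≠ 0 := by
      rw [e]
      exact smul_ne_zero hr0 hne
    refine ⟨hne', ?_⟩
    rw [hp', he]
    exact ((Projectivization.mk_eq_mk_iff' ℝ _ _ _ _).2 ⟨r, e.symm⟩).symm

/-- Along `t` the family moves only through `f`; the variation of the factor in front cancels in
`gen`, leaving δ_t f divided by the x-derivative of `f`. -/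
theorem eps_substFamily (h : IsNormalizedLift c p a b) (hf : ∀ z, 0 < (dx f).1 z)
    (t : EuclideanSpace ℝ (Fin m)) (ht : ∀ s, fderiv ℝ g s t = 0) :
    eps (invSqrt (dx f) hf * substFamily hg f a) (invSqrt (dx f) hf * substFamily hg f b) t =
      invSqrt (dx f) hf * invSqrt (dx f) hf * ds t f := by
  have hs : ∀ F, ds t (Virasoro.substFamily hg f F) =
      ds t f * Virasoro.substFamily hg f (dx F) :=
    fun F => ext_val fun z => dir_substFamily hg f F _ z (ht z.1)
  have h1 := congrArg (Virasoro.substFamily hg f) h.wronskian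
  rw [map_sub, map_mul, map_mul, map_one] at h1
  rw [eps, gen, dir_mul, dir_mul, hs, hs]
  linear_combination (invSqrt (dx f) hf * invSqrt (dx f) hf * ds t f) * h1

end Flow

/-- By the mean value theorem the derivative equals 1 somewhere on a period, and it cannot change
sign. -/
theorem dx_pos_of_shift {E : Type} [NormedAddCommGroup E] [NormedSpace ℝ E]
    {f : SmoothFn (E × ℝ)} (h1 : ∀ s x, f.1 (s, x + 1) = f.1 (s, x) + 1)
    (h0 : ∀ z, (dx f).1 z ≠ 0) (z : E × ℝ) : 0 < (dx f).1 z := by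
  obtain ⟨s, x⟩ := z
  obtain ⟨y, -, hy⟩ := exists_hasDerivAt_eq_slope (fun x => f.1 (s, x)) (fun x => (dx f).1 (s, x))
    zero_lt_one (continuous_snd f s).continuousOn fun x _ => hasDerivAt_snd f s x
  have h2 := h1 s 0
  rw [zero_add] at h2
  rw [h2] at hy
  have hy1 : (dx f).1 (s, y) = 1 := by rw [hy]; ring
  have := mul_pos_of_continuous (continuous_snd (dx f) s) (fun x => h0 (s, x)) x y
  rwa [hy1, mul_one] at this

theorem dx_ofCircle {E : Type} [NormedAddCommGroup E] [NormedSpace ℝ E] {f : ℝ → ℝ}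
    (hf : ContDiff ℝ ∞ f) (z : E × ℝ) : (dx (ofCircle f hf)).1 z = deriv f z.2 :=
  (hasDerivAt_snd (ofCircle f hf) z.1 z.2).unique
    (hf.differentiable (by simp)).differentiableAt.hasDerivAt

/-- The change of parameter between two parametrizations. -/
theorem exists_transition (c c' : C.Param) : ∃ f : ℝ → ℝ, ContDiff ℝ ∞ f ∧ (∀ x, 0 < deriv f x) ∧
    (∀ x, f (x + 1) = f x + 1) ∧ ∀ x, c'.map x = c.map (f x) := by
  set f : ℝ → ℝ := fun x => c.inv (c'.map x) with hf
  set g : ℝ → ℝ := fun x => c'.inv (c.map x) with hg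
  have hfc : ContDiff ℝ ∞ f := ((Param.contMDiff_inv c).comp (Param.contMDiff_map c')).contDiff
  have hgc : ContDiff ℝ ∞ g := ((Param.contMDiff_inv c').comp (Param.contMDiff_map c)).contDiff
  have hf1 : ∀ x, f (x + 1) = f x + 1 := fun x => by
    simp only [hf]
    rw [Param.map_add_one, Param.inv_κ]
  refine ⟨f, hfc, fun x => ?_, hf1, fun x => (Param.map_inv c _).symm⟩
  have hd : ∀ x, HasDerivAt f (deriv f x) x := fun x =>
    (hfc.differentiable (by simp)).differentiableAt.hasDerivAt
  have hne : ∀ x, deriv f x ≠ 0 := fun x h0 => by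
    have h1 := ((hgc.differentiable (by simp)).differentiableAt (x := f x)).hasDerivAt.comp x (hd x)
    have h2 : g ∘ f = id := funext fun y => by
      simp only [hf, hg, Function.comp_apply, Param.map_inv, Param.inv_map, id]
    rw [h2, h0, mul_zero] at h1
    exact one_ne_zero ((hasDerivAt_id x).unique h1)
  have key := dx_pos_of_shift (E := EuclideanSpace ℝ (Fin 0)) (f := ofCircle f hfc)
    (fun _ x => hf1 x) (fun z => by
      rw [dx_ofCircle]
      exact hne z.2) (0, x)
  rwa [dx_ofCircle] at key

/-- Transporting `a`, `b` by the change of parameter gives a normalized lift for `c'`. By uniqueness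
it yields the same form as `a'`, `b'`, and `twoForm_substitute` compares it with the original. -/
theorem IsNormalizedLift.twoForm_param (h : IsNormalizedLift c p a b) {c' : C.Param}
    {a' b' : SmoothFn (EuclideanSpace ℝ (Fin n) × ℝ)} (h' : IsNormalizedLift c' p a' b') :
    twoForm a' b' = twoForm a b := by
  obtain ⟨f, hf, hpos, hf1, hfc⟩ := exists_transition c c'
  have hpos' : ∀ z : EuclideanSpace ℝ (Fin n) × ℝ, 0 < (dx (ofCircle f hf)).1 z := fun z => by
    rw [dx_ofCircle]
    exact hpos _
  have h1 := h.substFamily (g := fun s => s) contDiff_id (ofCircle f hf) (c' := c') (p' := p) hpos'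
    fun s x => by rw [hfc]; rfl
  rw [h1.twoForm_eq h']
  set m : ℝ → ℝ := fun x => deriv f x ^ (-(1 / 2) : ℝ) with hm
  have hmc : ContDiff ℝ ∞ m := (contDiff_deriv hf).rpow_const_of_ne fun x => (hpos x).ne'
  have hd1 : ∀ x, deriv f (x + 1) = deriv f x := fun x => by
    have e : (fun y => f (y + 1)) = fun y => f y + 1 := funext hf1
    rw [← deriv_comp_add_const, e, deriv_add_const]
  have hinv : invSqrt (dx (ofCircle f hf)) hpos' = ofCircle m hmc := ext_val fun z => by
    change (dx (ofCircle f hf)).1 z ^ (-(1 / 2) : ℝ) = deriv f z.2 ^ (-(1 / 2) : ℝ)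
    rw [dx_ofCircle]
  refine twoForm_substitute hf hmc (fun x => rpow_neg_half_mul (hpos x)) hf1
    (fun x => by simp only [hm, hd1]) h.wronskian h.hasMonodromy.shift_pot ?_ ?_
  · rw [hinv]; rfl
  · rw [hinv]; rfl

end Transform

/-! ### The 2-form on the space of developing maps -/

/-- A parametrization of the circle. -/
def CircleCover.param (C : CircleCover) : C.Param := (nonempty_param C).some

open Classical in
/-- The pullback of the 2-form along a family of developing maps. -/
def pullForm {C : CircleCover} {n : ℕ} (p : EuclideanSpace ℝ (Fin n) → DevMap C) :
    EuclideanSpace ℝ (Fin n) → EuclideanSpace ℝ (Fin n) [⋀^Fin 2]→L[ℝ] ℝ :=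
  -- The default value 0 is never taken on plots, which always have a normalized lift.
  if h : ∃ a b, IsNormalizedLift C.param p a b then twoForm h.choose h.choose_spec.choose else 0

theorem IsNormalizedLift.toParam {C : CircleCover} {c : C.Param} {n : ℕ}
    {p : EuclideanSpace ℝ (Fin n) → DevMap C} {a b : SmoothFn (EuclideanSpace ℝ (Fin n) × ℝ)}
    (h : IsNormalizedLift c p a b) (c' : C.Param) : ∃ a' b', IsNormalizedLift c' p a' b' := by
  obtain ⟨f, hf, hpos, hf1, hfc⟩ := exists_transition c c'
  exact ⟨_, _, h.substFamily (g := fun s => s) contDiff_id (ofCircle f hf)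
    (fun z => by rw [dx_ofCircle]; exact hpos _) fun s x => by rw [hfc]; rfl⟩

theorem IsNormalizedLift.pullForm_eq {C : CircleCover} {c : C.Param} {n : ℕ}
    {p : EuclideanSpace ℝ (Fin n) → DevMap C} {a b : SmoothFn (EuclideanSpace ℝ (Fin n) × ℝ)}
    (h : IsNormalizedLift c p a b) : pullForm p = twoForm a b := by
  have hex : ∃ a b, IsNormalizedLift C.param p a b := h.toParam _
  rw [pullForm, dif_pos hex]
  exact h.twoForm_param hex.choose_spec.choose_spec

/-- The 2-form on the space of developing maps. -/
def devForm (C : CircleCover) : DForm (DevMap C) 2 where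
  pull p := pullForm p
  smooth p hp := by
    obtain ⟨a, b, h, -⟩ := exists_normalizedLift C.param hp
    rw [h.pullForm_eq]
    exact contDiff_twoForm a b
  reparam p g hp hg s := by
    obtain ⟨a, b, h, -⟩ := exists_normalizedLift C.param hp
    have h' : IsNormalizedLift C.param (p ∘ g) (reparam g hg a) (reparam g hg b) := h.reparam g hg
    rw [h.pullForm_eq, h'.pullForm_eq]
    ext w
    exact twoForm_reparam g hg a b s w

theorem IsNormalizedLift.pull_eq {C : CircleCover} {c : C.Param} {n : ℕ}
    {p : EuclideanSpace ℝ (Fin n) → DevMap C} {a b : SmoothFn (EuclideanSpace ℝ (Fin n) × ℝ)}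
    (h : IsNormalizedLift c p a b) : (devForm C).pull p = twoForm a b := h.pullForm_eq

/-! ### Properties of the 2-form -/

section Properties

variable {C : CircleCover} {c : C.Param} {n : ℕ} {p : EuclideanSpace ℝ (Fin n) → DevMap C}
  {a b : SmoothFn (EuclideanSpace ℝ (Fin n) × ℝ)}

/-- The same functions `a`, `b` serve for the pulled back family once the parametrization is
transported, so naturality reduces to independence of the parametrization. -/
theorem IsNormalizedLift.pullback (h : IsNormalizedLift c p a b) {C' : CircleCover}
    (Φ : Iso C' C) : IsNormalizedLift (C := C') (c.trans Φ.symm) (fun s => (p s).pullback Φ) a b where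
  wronskian := h.wronskian
  proj s x := by
    have e : Φ.toDiffeo (CircleCover.Param.map (c.trans Φ.symm) x) = c.map x :=
      Φ.toDiffeo.apply_symm_apply _
    change ∃ hne, (p s).toFun (Φ.toDiffeo (CircleCover.Param.map (c.trans Φ.symm) x)) = _
    rw [e]
    exact h.proj s x

theorem IsNormalizedLift.dMat_eq (h : IsNormalizedLift c p a b) (s w : EuclideanSpace ℝ (Fin n)) :
    dMat (fun s' => (p s').q) s w = dMonMat a b w s := by
  ext i j
  exact h.hasMonodromy.fderiv_eq h.wronskian s w i j

theorem cartanForm_eq (h : EuclideanSpace ℝ (Fin n) → SLTilde) (s : EuclideanSpace ℝ (Fin n))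
    (w : Fin 3 → EuclideanSpace ℝ (Fin n)) : cartanForm h s w =
      (thetaL h s (w 0) * ⁅thetaL h s (w 1), thetaL h s (w 2)⁆).trace := by
  unfold cartanForm thetaBracket
  generalize thetaL h s (w 0) = x
  generalize thetaL h s (w 1) = y
  generalize thetaL h s (w 2) = z
  simp only [two_smul, Ring.lie_def, Matrix.trace_fin_two, Matrix.mul_apply, Matrix.sub_apply,
    Matrix.add_apply, Fin.sum_univ_two]
  ring

theorem IsNormalizedLift.extDeriv_pull (h : IsNormalizedLift c p a b)
    (s : EuclideanSpace ℝ (Fin n)) (w : Fin 3 → EuclideanSpace ℝ (Fin n)) :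
    extDeriv ((devForm C).pull p) s w = cartanForm (fun s' => (p s').q) s w := by
  rw [h.pull_eq, extDeriv_twoForm_monodromy h.hasMonodromy h.wronskian, cartanForm_eq]
  simp only [thetaL, h.dMat_eq]

theorem IsNormalizedLift.pull_smul (h : IsNormalizedLift c p a b) (g : PSL2R) :
    (devForm C).pull (fun s => g • p s) = (devForm C).pull p := by
  induction g using QuotientGroup.induction_on with | _ A => ?_
  set α : Fin 2 → Fin 2 → SmoothFn (EuclideanSpace ℝ (Fin n) × ℝ) :=
    fun i j => algebraMap ℝ _ (A i j) with hα
  have h' := h.smul (fun _ => A) α fun _ _ _ _ => rfl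
  have hd : ∀ v i j, dir v (α i j) = 0 := fun v i j => Derivation.map_algebraMap _ _
  have hdet : α 0 0 * α 1 1 - α 0 1 * α 1 0 = 1 := by
    rw [hα, ← map_mul, ← map_mul, ← map_sub, det_SL2, map_one]
  -- Both `eps` and `pot` are determinants in the pair, hence unchanged by a constant matrix of
  -- determinant 1.
  have heps : ∀ w, eps (α 0 0 * a + α 0 1 * b) (α 1 0 * a + α 1 1 * b) w = eps a b w := fun w => by
    simp only [eps, gen, map_add, dir_mul, hd]
    linear_combination (b * ds w a - a * ds w b) * hdet
  have hpot : pot dx (α 0 0 * a + α 0 1 * b) (α 1 0 * a + α 1 1 * b) = pot dx a b := by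
    simp only [pot, map_add, dir_mul, hd, zero_mul, zero_add]
    linear_combination (dx (dx a) * dx b - dx (dx b) * dx a) * hdet
  rw [h.pull_eq, h'.pull_eq]
  ext s w
  exact twoForm_congr id (fun w x => by rw [heps]; rfl) (fun x => by rw [hpot])
    (fun w x => by rw [hpot]; rfl) w

/-! #### Families with an additional parameter -/

/-- The projection that forgets the first coordinate. -/
def tailL (n : ℕ) : EuclideanSpace ℝ (Fin (n + 1)) →L[ℝ] EuclideanSpace ℝ (Fin n) :=
  LinearMap.toContinuousLinearMap
    { toFun := fun z => WithLp.toLp 2 fun i : Fin n => z i.succ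
      map_add' := fun _ _ => rfl
      map_smul' := fun _ _ => rfl }

/-- The inclusion as the hyperplane where the first coordinate vanishes. -/
def consL (n : ℕ) : EuclideanSpace ℝ (Fin n) →L[ℝ] EuclideanSpace ℝ (Fin (n + 1)) :=
  LinearMap.toContinuousLinearMap
    { toFun := fun s => WithLp.toLp 2 (Fin.cons 0 fun i : Fin n => s i)
      map_add' := fun _ _ => by
        ext i
        refine Fin.cases ?_ (fun i => ?_) i <;> simp
      map_smul' := fun _ _ => by
        ext i
        refine Fin.cases ?_ (fun i => ?_) i <;> simp }

theorem consL_zero (s : EuclideanSpace ℝ (Fin n)) : consL n s 0 = 0 := rfl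

theorem tailL_consL (s : EuclideanSpace ℝ (Fin n)) : tailL n (consL n s) = s := rfl

theorem tailL_single : tailL n (EuclideanSpace.single 0 1) = 0 := by
  ext i
  change (EuclideanSpace.single (0 : Fin (n + 1)) (1 : ℝ)) i.succ = 0
  simp [Fin.succ_ne_zero]

theorem contract_eq (α : DForm (DevMap C) 2) (ρ : ℝ → DevMap C → DevMap C)
    (s w : EuclideanSpace ℝ (Fin n)) : α.contract ρ p s w =
      α.pull (fun z => ρ (z 0) (p (tailL n z))) (consL n s)
        ![EuclideanSpace.single 0 1, consL n w] := rfl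

/-- Derivatives in directions tangent to the hyperplane where the first coordinate vanishes. -/
theorem ds_consL (F : SmoothFn (EuclideanSpace ℝ (Fin (n + 1)) × ℝ))
    (s w : EuclideanSpace ℝ (Fin n)) (x : ℝ) :
    (ds (consL n w) F).1 (consL n s, x) = fderiv ℝ (fun s' => F.1 (consL n s', x)) s w := by
  have h := dir_reparam (consL n) (consL n).contDiff F w 0 s x
  rw [ContinuousLinearMap.fderiv] at h
  rw [← h]
  exact (fderiv_fst (reparam (consL n) (consL n).contDiff F) s w x).symm

/-- The contraction is computed on the family with an extra time coordinate, while the Maurer-Cartan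
forms refer to the original one; the two agree in directions tangent to time 0. -/
theorem dMat_consL {p' : EuclideanSpace ℝ (Fin (n + 1)) → DevMap C}
    {a' b' : SmoothFn (EuclideanSpace ℝ (Fin (n + 1)) × ℝ)} (h' : IsNormalizedLift c p' a' b')
    (hp : ∀ s, p' (consL n s) = p s) (s w : EuclideanSpace ℝ (Fin n)) :
    dMat (fun s' => (p s').q) s w = dMonMat a' b' (consL n w) (consL n s) := by
  ext i j
  have e : (fun s' => (p s').q.mat i j) = fun s' => (monMat a' b' i j).1 (consL n s', 0) :=
    funext fun s' => by rw [h'.hasMonodromy.monMat_val h'.wronskian, hp]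
  change fderiv ℝ (fun s' => (p s').q.mat i j) s w =
    (ds (consL n w) (monMat a' b' i j)).1 (consL n s, 0)
  rw [ds_consL, e]

/-! #### Contraction with the generators of the projective action -/

section Exp

open scoped Matrix.Norms.Operator

theorem contDiff_exp_smul (X : Matrix (Fin 2) (Fin 2) ℝ) (i j : Fin 2) :
    ContDiff ℝ ∞ fun t : ℝ => NormedSpace.exp (t • X) i j := by
  have h1 : ContDiff ℝ ∞ fun t : ℝ => NormedSpace.exp (t • X) := by
    refine contDiff_iff_contDiffAt.2 fun t => ?_
    exact ((NormedSpace.exp_analytic (𝕂 := ℝ) (t • X)).contDiffAt).comp t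
      (contDiff_id.smul contDiff_const).contDiffAt
  exact (Matrix.entryLinearMap ℝ ℝ i j).toContinuousLinearMap.contDiff.comp h1

theorem hasDerivAt_exp_smul (X : Matrix (Fin 2) (Fin 2) ℝ) (t : ℝ) (i j : Fin 2) :
    HasDerivAt (fun t : ℝ => NormedSpace.exp (t • X) i j)
      ((X * NormedSpace.exp (t • X)) i j) t :=
  (Matrix.entryLinearMap ℝ ℝ i j).toContinuousLinearMap.hasFDerivAt.comp_hasDerivAt t
    (hasDerivAt_exp_smul_const' X t)

end Exp

end Properties

section Projective

variable {C : CircleCover} {c : C.Param} {n : ℕ} {p : EuclideanSpace ℝ (Fin n) → DevMap C}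
  {a b : SmoothFn (EuclideanSpace ℝ (Fin n) × ℝ)}

theorem DevMap.ext_toFun {γ γ' : DevMap C} (h : ∀ x, γ.toFun x = γ'.toFun x) : γ = γ' := by
  cases γ
  cases γ'
  congr
  exact funext h

/-- Entries of `exp (-tX)`, where `t` is the first coordinate. -/
def expEntry (n : ℕ) (X : Matrix (Fin 2) (Fin 2) ℝ) (i j : Fin 2) :
    SmoothFn (EuclideanSpace ℝ (Fin (n + 1)) × ℝ) :=
  ⟨fun z => NormedSpace.exp ((-(z.1 0)) • X) i j,
    (contDiff_exp_smul X i j).comp (by fun_prop :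
      ContDiff ℝ ∞ fun z : EuclideanSpace ℝ (Fin (n + 1)) × ℝ => -(z.1 0))⟩

theorem ds_expEntry (X : Matrix (Fin 2) (Fin 2) ℝ) (i j : Fin 2) :
    ds (EuclideanSpace.single 0 1) (expEntry n X i j) =
      -(X i 0 • expEntry n X 0 j + X i 1 • expEntry n X 1 j) := ext_val fun z => by
  have h1 : HasFDerivAt (fun z : EuclideanSpace ℝ (Fin (n + 1)) × ℝ => -(z.1 0))
      (-((EuclideanSpace.proj (𝕜 := ℝ) (0 : Fin (n + 1))).comp (ContinuousLinearMap.fst ℝ _ ℝ))) z :=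
    ((EuclideanSpace.proj (𝕜 := ℝ) (0 : Fin (n + 1))).hasFDerivAt.comp z hasFDerivAt_fst).neg
  have h2 := (hasDerivAt_exp_smul X (-(z.1 0)) i j).comp_hasFDerivAt z h1
  have h3 : HasFDerivAt (expEntry n X i j).1 _ z := h2
  rw [dir_val, h3.fderiv]
  have e : ∀ k, (expEntry n X k j).1 z = NormedSpace.exp ((-(z.1 0)) • X) k j := fun _ => rfl
  rw [neg_val, add_val, smul_val, smul_val, e, e]
  simp [Matrix.mul_apply, Fin.sum_univ_two]

theorem ds_reparam_tailL (F : SmoothFn (EuclideanSpace ℝ (Fin n) × ℝ)) :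
    ds (EuclideanSpace.single 0 1) (reparam (tailL n) (tailL n).contDiff F) = 0 :=
  ext_val fun ⟨s, x⟩ => by
    rw [dir_reparam, ContinuousLinearMap.fderiv, tailL_single, Prod.mk_zero_zero, dir_val, map_zero]
    rfl

/-- The extended family has the lift exp(−tX)(a, b), whose time derivative is −X times itself, as
`twoForm_of_linear` requires. -/
theorem IsNormalizedLift.contract_exp (h : IsNormalizedLift c p a b) (X : sl2R)
    (s w : EuclideanSpace ℝ (Fin n)) :
    (devForm C).contract (fun t γ => expPSL (-t • X) • γ) p s w =
      (X.1 * (thetaL (fun s' => (p s').q) s w + thetaR (fun s' => (p s').q) s w)).trace := by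
  have h' : IsNormalizedLift c (fun z => expPSL (-(z 0) • X) • p (tailL n z)) _ _ :=
    (h.reparam (tailL n) (tailL n).contDiff).smul
      (fun z => ⟨NormedSpace.exp (-(z 0) • X).1, det_exp_sl2 _⟩) (expEntry n X.1)
      fun _ _ _ _ => rfl
  have hp : ∀ s', expPSL (-(consL n s' 0) • X) • p (tailL n (consL n s')) = p s' := fun s' => by
    have e : expPSL (-(consL n s' 0) • X) = 1 := by
      rw [consL_zero, neg_zero, zero_smul, expPSL, ← QuotientGroup.mk_one]
      congr 1
      exact Subtype.ext NormedSpace.exp_zero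
    rw [e, tailL_consL]
    exact DevMap.ext_toFun fun x => one_smul PSL2R ((p s').toFun x)
  rw [contract_eq, h'.pull_eq, twoForm_of_linear h'.hasMonodromy h'.wronskian
    (LinearMap.mem_ker.1 X.2)]
  · simp only [hp, thetaL, thetaR, dMat_consL h' hp]
  · simp only [map_add, dir_mul, ds_expEntry, ds_reparam_tailL, Algebra.smul_def]
    ring
  · simp only [map_add, dir_mul, ds_expEntry, ds_reparam_tailL, Algebra.smul_def]
    ring

end Projective

/-! #### Contraction with the generators of the action of diffeomorphisms -/

section Flow

variable {C : CircleCover} {v : Vect C} {F : ℝ → Iso C C}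

/-- The additivity of the flow makes `F 0` an idempotent bijection. -/
theorem IsFlow.map_zero (hF : IsFlow v F) (x : C.X) : (F 0).toDiffeo x = x :=
  (F 0).toDiffeo.injective <| by
    change (F 0).toDiffeo ((F 0).toDiffeo x) = (F 0).toDiffeo x
    rw [← hF.add, add_zero]

theorem IsFlow.symm_eq (hF : IsFlow v F) (t : ℝ) (x : C.X) :
    (F t).toDiffeo.symm x = (F (-t)).toDiffeo x := by
  apply (F t).toDiffeo.injective
  change (F t).toDiffeo ((F t).toDiffeo.symm x) = (F t).toDiffeo ((F (-t)).toDiffeo x)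
  rw [Diffeomorph.apply_symm_apply, ← hF.add, add_neg_cancel, hF.map_zero]

variable (c : C.Param) {n : ℕ}

theorem IsFlow.contDiff_param (hF : IsFlow v F) :
    ContDiff ℝ ∞ fun y : ℝ × ℝ => c.inv ((F y.1).toDiffeo (c.map y.2)) := by
  have hg : ContMDiff (𝓘(ℝ, ℝ).prod 𝓘(ℝ, ℝ)) (𝓘(ℝ, ℝ).prod 𝓘(ℝ, ℝ)) ∞
      (fun y : ℝ × ℝ => (y.1, c.map y.2)) :=
    contMDiff_fst.prodMk ((Param.contMDiff_map c).comp contMDiff_snd)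
  have h := (Param.contMDiff_inv c).comp (hF.smooth.comp hg)
  rw [← modelWithCornersSelf_prod, chartedSpaceSelf_prod] at h
  exact h.contDiff

theorem IsFlow.hasDerivAt_param (hF : IsFlow v F) (x : ℝ) :
    HasDerivAt (fun t => c.inv ((F t).toDiffeo (c.map x))) (v.coeff c x) 0 := by
  have h1 := hF.integral (c.map x) 0
  have h2 := ((Param.contMDiff_inv c).mdifferentiable (by simp)
    ((F 0).toDiffeo (c.map x))).hasMFDerivAt.comp (0 : ℝ) h1
  have key : ∀ (A : ℝ →L[ℝ] ℝ) (u : ℝ), (A ∘L (1 : ℝ →L[ℝ] ℝ).smulRight u) 1 = A u :=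
    fun A u => by simp
  set A : ℝ →L[ℝ] ℝ := mfderiv 𝓘(ℝ, ℝ) 𝓘(ℝ, ℝ) c.inv ((F 0).toDiffeo (c.map x))
  set u : ℝ := v.toFun ((F 0).toDiffeo (c.map x))
  have h3 : HasFDerivAt (fun t => c.inv ((F t).toDiffeo (c.map x)))
    (A ∘L (1 : ℝ →L[ℝ] ℝ).smulRight u) 0 := h2.hasFDerivAt
  have h4 : HasDerivAt (fun t => c.inv ((F t).toDiffeo (c.map x)))
      (mfderiv 𝓘(ℝ, ℝ) 𝓘(ℝ, ℝ) c.inv ((F 0).toDiffeo (c.map x))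
        (v.toFun ((F 0).toDiffeo (c.map x)))) 0 := h3.hasDerivAt.congr_deriv (key A u)
  rw [hF.map_zero] at h4
  exact h4

/-- The inverse flow in a parametrization, with the first coordinate as time. -/
def flowFn (hF : IsFlow v F) (n : ℕ) : SmoothFn (EuclideanSpace ℝ (Fin (n + 1)) × ℝ) :=
  ⟨fun z => c.inv ((F (-(z.1 0))).toDiffeo (c.map z.2)), (hF.contDiff_param c).comp (by fun_prop :
    ContDiff ℝ ∞ fun z : EuclideanSpace ℝ (Fin (n + 1)) × ℝ => (-(z.1 0), z.2))⟩

theorem map_flowFn (hF : IsFlow v F) (s : EuclideanSpace ℝ (Fin (n + 1))) (x : ℝ) :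
    c.map ((flowFn c hF n).1 (s, x)) = (F (s 0)).toDiffeo.symm (c.map x) := by
  rw [hF.symm_eq]
  exact Param.map_inv c _

theorem flowFn_add_one (hF : IsFlow v F) (s : EuclideanSpace ℝ (Fin (n + 1))) (x : ℝ) :
    (flowFn c hF n).1 (s, x + 1) = (flowFn c hF n).1 (s, x) + 1 := by
  change c.inv ((F (-(s 0))).toDiffeo (c.map (x + 1))) =
    c.inv ((F (-(s 0))).toDiffeo (c.map x)) + 1
  rw [Param.map_add_one, (F _).map_κ, Param.inv_κ]

theorem flowFn_consL (hF : IsFlow v F) (s : EuclideanSpace ℝ (Fin n)) (x : ℝ) :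
    (flowFn c hF n).1 (consL n s, x) = x := by
  change c.inv ((F (-(consL n s 0))).toDiffeo (c.map x)) = x
  rw [consL_zero, neg_zero, hF.map_zero, Param.inv_map]

theorem dx_flowFn_pos (hF : IsFlow v F) (z : EuclideanSpace ℝ (Fin (n + 1)) × ℝ) :
    0 < (dx (flowFn c hF n)).1 z := by
  refine dx_pos_of_shift (flowFn_add_one c hF) (fun z h0 => ?_) z
  obtain ⟨s, x⟩ := z
  have h1 := hasDerivAt_snd (flowFn c hF n) s x
  have hg : ContDiff ℝ ∞ fun y => c.inv ((F (s 0)).toDiffeo (c.map y)) :=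
    (hF.contDiff_param c).comp (contDiff_const.prodMk contDiff_id)
  have h2 := ((hg.differentiable (by simp)).differentiableAt
    (x := (flowFn c hF n).1 (s, x))).hasDerivAt.comp x h1
  have e : (fun y => c.inv ((F (s 0)).toDiffeo (c.map y))) ∘
      (fun y => (flowFn c hF n).1 (s, y)) = id := funext fun y => by
    simp only [Function.comp_apply, map_flowFn, Diffeomorph.apply_symm_apply, Param.inv_map, id]
  rw [e, h0, mul_zero] at h2
  exact one_ne_zero ((hasDerivAt_id x).unique h2)

theorem dx_flowFn_consL (hF : IsFlow v F) (s : EuclideanSpace ℝ (Fin n)) (x : ℝ) :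
    (dx (flowFn c hF n)).1 (consL n s, x) = 1 := by
  have h := hasDerivAt_snd (flowFn c hF n) (consL n s) x
  simp only [flowFn_consL] at h
  exact h.unique (hasDerivAt_id x)

theorem ds_flowFn_consL (hF : IsFlow v F) (s : EuclideanSpace ℝ (Fin n)) (x : ℝ) :
    (ds (EuclideanSpace.single 0 1) (flowFn c hF n)).1 (consL n s, x) = -v.coeff c x := by
  set L : ℝ → EuclideanSpace ℝ (Fin (n + 1)) × ℝ :=
    fun t => (consL n s + t • EuclideanSpace.single 0 1, x) with hL
  have hL' : HasDerivAt L (EuclideanSpace.single 0 1, 0) 0 := by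
    have := (((hasDerivAt_id (0 : ℝ)).smul_const
      (EuclideanSpace.single (0 : Fin (n + 1)) (1 : ℝ))).const_add (consL n s)).prodMk
      (hasDerivAt_const (0 : ℝ) x)
    rw [one_smul] at this
    exact this
  have hL0 : L 0 = (consL n s, x) := by simp [hL]
  have h1 := ((flowFn c hF n).differentiableAt (L 0)).hasFDerivAt.comp_hasDerivAt 0 hL'
  rw [hL0] at h1
  have h2 : HasDerivAt (fun t => c.inv ((F (-t)).toDiffeo (c.map x))) (-v.coeff c x) 0 := by
    have h := hF.hasDerivAt_param c x
    rw [← neg_zero] at h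
    have := h.comp (0 : ℝ) (hasDerivAt_neg (0 : ℝ))
    rw [mul_neg_one] at this
    exact this
  have e : (flowFn c hF n).1 ∘ L = fun t => c.inv ((F (-t)).toDiffeo (c.map x)) :=
    funext fun t => by
      have : (L t).1 0 = t := by simp [hL, consL_zero]
      change c.inv ((F (-((L t).1 0))).toDiffeo (c.map x)) = _
      rw [this]
  rw [e] at h1
  exact h1.unique h2

/-- With `f` the inverse flow, the extended family has the lift given by substituting `f` and
rescaling. Its time variation is a periodic field, equal to −v at time 0, so `twoForm_of_periodic`
applies. -/
theorem IsNormalizedLift.contract_flow {p : EuclideanSpace ℝ (Fin n) → DevMap C}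
    {a b : SmoothFn (EuclideanSpace ℝ (Fin n) × ℝ)} {c : C.Param} (h : IsNormalizedLift c p a b)
    (hpot : ∀ s x, (p s).hillPotential c x = (pot dx a b).1 (s, x)) (hF : IsFlow v F)
    (s w : EuclideanSpace ℝ (Fin n)) :
    (devForm C).contract (fun t γ => diffAct (F t) γ) p s w = -2 * hillPairing c v p s w := by
  set f := flowFn c hF n with hf
  have hpos := dx_flowFn_pos c hF (n := n)
  set r := invSqrt (dx f) hpos with hr
  have h' : IsNormalizedLift c (fun z => diffAct (F (z 0)) (p (tailL n z))) _ _ :=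
    h.substFamily (tailL n).contDiff f (c' := c) hpos fun s x => by
      rw [map_flowFn]
      rfl
  have heps := eps_substFamily (tailL n).contDiff f h hpos (EuclideanSpace.single 0 1) fun s => by
    rw [ContinuousLinearMap.fderiv, tailL_single]
  -- The flow commutes with the deck transformation, so every derivative of `f`, the factor `r` and
  -- the generating field are periodic.
  have hshift : shift f = f + 1 := ext_val fun ⟨s, x⟩ => flowFn_add_one c hF s x
  have hdir : ∀ y, shift (dir y f) = dir y f := fun y => by
    rw [← dir_shift, hshift, map_add, Derivation.map_one_eq_zero, add_zero]
  have hrs : shift r = r := ext_val fun ⟨s, x⟩ => by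
    change ((shift (dx f)).1 (s, x)) ^ (-(1 / 2) : ℝ) = _
    rw [hdir]
    rfl
  have hr1 : ∀ s x, r.1 (consL n s, x) = 1 := fun s x => by
    change ((dx f).1 (consL n s, x)) ^ (-(1 / 2) : ℝ) = _
    rw [dx_flowFn_consL, Real.one_rpow]
  have hslice : ∀ (G : SmoothFn (EuclideanSpace ℝ (Fin n) × ℝ)) s x,
      (r * Virasoro.substFamily (tailL n).contDiff f G).1 (consL n s, x) = G.1 (s, x) := fun G s x => by
    rw [mul_val, hr1, one_mul]
    change G.1 (tailL n (consL n s), f.1 (consL n s, x)) = _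
    rw [flowFn_consL, tailL_consL]
  -- At time 0 the flow is the identity and `r = 1`, so the extended lift restricts to `a`, `b`
  -- there and has the potential of `p s`.
  have hT : ∀ s x, (pot dx (r * Virasoro.substFamily (tailL n).contDiff f a)
      (r * Virasoro.substFamily (tailL n).contDiff f b)).1 (consL n s, x) =
      (p s).hillPotential c x := fun s x => by
    have ha := dx_congr_slice (hslice a s)
    have hb := dx_congr_slice (hslice b s)
    rw [hpot]
    simp only [pot, sub_val, mul_val] at ha hb ⊢
    rw [ha, hb, dx_congr_slice ha, dx_congr_slice hb]
  rw [contract_eq, h'.pull_eq, twoForm_of_periodic h'.wronskian h'.hasMonodromy.shift_pot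
    (by rw [heps, map_mul, map_mul, hdir, hrs])]
  rw [hillPairing, neg_mul, ← mul_neg, ← intervalIntegral.integral_neg]
  congr 1
  refine intervalIntegral.integral_congr fun x _ => ?_
  have e1 : (r * r * ds (EuclideanSpace.single 0 1) f).1 (consL n s, x) = -v.coeff c x := by
    rw [mul_val, mul_val, hr1, ds_flowFn_consL, one_mul, one_mul]
  have e2 := (ds_consL (pot dx (r * Virasoro.substFamily (tailL n).contDiff f a)
      (r * Virasoro.substFamily (tailL n).contDiff f b)) s w x).trans
    (congrArg (fun G => fderiv ℝ G s w) (funext fun s' => hT s' x))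
  rw [heps]
  exact (congrArg₂ (· * ·) e1 e2).trans (by ring)

end Flow

end Virasoro

end

theorem mainTheorem2 :
    ∃ ϖ : ∀ C : CircleCover.{u}, DForm (DevMap C) 2,
      -- naturality
      (∀ (C₁ C₂ : CircleCover.{u}) (Φ : Iso C₁ C₂) (n : ℕ)
        (p : EuclideanSpace ℝ (Fin n) → DevMap C₂), Diffeology.IsPlot p →
        (ϖ C₁).pull (fun s => (p s).pullback Φ) = (ϖ C₂).pull p) ∧
      ∀ (C : CircleCover.{u}) (n : ℕ) (p : EuclideanSpace ℝ (Fin n) → DevMap C),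
        Diffeology.IsPlot p →
        -- exterior differential
        (∀ s w, extDeriv ((ϖ C).pull p) s w = cartanForm (fun s' => (p s').q) s w) ∧
        -- `PSL(2,ℝ)`-invariance and contractions
        (∀ g : PSL2R, (ϖ C).pull (fun s => g • p s) = (ϖ C).pull p) ∧
        (∀ (X : sl2R) (s w : EuclideanSpace ℝ (Fin n)),
          (ϖ C).contract (fun t γ => expPSL (-t • X) • γ) p s w =
            (X.1 * (thetaL (fun s' => (p s').q) s w + thetaR (fun s' => (p s').q) s w)).trace) ∧
        -- `Diff_ℤ`-invariance and contractions
        (∀ F : Iso C C, (ϖ C).pull (fun s => diffAct F (p s)) = (ϖ C).pull p) ∧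
        (∀ (v : Vect C) (F : ℝ → Iso C C), IsFlow v F →
          ∀ (c : C.Param) (s w : EuclideanSpace ℝ (Fin n)),
            (ϖ C).contract (fun t γ => diffAct (F t) γ) p s w = -2 * hillPairing c v p s w) := by
  refine ⟨fun C => devForm C, fun C₁ C₂ Φ n p hp => ?_, fun C n p hp => ?_⟩
  · obtain ⟨a, b, h, -⟩ := exists_normalizedLift C₂.param hp
    rw [h.pull_eq, (h.pullback Φ).pull_eq]
  · obtain ⟨a, b, h, -⟩ := exists_normalizedLift C.param hp
    refine ⟨h.extDeriv_pull, h.pull_smul, h.contract_exp, fun F => ?_, fun v F hF c s w => ?_⟩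
    · rw [h.pull_eq]
      exact (h.pullback F.symm).pull_eq
    -- The pairing is computed in the given parametrization `c`, so the lift is chosen anew in it
    -- instead of in `C.param`.
    · obtain ⟨a, b, h, hpot⟩ := exists_normalizedLift c hp
      exact h.contract_flow hpot hF s w
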